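/- **Setting.** Let $n\ge 0$, $r\ge 1$ be integers, $m>0$, $s\in\mathbb R$, and let $E=E_1\oplus E_2$ with $E_1=\mathbb R^{d_1}$, $E_2=\mathbb R^{d_2}$. Put $\langle\xi\rangle=\sqrt{m^2+|\xi|^2}$; $H^\sigma=H^\sigma(\mathbb R^n)$ is the space of real tempered distributions $f$ with $\|f\|_{H^\sigma}=\|\langle\xi\rangle^\sigma\hat f\|_{L^2}<\infty$, and $\|\varphi\|_{H^\sigma}=\sum_i\|\varphi^i\|_{H^\sigma}$ for vector-valued $\varphi$. Let $$L=\begin{pmatrix}\gamma^0\partial_0+P_1(\vec\partial)&0\\0&\partial_0^2+P_2(\vec\partial)\end{pmatrix},$$ where $\gamma^0$ is an invertible real $d_1\times d_1$ matrix, and $P_1,P_2$ are real matrices of polynomials of degree at most $r$ and $2r$ such that, for all $\xi\in\mathbb R^n$, $i(\gamma^0)^{-1}P_1(i\xi)$ is Hermitian and $P_2(i\xi)$ is positive Hermitian, with $$P_2(i\xi)\ge\alpha(\mu_0+|\xi|^{2r})$$ for some constants $\alpha>0$, $\mu_0\ge 0$. Let $I\subset\mathbb R$ be an interval with more than one point,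 and assume that $\mu_0>0$ or that $I$ is bounded. For $u:I\times\mathbb R^n\to E$ put $[u]_t=(u|_t,\partial_0u_2|_t)$. Let $\mathcal E_0^s(I)$ be the space of those $u\in C^0(I,H^s(\mathbb R^n,E))\cap C^1(I,H^{s-r}(\mathbb R^n,E))$ with $Lu=0$ weakly and with finite norm $\|u\|=\sup_{t\in I}\left(\|u|_t\|_{H^s}+\|\partial_0u_2|_t\|_{H^{s-r}}\right)$. Let $G$ be the $\mathrm{End}(E)$-valued Green function of $L$, i.e. $LG=0$ and $L(1_{\{x^0\ge0\}}G)=\delta_0\otimes 1_E$, and $G_y(x)=G(x-y)$. For a formal series $f=\sum_kf^{(k)}$ of homogeneous polynomial maps between normed spaces, $\|f^{(k)}\|_\otimes$ is the norm of the symmetric $k$-linear map that polarizes $f^{(k)}$, and $\rho_\otimes(f)\in[0,\infty]$ is the radius of convergence of $\sum_k\|f^{(k)}\|_\otimes z^k$. A family $(f_a)_{a\in A}$ of such series is a *normal family of analytic maps of multiradius $\rho$* if there is a real power series $\sum_kX^{(k)}z^k$ with radius of convergence equal to $\rho$ and $\|f_a^{(k)}\|_\otimes\le X^{(k)}$ for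 all $a,k$. The space $E_{(1)}=E\times E_2\times E^n$, in which $(u,\partial_0u_2,\vec\partial u)$ takes its values, and $E$ carry the supremum norms. **Proposition.** There is a constant $Q_s>0$, depending only on $n,m,s,r,d_1,d_2$, such that the following holds for all $L$, $\alpha$, $\mu_0$, $I$ as above. Let $N=(N_1,N_2)=\sum_kN^{(k)}$ be a real analytic map from $E_{(1)}$ to $E$ (a formal series with $\rho_\otimes(N)>0$) such that $N(0)=0$ and $N_1$ is a function of $u$ only. Assume that one of the following holds: 1. $N_2$ does not depend on $\partial u=(\partial_0u_2,\vec\partial u)$, and $s>n/2$; 2. $N_2$ is affine in $\partial u$, i.e. $N_2(u,\partial u)=J(u)+K(u)\partial u$ with $J,K$ real analytic near $0$, and $s>n/2>s-r\ge0$; 3. $s>n/2+1$ and, in addition (this is automatic if $r=1$ or $E_2=\{0\}$), $s-r>n/2$, or $s\ge r$ and $N_2$ is affine in $\partial_0u_2$ with coefficients real analytic in $(u,\vec\partial u)$ near $0$, or $N_2$ does not depend on $\partial_0u_2$. Then there is $\rho_\otimes(V)\in[0,\infty]$ with $Q_s\,\rho_\otimes(V)\ge\rho_\otimes(N)$ such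 that, for every $t\in I$ and every $\varphi\in\mathcal E_0^s(I)$ with $\|\varphi\|<\rho_\otimes(V)$, the quantity $$V_t(\varphi)=\int_{y^0=t}d\vec y\;G_y\,N(\varphi,\partial\varphi)(y)$$ is well defined and belongs to $\mathcal E_0^s(I)$: the series $N(\varphi,\partial\varphi)(t,\vec y)$ converges for almost every $\vec y$, its sum is in $L^2(\mathbb R^n,E)$, and for each $\tau\in I$ the convolution of $G(\tau-t,\cdot)$ with it (the Fourier multiplier with symbol $\hat G(\tau-t,\xi)$, whose value is in $L^2$) is $V_t(\varphi)|_\tau$. Moreover, the map $(t,\varphi)\mapsto V_t(\varphi)$ is continuous from $I\times\{\varphi\in\mathcal E_0^s(I):\|\varphi\|<\rho_\otimes(V)\}$ to $\mathcal E_0^s(I)$, and each $V_t$ is on this ball the sum of a formal series $\sum_kV_t^{(k)}$ such that $(V_t)_{t\in I}$ is a normal family of analytic maps of multiradius equal to $\rho_\otimes(V)$. -/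

import Mathlib

open MeasureTheory Set Filter Topology
open scoped ENNReal NNReal SchwartzMap FourierTransform LineDeriv BoundedContinuousFunction

noncomputable section

namespace LagrangeDuhamel

/-! ### Sobolev spaces -/

/-- The space `ℝⁿ` with its Euclidean structure. -/
abbrev Sp (n : ℕ) : Type := EuclideanSpace ℝ (Fin n)

/-- The weight `⟨ξ⟩^s = (m² + |ξ|²)^{s/2}`, written in the frequency variable `η = ξ / 2π` of
Mathlib's Fourier transform `∫ f(x) e^{-2πi x·η} dx`. The factor `(2π)^{n/2}` is the Jacobian of
`ξ = 2πη`, so that the `L²`-norm of the weight times the Fourier transform is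
`(∫ ⟨ξ⟩^{2s} |f̂(ξ)|² dξ)^{1/2}`, where `f̂(ξ) = ∫ f(x) e^{-i x·ξ} dx`. -/
def weight (n : ℕ) (m s : ℝ) (η : Sp n) : ℝ :=
  (2 * Real.pi) ^ ((n : ℝ) / 2) * (m ^ 2 + ‖(2 * Real.pi) • η‖ ^ 2) ^ (s / 2)

/-- A tempered distribution is real if it is real on real test functions. -/
def IsRealDist {n : ℕ} (T : 𝓢'(Sp n, ℂ)) : Prop :=
  ∀ f : 𝓢(Sp n, ℂ), (∀ x, (f x).im = 0) → (T f).im = 0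

/-- `g ∈ L²` is the weighted Fourier transform `⟨ξ⟩^s f̂` of the tempered distribution `T`. -/
def IsWeightedFourier (n : ℕ) (m s : ℝ) (T : 𝓢'(Sp n, ℂ))
    (g : Lp ℂ 2 (volume : Measure (Sp n))) : Prop :=
  TemperedDistribution.smulLeftCLM ℂ (fun η => (weight n m s η : ℂ)) (𝓕 T) =
    Lp.toTemperedDistribution g

theorem IsWeightedFourier.add {n : ℕ} {m s : ℝ} {T T' : 𝓢'(Sp n, ℂ)}
    {g g' : Lp ℂ 2 (volume : Measure (Sp n))} (h : IsWeightedFourier n m s T g)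
    (h' : IsWeightedFourier n m s T' g') : IsWeightedFourier n m s (T + T') (g + g') := by
  unfold IsWeightedFourier at *
  rw [← Lp.toTemperedDistributionCLM_apply] at *
  rw [FourierTransform.fourier_add, map_add, map_add, h, h']

theorem real_smul_dist {n : ℕ} (c : ℝ) (T : 𝓢'(Sp n, ℂ)) : c • T = (c : ℂ) • T := by
  ext f
  simp

theorem IsWeightedFourier.smul {n : ℕ} {m s : ℝ} (c : ℝ) {T : 𝓢'(Sp n, ℂ)}
    {g : Lp ℂ 2 (volume : Measure (Sp n))} (h : IsWeightedFourier n m s T g) :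
    IsWeightedFourier n m s (c • T) (c • g) := by
  have hc : c • g = (c : ℂ) • g := by
    rw [← algebraMap_smul ℂ c g]
    rfl
  unfold IsWeightedFourier at *
  rw [← Lp.toTemperedDistributionCLM_apply] at *
  rw [real_smul_dist, hc, FourierTransform.fourier_smul, map_smul, map_smul, h]

theorem IsWeightedFourier.zero (n : ℕ) (m s : ℝ) : IsWeightedFourier n m s 0 0 := by
  have := IsWeightedFourier.smul (n := n) (m := m) (s := s) 0
    (T := 0) (g := 0)
  unfold IsWeightedFourier
  rw [← Lp.toTemperedDistributionCLM_apply, FourierTransform.fourier_zero, map_zero, map_zero]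

theorem IsWeightedFourier.unique {n : ℕ} {m s : ℝ} {T : 𝓢'(Sp n, ℂ)}
    {g g' : Lp ℂ 2 (volume : Measure (Sp n))} (h : IsWeightedFourier n m s T g)
    (h' : IsWeightedFourier n m s T g') : g = g' := by
  have hinj := LinearMap.ker_eq_bot.1
    (Lp.ker_toTemperedDistributionCLM_eq_bot (F := ℂ) (E := Sp n) (μ := volume) (p := 2))
  apply hinj
  exact h.symm.trans h'

/-- The weights of exponents `s` and `-s` are inverse to each other up to a constant. -/
theorem weight_mul_weight_neg (n : ℕ) {m : ℝ} (hm : 0 < m) (s : ℝ) (η : Sp n) :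
    weight n m s η * weight n m (-s) η = ((2 * Real.pi) ^ ((n : ℝ) / 2)) ^ 2 := by
  have hpos : 0 < m ^ 2 + ‖(2 * Real.pi) • η‖ ^ 2 := by positivity
  have h1 : (m ^ 2 + ‖(2 * Real.pi) • η‖ ^ 2) ^ (s / 2) *
      (m ^ 2 + ‖(2 * Real.pi) • η‖ ^ 2) ^ (-s / 2) = 1 := by
    rw [← Real.rpow_add hpos, show s / 2 + -s / 2 = 0 by ring, Real.rpow_zero]
  unfold weight
  linear_combination ((2 * Real.pi) ^ ((n : ℝ) / 2)) ^ 2 * h1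

theorem weight_temperate (n : ℕ) {m : ℝ} (hm : 0 < m) (s : ℝ) :
    (fun η : Sp n => (weight n m s η : ℂ)).HasTemperateGrowth := by
  have h1 : (fun η : Sp n => (1 + ‖η‖ ^ 2) ^ (s / 2)).HasTemperateGrowth :=
    Function.hasTemperateGrowth_one_add_norm_sq_rpow (Sp n) (s / 2)
  have h2 : (fun η : Sp n => (2 * Real.pi / m) • η).HasTemperateGrowth :=
    ((2 * Real.pi / m) • ContinuousLinearMap.id ℝ (Sp n)).hasTemperateGrowth
  have h3 := h1.comp h2
  have h4 : (fun η : Sp n => weight n m s η) =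
      fun η => ((2 * Real.pi) ^ ((n : ℝ) / 2) * (m ^ 2) ^ (s / 2)) *
        (1 + ‖(2 * Real.pi / m) • η‖ ^ 2) ^ (s / 2) := by
    funext η
    unfold weight
    rw [mul_assoc, ← Real.mul_rpow (by positivity) (by positivity)]
    congr 2
    rw [norm_smul, norm_smul, Real.norm_of_nonneg (by positivity),
      Real.norm_of_nonneg (by positivity)]
    field_simp
  have h5 : (fun η : Sp n => weight n m s η).HasTemperateGrowth := by
    rw [h4]
    exact (Function.HasTemperateGrowth.const _).mul h3
  exact Function.HasTemperateGrowth.comp Function.Complex.hasTemperateGrowth_ofReal h5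

/-- A tempered distribution can be recovered from its weighted Fourier transform. -/
theorem IsWeightedFourier.apply {n : ℕ} {m : ℝ} (hm : 0 < m) {s : ℝ} {T : 𝓢'(Sp n, ℂ)}
    {g : Lp ℂ 2 (volume : Measure (Sp n))} (h : IsWeightedFourier n m s T g)
    (f : 𝓢(Sp n, ℂ)) :
    T f = ((((2 * Real.pi) ^ ((n : ℝ) / 2)) ^ 2 : ℝ) : ℂ)⁻¹ *
      (Lp.toTemperedDistribution g) (SchwartzMap.smulLeftCLM ℂ
        (fun η => (weight n m (-s) η : ℂ)) (𝓕⁻ f)) := by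
  have hc : ((((2 * Real.pi) ^ ((n : ℝ) / 2)) ^ 2 : ℝ) : ℂ) ≠ 0 := by
    have : (0 : ℝ) < ((2 * Real.pi) ^ ((n : ℝ) / 2)) ^ 2 := by positivity
    exact_mod_cast this.ne'
  have hw : (fun η : Sp n => (weight n m s η : ℂ)) * (fun η => (weight n m (-s) η : ℂ)) =
      fun _ => ((((2 * Real.pi) ^ ((n : ℝ) / 2)) ^ 2 : ℝ) : ℂ) := by
    funext η
    rw [Pi.mul_apply, ← Complex.ofReal_mul, weight_mul_weight_neg n hm]
  have h1 : (Lp.toTemperedDistribution g) (SchwartzMap.smulLeftCLM ℂ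
        (fun η => (weight n m (-s) η : ℂ)) (𝓕⁻ f)) =
      ((((2 * Real.pi) ^ ((n : ℝ) / 2)) ^ 2 : ℝ) : ℂ) * T f := by
    rw [← TemperedDistribution.smulLeftCLM_apply_apply, ← h,
      TemperedDistribution.smulLeftCLM_smulLeftCLM_apply (weight_temperate n hm s)
        (weight_temperate n hm (-s)), hw, TemperedDistribution.smulLeftCLM_const]
    simp [TemperedDistribution.fourier_apply]
  rw [h1, inv_mul_cancel_left₀ hc]

/-- The real Sobolev space `H^s(ℝⁿ)` as a set of tempered distributions. -/
def sobolevSubmodule (n : ℕ) (m s : ℝ) : Submodule ℝ 𝓢'(Sp n, ℂ) where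
  carrier := {T | IsRealDist T ∧ ∃ g, IsWeightedFourier n m s T g}
  add_mem' := by
    rintro T T' ⟨h1, g, hg⟩ ⟨h1', g', hg'⟩
    refine ⟨fun f hf => ?_, g + g', hg.add hg'⟩
    have e : (T + T') f = T f + T' f := rfl
    rw [e, Complex.add_im, h1 f hf, h1' f hf, add_zero]
  zero_mem' := ⟨fun f _ => by
    have e : (0 : 𝓢'(Sp n, ℂ)) f = 0 := rfl
    rw [e, Complex.zero_im], 0, IsWeightedFourier.zero n m s⟩
  smul_mem' := by
    rintro c T ⟨h1, g, hg⟩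
    refine ⟨fun f hf => ?_, c • g, hg.smul c⟩
    have e : (c • T) f = c • T f := rfl
    rw [e, Complex.smul_im, h1 f hf, smul_zero]

/-- The real Sobolev space `H^s(ℝⁿ)`; its norm is defined below. -/
def Sobolev (n : ℕ) (m s : ℝ) : Type := sobolevSubmodule n m s

namespace Sobolev

variable {n : ℕ} {m s : ℝ}

instance : AddCommGroup (Sobolev n m s) := inferInstanceAs (AddCommGroup (sobolevSubmodule n m s))

instance : Module ℝ (Sobolev n m s) := inferInstanceAs (Module ℝ (sobolevSubmodule n m s))

/-- The tempered distribution underlying an element of `H^s`. -/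
def toDist : Sobolev n m s →ₗ[ℝ] 𝓢'(Sp n, ℂ) := (sobolevSubmodule n m s).subtype

theorem exists_weighted (T : Sobolev n m s) : ∃ g, IsWeightedFourier n m s T.toDist g := T.2.2

/-- The function `⟨ξ⟩^s f̂ ∈ L²` of an element `f` of `H^s`. -/
def weighted : Sobolev n m s →ₗ[ℝ] Lp ℂ 2 (volume : Measure (Sp n)) where
  toFun T := T.exists_weighted.choose
  map_add' T T' := (T + T').exists_weighted.choose_spec.unique
    (T.exists_weighted.choose_spec.add T'.exists_weighted.choose_spec)
  map_smul' c T := (c • T).exists_weighted.choose_spec.unique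
    (T.exists_weighted.choose_spec.smul c)

theorem weighted_spec (T : Sobolev n m s) : IsWeightedFourier n m s T.toDist T.weighted :=
  T.exists_weighted.choose_spec

theorem weighted_injective [hm : Fact (0 < m)] :
    Function.Injective (weighted : Sobolev n m s → Lp ℂ 2 (volume : Measure (Sp n))) := by
  intro T T' h
  apply Subtype.ext
  change T.toDist = T'.toDist
  ext f
  rw [T.weighted_spec.apply hm.out f, T'.weighted_spec.apply hm.out f, h]

variable [hm : Fact (0 < m)]

/-- The norm `‖f‖_{H^s} = ‖⟨ξ⟩^s f̂‖_{L²}`. -/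
instance : NormedAddCommGroup (Sobolev n m s) :=
  NormedAddCommGroup.induced (Sobolev n m s) (Lp ℂ 2 (volume : Measure (Sp n))) weighted
    weighted_injective

theorem norm_def (T : Sobolev n m s) : ‖T‖ = ‖T.weighted‖ := rfl

instance : NormedSpace ℝ (Sobolev n m s) where
  norm_smul_le c T := by
    rw [norm_def, norm_def, map_smul, norm_smul]

theorem continuous_toDist : Continuous (toDist : Sobolev n m s → 𝓢'(Sp n, ℂ)) := by
  apply PointwiseConvergenceCLM.continuous_of_continuous_eval
  intro f
  have hw : Continuous (weighted : Sobolev n m s → Lp ℂ 2 (volume : Measure (Sp n))) := by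
    refine AddMonoidHomClass.continuous_of_bound (weighted (n := n) (m := m) (s := s)) 1 ?_
    intro T
    rw [norm_def, one_mul]
  simp_rw [fun T : Sobolev n m s => T.weighted_spec.apply hm.out f]
  refine continuous_const.mul ?_
  have h2 := (Lp.toTemperedDistributionCLM ℂ (volume : Measure (Sp n)) 2).continuous.comp hw
  exact (ContinuousEvalConst.continuous_eval_const
    (SchwartzMap.smulLeftCLM ℂ (fun η => (weight n m (-s) η : ℂ)) (𝓕⁻ f))).comp h2

end Sobolev

/-! ### The linear operator `L` -/

/-- The differential operator `p(∂₁, …, ∂ₙ)` acting on tempered distributions. -/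
def polyDiff {n : ℕ} (p : MvPolynomial (Fin n) ℝ) : 𝓢'(Sp n, ℂ) →L[ℂ] 𝓢'(Sp n, ℂ) :=
  ∑ a ∈ p.support, ((p.coeff a : ℝ) : ℂ) •
    ((List.finRange n).map fun j =>
      (LineDeriv.lineDerivOpCLM ℂ 𝓢'(Sp n, ℂ) (EuclideanSpace.single j (1 : ℝ))) ^ (a j)).prod

/-- The symbol `p(iξ)`. -/
def symbol {n : ℕ} (p : MvPolynomial (Fin n) ℝ) (ξ : Sp n) : ℂ :=
  MvPolynomial.aeval (fun j => Complex.I * (ξ j : ℂ)) p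

/-- The matrix `P(iξ)`. -/
def symbolMat {n d : ℕ} (P : Matrix (Fin d) (Fin d) (MvPolynomial (Fin n) ℝ)) (ξ : Sp n) :
    Matrix (Fin d) (Fin d) ℂ :=
  P.map fun p => symbol p ξ

open scoped ComplexOrder in
/-- The operators `L = (γ⁰∂₀ + P₁(∂)) ⊕ (∂₀² + P₂(∂))` on maps with values in
`E = E₁ ⊕ E₂ = ℝ^{d₁} ⊕ ℝ^{d₂}`, where `γ⁰` is invertible, `P₁` and `P₂` have degree at most `r`
and `2r`, `i(γ⁰)⁻¹P₁(iξ)` is Hermitian and `P₂(iξ)` is positive Hermitian. -/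
structure LinOp (n r d₁ d₂ : ℕ) where
  γ : Matrix (Fin d₁) (Fin d₁) ℝ
  P₁ : Matrix (Fin d₁) (Fin d₁) (MvPolynomial (Fin n) ℝ)
  P₂ : Matrix (Fin d₂) (Fin d₂) (MvPolynomial (Fin n) ℝ)
  isUnit_γ : IsUnit γ
  degree_P₁ : ∀ i j, (P₁ i j).totalDegree ≤ r
  degree_P₂ : ∀ i j, (P₂ i j).totalDegree ≤ 2 * r
  hermitian : ∀ ξ : Sp n,
    (Complex.I • ((γ.map Complex.ofReal)⁻¹ * symbolMat P₁ ξ)).IsHermitian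
  positive : ∀ ξ : Sp n, (symbolMat P₂ ξ).PosSemidef

open scoped ComplexOrder in
/-- The lower bound `P₂(iξ) ≥ α(μ₀ + |ξ|^{2r})` in the sense of Hermitian operators. -/
def LinOp.LowerBound {n r d₁ d₂ : ℕ} (L : LinOp n r d₁ d₂) (α μ₀ : ℝ) : Prop :=
  ∀ ξ : Sp n, (symbolMat L.P₂ ξ -
    ((α * (μ₀ + ‖ξ‖ ^ (2 * r)) : ℝ) : ℂ) • (1 : Matrix (Fin d₂) (Fin d₂) ℂ)).PosSemidef

/-! ### The function spaces -/

/-- `H^s(ℝⁿ, ℝ^ι)` with the norm `∑ᵢ ‖φⁱ‖_{H^s}`. -/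
abbrev SobolevVec (n : ℕ) (m s : ℝ) [Fact (0 < m)] (ι : Type) [Fintype ι] : Type :=
  PiLp 1 fun _ : ι => Sobolev n m s

/-- The Cauchy data `Cau^s = H^s(ℝⁿ, E) × H^{s-r}(ℝⁿ, E₂)` with the norm
`‖(ψ, χ)‖ = ‖ψ‖_{H^s} + ‖χ‖_{H^{s-r}}`. -/
abbrev Cau (n r d₁ d₂ : ℕ) (m s : ℝ) [Fact (0 < m)] : Type :=
  WithLp 1 (SobolevVec n m s (Fin d₁ ⊕ Fin d₂) × SobolevVec n m (s - r) (Fin d₂))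

/-- The space `𝓕^s(I) = C⁰(I, H^s(ℝⁿ, E)) ∩ C¹(I, H^{s-r}(ℝⁿ, E))` with the norm
`sup_{t ∈ I} ‖[u]_t‖_{Cau^s}` (in particular this norm is finite on its elements).
A function `u` is encoded by the bounded continuous function `w : t ↦ [u]_t = (u|_t, ∂₀u₂|_t)`
of its Cauchy data: `w` is the function of Cauchy data of `u = w.1` iff `u`, seen as a map with
values in `H^{s-r}(ℝⁿ, E)`, is continuously differentiable on `I` and the `E₂`-part of its
derivative is `w.2`. -/
def FSpace (n r d₁ d₂ : ℕ) (m s : ℝ) [Fact (0 < m)] (I : Set ℝ) :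
    Submodule ℝ (I →ᵇ Cau n r d₁ d₂ m s) where
  carrier := {w | ∃ u v : ℝ → SobolevVec n m (s - r) (Fin d₁ ⊕ Fin d₂),
    (∀ (t : I) i, (u t i).toDist = ((w t).fst i).toDist) ∧
    (∀ t ∈ I, HasDerivWithinAt u (v t) I t) ∧ ContinuousOn v I ∧
    ∀ (t : I) j, v t (Sum.inr j) = (w t).snd j}
  add_mem' := by
    rintro w w' ⟨u, v, h1, h2, h3, h4⟩ ⟨u', v', h1', h2', h3', h4'⟩
    refine ⟨fun t => u t + u' t, fun t => v t + v' t, fun t i => ?_,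
      fun t ht => (h2 t ht).add (h2' t ht), h3.add h3', fun t j => ?_⟩
    · simp [h1 t i, h1' t i]
    · simp [h4 t j, h4' t j]
  zero_mem' := ⟨0, 0, fun t i => by simp, fun t _ => hasDerivWithinAt_const t I 0,
    continuousOn_const, fun t j => by simp⟩
  smul_mem' := by
    rintro c w ⟨u, v, h1, h2, h3, h4⟩
    refine ⟨fun t => c • u t, fun t => c • v t, fun t i => ?_,
      fun t ht => (h2 t ht).const_smul c, h3.const_smul c, fun t j => ?_⟩
    · simp [h1 t i]
    · simp [h4 t j]

variable {n r d₁ d₂ : ℕ} {m s : ℝ} [hm : Fact (0 < m)] {I : Set ℝ}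

/-- The component `u^i|_t`, a tempered distribution on `ℝⁿ`. -/
def comp (w : I →ᵇ Cau n r d₁ d₂ m s) (t : I) (i : Fin d₁ ⊕ Fin d₂) : 𝓢'(Sp n, ℂ) :=
  ((w t).fst i).toDist

/-- The component `∂₀u₂^j|_t`, a tempered distribution on `ℝⁿ`. -/
def timeDeriv (w : I →ᵇ Cau n r d₁ d₂ m s) (t : I) (j : Fin d₂) : 𝓢'(Sp n, ℂ) :=
  ((w t).snd j).toDist

/-- Lebesgue measure on `I`. -/
abbrev vol (I : Set ℝ) : Measure I := Measure.comap Subtype.val volume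

/-- `γ⁰∂₀u₁ + P₁(∂)u₁ = 0` in the sense of distributions on `interior I × ℝⁿ`, tested against
the products `θ(t) f(x)` (which span a dense space of test functions). -/
def WeakEq₁ (L : LinOp n r d₁ d₂) (w : I →ᵇ Cau n r d₁ d₂ m s) : Prop :=
  ∀ θ : ℝ → ℝ, ContDiff ℝ (⊤ : ℕ∞) θ → HasCompactSupport θ → tsupport θ ⊆ interior I →
    ∀ (f : 𝓢(Sp n, ℂ)) (i : Fin d₁),
      (∫ t : I, ((-deriv θ (t : ℝ) : ℝ) : ℂ) *
          ∑ j, (L.γ i j : ℂ) * comp w t (Sum.inl j) f ∂vol I) +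
        ∫ t : I, ((θ (t : ℝ) : ℝ) : ℂ) *
          ∑ j, polyDiff (L.P₁ i j) (comp w t (Sum.inl j)) f ∂vol I = 0

/-- `∂₀²u₂ + P₂(∂)u₂ = 0` in the sense of distributions on `interior I × ℝⁿ`. -/
def WeakEq₂ (L : LinOp n r d₁ d₂) (w : I →ᵇ Cau n r d₁ d₂ m s) : Prop :=
  ∀ θ : ℝ → ℝ, ContDiff ℝ (⊤ : ℕ∞) θ → HasCompactSupport θ → tsupport θ ⊆ interior I →
    ∀ (f : 𝓢(Sp n, ℂ)) (i : Fin d₂),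
      (∫ t : I, ((deriv (deriv θ) (t : ℝ) : ℝ) : ℂ) * comp w t (Sum.inr i) f ∂vol I) +
        ∫ t : I, ((θ (t : ℝ) : ℝ) : ℂ) *
          ∑ j, polyDiff (L.P₂ i j) (comp w t (Sum.inr j)) f ∂vol I = 0

/-- A continuous linear functional of the Cauchy data is integrable against a continuous compactly
supported function of time. -/
theorem integrable_pairing [hI : I.OrdConnected] {θ : ℝ → ℝ} (hθ : Continuous θ)
    (hθ' : HasCompactSupport θ) (ℓ : Cau n r d₁ d₂ m s →L[ℝ] ℂ)
    (w : I →ᵇ Cau n r d₁ d₂ m s) :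
    Integrable (fun t : I => ((θ (t : ℝ) : ℝ) : ℂ) * ℓ (w t)) (vol I) := by
  have h1 : Integrable (fun t : ℝ => (θ t : ℂ)) :=
    (hθ.integrable_of_hasCompactSupport hθ').ofReal
  have h2 : Integrable (fun t : I => ((θ (t : ℝ) : ℝ) : ℂ)) (vol I) :=
    (integrableOn_iff_comap_subtypeVal hI.measurableSet).1 h1.integrableOn
  refine h2.mul_bdd (c := ‖ℓ‖ * ‖w‖) ?_ ?_
  · exact (ℓ.continuous.comp w.continuous).aestronglyMeasurable
  · exact Eventually.of_forall fun t =>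
      (ℓ.le_opNorm _).trans (by gcongr; exact w.norm_coe_le_norm t)

/-- The `w` that solve a weak equation form a linear subspace. -/
def weakSubmodule [I.OrdConnected] {θ θ' : ℝ → ℝ} (hθ : Continuous θ)
    (hθc : HasCompactSupport θ) (hθ' : Continuous θ') (hθc' : HasCompactSupport θ')
    (ℓ ℓ' : Cau n r d₁ d₂ m s →L[ℝ] ℂ) : Submodule ℝ (I →ᵇ Cau n r d₁ d₂ m s) where
  carrier := {w | (∫ t : I, ((θ (t : ℝ) : ℝ) : ℂ) * ℓ (w t) ∂vol I) +
    ∫ t : I, ((θ' (t : ℝ) : ℝ) : ℂ) * ℓ' (w t) ∂vol I = 0}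
  add_mem' := by
    intro w w' h h'
    have e : (∫ t : I, ((θ (t : ℝ) : ℝ) : ℂ) * ℓ ((w + w') t) ∂vol I) =
        (∫ t : I, ((θ (t : ℝ) : ℝ) : ℂ) * ℓ (w t) ∂vol I) +
        ∫ t : I, ((θ (t : ℝ) : ℝ) : ℂ) * ℓ (w' t) ∂vol I := by
      rw [← integral_add (integrable_pairing hθ hθc ℓ w) (integrable_pairing hθ hθc ℓ w')]
      simp only [BoundedContinuousFunction.coe_add, Pi.add_apply, map_add, mul_add]
    have e' : (∫ t : I, ((θ' (t : ℝ) : ℝ) : ℂ) * ℓ' ((w + w') t) ∂vol I) =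
        (∫ t : I, ((θ' (t : ℝ) : ℝ) : ℂ) * ℓ' (w t) ∂vol I) +
        ∫ t : I, ((θ' (t : ℝ) : ℝ) : ℂ) * ℓ' (w' t) ∂vol I := by
      rw [← integral_add (integrable_pairing hθ' hθc' ℓ' w) (integrable_pairing hθ' hθc' ℓ' w')]
      simp only [BoundedContinuousFunction.coe_add, Pi.add_apply, map_add, mul_add]
    simp only [mem_ofPred_eq] at h h' ⊢
    rw [e, e']
    linear_combination h + h'
  zero_mem' := by simp
  smul_mem' := by
    intro c w h
    have e : ∀ (θ : ℝ → ℝ) (ℓ : Cau n r d₁ d₂ m s →L[ℝ] ℂ),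
        (∫ t : I, ((θ (t : ℝ) : ℝ) : ℂ) * ℓ ((c • w) t) ∂vol I) =
        (c : ℂ) * ∫ t : I, ((θ (t : ℝ) : ℝ) : ℂ) * ℓ (w t) ∂vol I := by
      intro θ ℓ
      rw [← integral_const_mul]
      congr 1
      funext t
      rw [BoundedContinuousFunction.coe_smul, map_smul, Complex.real_smul]
      ring
    simp only [mem_ofPred_eq] at h ⊢
    rw [e, e, ← mul_add, h, mul_zero]

/-- Cauchy data `↦ ⟨∑ⱼ Aⱼ uʲ, f⟩` as a continuous linear functional. -/
def pairing {κ : Type} [Fintype κ] (e : κ → Fin d₁ ⊕ Fin d₂)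
    (A : κ → 𝓢'(Sp n, ℂ) →L[ℂ] 𝓢'(Sp n, ℂ)) (f : 𝓢(Sp n, ℂ)) :
    Cau n r d₁ d₂ m s →L[ℝ] ℂ where
  toFun c := ∑ j, A j ((c.fst (e j)).toDist) f
  map_add' c c' := by
    rw [← Finset.sum_add_distrib]
    refine Finset.sum_congr rfl fun j _ => ?_
    have h : ((c + c').fst (e j)).toDist = (c.fst (e j)).toDist + (c'.fst (e j)).toDist := by
      simp
    rw [h, map_add]
    rfl
  map_smul' a c := by
    simp only [Finset.smul_sum, RingHom.id_apply]
    refine Finset.sum_congr rfl fun j _ => ?_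
    have h : ((a • c).fst (e j)).toDist = (a : ℂ) • (c.fst (e j)).toDist := by
      rw [← real_smul_dist]
      simp
    rw [h, map_smul]
    rfl
  cont := by
    refine continuous_finsetSum _ fun j _ => ?_
    refine (ContinuousEvalConst.continuous_eval_const f).comp ((A j).continuous.comp ?_)
    refine Sobolev.continuous_toDist.comp ?_
    fun_prop

theorem weakEq₁_iff [I.OrdConnected] (L : LinOp n r d₁ d₂) (w : I →ᵇ Cau n r d₁ d₂ m s) :
    WeakEq₁ L w ↔ ∀ (θ : ℝ → ℝ) (h : ContDiff ℝ (⊤ : ℕ∞) θ) (hc : HasCompactSupport θ),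
      tsupport θ ⊆ interior I → ∀ (f : 𝓢(Sp n, ℂ)) (i : Fin d₁),
      w ∈ weakSubmodule (θ := fun t => -deriv θ t) (h.continuous_deriv (by simp)).neg hc.deriv.neg
        h.continuous hc
        (pairing Sum.inl (fun j => (L.γ i j : ℂ) • ContinuousLinearMap.id ℂ 𝓢'(Sp n, ℂ)) f)
        (pairing Sum.inl (fun j => polyDiff (L.P₁ i j)) f) :=
  Iff.rfl

theorem weakEq₂_iff [I.OrdConnected] (L : LinOp n r d₁ d₂) (w : I →ᵇ Cau n r d₁ d₂ m s) :
    WeakEq₂ L w ↔ ∀ (θ : ℝ → ℝ) (h : ContDiff ℝ (⊤ : ℕ∞) θ) (hc : HasCompactSupport θ),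
      tsupport θ ⊆ interior I → ∀ (f : 𝓢(Sp n, ℂ)) (i : Fin d₂),
      w ∈ weakSubmodule (θ := fun t => deriv (deriv θ) t)
        ((contDiff_infty_iff_deriv.1 h).2.continuous_deriv (by simp)) hc.deriv.deriv
        h.continuous hc
        (pairing (κ := Unit) (fun _ => Sum.inr i)
          (fun _ => ContinuousLinearMap.id ℂ 𝓢'(Sp n, ℂ)) f)
        (pairing Sum.inr (fun j => polyDiff (L.P₂ i j)) f) := by
  simp [WeakEq₂, weakSubmodule, pairing, comp]

/-- The space `𝓔₀^s(I)` of the weak solutions `u ∈ 𝓕^s(I)` of `Lu = 0`, with the norm of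
`𝓕^s(I)`. -/
def E0 (L : LinOp n r d₁ d₂) (m s : ℝ) [Fact (0 < m)] (I : Set ℝ) [I.OrdConnected] :
    Submodule ℝ (I →ᵇ Cau n r d₁ d₂ m s) where
  carrier := {w | w ∈ FSpace n r d₁ d₂ m s I ∧ WeakEq₁ L w ∧ WeakEq₂ L w}
  add_mem' := by
    rintro w w' ⟨h1, h2, h3⟩ ⟨h1', h2', h3'⟩
    rw [weakEq₁_iff] at h2 h2'
    rw [weakEq₂_iff] at h3 h3'
    refine ⟨add_mem h1 h1', (weakEq₁_iff L _).2 ?_, (weakEq₂_iff L _).2 ?_⟩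
    · exact fun θ h hc hs f i => add_mem (h2 θ h hc hs f i) (h2' θ h hc hs f i)
    · exact fun θ h hc hs f i => add_mem (h3 θ h hc hs f i) (h3' θ h hc hs f i)
  zero_mem' := by
    refine ⟨zero_mem _, (weakEq₁_iff L _).2 ?_, (weakEq₂_iff L _).2 ?_⟩
    · exact fun θ h hc hs f i => zero_mem _
    · exact fun θ h hc hs f i => zero_mem _
  smul_mem' := by
    rintro c w ⟨h1, h2, h3⟩
    rw [weakEq₁_iff] at h2
    rw [weakEq₂_iff] at h3
    refine ⟨Submodule.smul_mem _ c h1, (weakEq₁_iff L _).2 ?_, (weakEq₂_iff L _).2 ?_⟩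
    · exact fun θ h hc hs f i => Submodule.smul_mem _ c (h2 θ h hc hs f i)
    · exact fun θ h hc hs f i => Submodule.smul_mem _ c (h3 θ h hc hs f i)

/-! ### Formal series and analytic maps -/

section Series

variable {X Y : Type*} [NormedAddCommGroup X] [NormedSpace ℝ X] [NormedAddCommGroup Y]
  [NormedSpace ℝ Y]

/-- The formal series whose terms are symmetric multilinear maps. The multiradius of convergence
`ρ_⊗` of such a series is `FormalMultilinearSeries.radius`, since the norm of its `k`-th term is
the smallest `C ≥ 0` with `‖f(φ₁, …, φₖ)‖ ≤ C ‖φ₁‖ ⋯ ‖φₖ‖`. -/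
def IsSymmetricSeries (p : FormalMultilinearSeries ℝ X Y) : Prop :=
  ∀ (k : ℕ) (σ : Equiv.Perm (Fin k)) (x : Fin k → X), (p k fun i => x (σ i)) = p k x

/-- The open ball of center `0` and radius `ρ ∈ [0, ∞]`. -/
def oball (X : Type*) [NormedAddCommGroup X] (ρ : ℝ≥0∞) : Set X := {x | (‖x‖₊ : ℝ≥0∞) < ρ}

/-- A normal family `(f_a)` of analytic maps of multiradius `ρ`: the homogeneous parts of the `f_a`
are dominated by the coefficients of one real power series with radius of convergence `ρ`. -/
def IsNormalFamily {A : Type*} (f : A → X → Y) (ρ : ℝ≥0∞) : Prop :=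
  ∃ p : A → FormalMultilinearSeries ℝ X Y,
    (∀ a, IsSymmetricSeries (p a)) ∧
    (∀ a, ∀ x ∈ oball X ρ, HasSum (fun k => p a k fun _ => x) (f a x)) ∧
    ∃ c : ℕ → ℝ, (FormalMultilinearSeries.ofScalars ℝ c).radius = ρ ∧ ∀ a k, ‖p a k‖ ≤ c k

end Series

/-! ### The nonlinearity -/

/-- `E = E₁ ⊕ E₂`, with `E₁ = ℝ^{d₁}` and `E₂ = ℝ^{d₂}`. -/
abbrev Target (d₁ d₂ : ℕ) : Type := Fin d₁ ⊕ Fin d₂ → ℝ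

/-- `E₍₁₎ = E × E₂ × 𝓛(ℝⁿ, E)`: the values of `(u, ∂₀u₂, (∂₁u, …, ∂ₙu))`, with the supremum
norm. -/
abbrev JetSpace (n d₁ d₂ : ℕ) : Type :=
  Target d₁ d₂ × (Fin d₂ → ℝ) × (Fin n → Target d₁ d₂)

/-- The `E₂`-part of a value. -/
def part₂ (z : Target d₁ d₂) : Fin d₂ → ℝ := fun j => z (Sum.inr j)

/-- `N₁` is a function of `u` only. -/
def FirstPartIndep (N : FormalMultilinearSeries ℝ (JetSpace n d₁ d₂) (Target d₁ d₂)) : Prop :=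
  ∀ (k : ℕ) (z : JetSpace n d₁ d₂) (i : Fin d₁),
    N k (fun _ => z) (Sum.inl i) = N k (fun _ => (z.1, 0, 0)) (Sum.inl i)

/-- `N₂` does not depend on `∂u`. -/
def SecondPartIndep (N : FormalMultilinearSeries ℝ (JetSpace n d₁ d₂) (Target d₁ d₂)) : Prop :=
  ∀ (k : ℕ) (z : JetSpace n d₁ d₂),
    part₂ (N k fun _ => z) = part₂ (N k fun _ => (z.1, 0, 0))

/-- `N₂` does not depend on `∂₀u₂`. -/
def SecondPartIndepTime (N : FormalMultilinearSeries ℝ (JetSpace n d₁ d₂) (Target d₁ d₂)) :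
    Prop :=
  ∀ (k : ℕ) (z : JetSpace n d₁ d₂),
    part₂ (N k fun _ => z) = part₂ (N k fun _ => (z.1, 0, z.2.2))

/-- `N₂` is affine in `∂u`: `N₂(u, ∂u) = J(u) + K(u)∂u` with `J`, `K` real analytic. -/
def SecondPartAffine (N : FormalMultilinearSeries ℝ (JetSpace n d₁ d₂) (Target d₁ d₂)) : Prop :=
  ∃ (J : Target d₁ d₂ → Fin d₂ → ℝ)
    (K : Target d₁ d₂ → (Fin d₂ → ℝ) × (Fin n → Target d₁ d₂) →L[ℝ] (Fin d₂ → ℝ)),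
    AnalyticAt ℝ J 0 ∧ AnalyticAt ℝ K 0 ∧
      ∀ᶠ z in 𝓝 (0 : JetSpace n d₁ d₂), part₂ (N.sum z) = J z.1 + K z.1 z.2

/-- `N₂` is affine in `∂₀u₂`, with coefficients that are real analytic in `u` and its spatial
derivatives. -/
def SecondPartAffineTime (N : FormalMultilinearSeries ℝ (JetSpace n d₁ d₂) (Target d₁ d₂)) :
    Prop :=
  ∃ (J : Target d₁ d₂ × (Fin n → Target d₁ d₂) → Fin d₂ → ℝ)
    (K : Target d₁ d₂ × (Fin n → Target d₁ d₂) → (Fin d₂ → ℝ) →L[ℝ] (Fin d₂ → ℝ)),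
    AnalyticAt ℝ J 0 ∧ AnalyticAt ℝ K 0 ∧
      ∀ᶠ z in 𝓝 (0 : JetSpace n d₁ d₂),
        part₂ (N.sum z) = J (z.1, z.2.2) + K (z.1, z.2.2) z.2.1

/-! ### The Lagrange–Duhamel vector field -/

open Classical in
/-- A function representing the real tempered distribution `T` if `T` is in `L²` (and `0`
otherwise). -/
def representative (T : 𝓢'(Sp n, ℂ)) (y : Sp n) : ℝ :=
  if h : ∃ g : Lp ℂ 2 (volume : Measure (Sp n)), T = Lp.toTemperedDistribution g then
    (h.choose y).re
  else 0

/-- The value `(φ, ∂φ)(t, y) = (φ, ∂₀φ₂, ∂₁φ, …, ∂ₙφ)(t, y)`. -/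
def jet (φ : I →ᵇ Cau n r d₁ d₂ m s) (t : I) (y : Sp n) : JetSpace n d₁ d₂ :=
  (fun i => representative (comp φ t i) y,
   fun j => representative (timeDeriv φ t j) y,
   fun k i => representative (∂_{EuclideanSpace.single k (1 : ℝ)} (comp φ t i)) y)

/-- The spatial Fourier transform `Ĝ₁(τ, ξ)` of the `E₁`-part of `G`: the solution of
`γ⁰∂_τĜ₁ + P₁(iξ)Ĝ₁ = 0` with `Ĝ₁(0, ξ) = (γ⁰)⁻¹`. -/
def greenHat₁ (L : LinOp n r d₁ d₂) (τ : ℝ) (ξ : Sp n) : Matrix (Fin d₁) (Fin d₁) ℂ :=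
  NormedSpace.exp ((-τ : ℂ) • ((L.γ.map Complex.ofReal)⁻¹ * symbolMat L.P₁ ξ)) *
    (L.γ.map Complex.ofReal)⁻¹

/-- The spatial Fourier transform `Ĝ₂(τ, ξ)` of the `E₂`-part of `G`: the solution of
`∂_τ²Ĝ₂ + P₂(iξ)Ĝ₂ = 0` with `Ĝ₂(0, ξ) = 0` and `∂_τĜ₂(0, ξ) = 1`, obtained from the propagator
of the associated first-order system. -/
def greenHat₂ (L : LinOp n r d₁ d₂) (τ : ℝ) (ξ : Sp n) : Matrix (Fin d₂) (Fin d₂) ℂ :=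
  (NormedSpace.exp ((τ : ℂ) •
    (Matrix.fromBlocks 0 1 (-symbolMat L.P₂ ξ) 0 :
      Matrix (Fin d₂ ⊕ Fin d₂) (Fin d₂ ⊕ Fin d₂) ℂ))).toBlocks₁₂

open scoped Matrix.Norms.Operator in
/-- The derivative of an entry of `exp(τA)`. -/
theorem hasDerivAt_exp_entry {ι : Type} [Fintype ι] [DecidableEq ι] (A : Matrix ι ι ℂ) (τ : ℝ)
    (i j : ι) : HasDerivAt (fun τ : ℝ => (NormedSpace.exp ((τ : ℂ) • A)) i j)
      ((A * NormedSpace.exp ((τ : ℂ) • A)) i j) τ := by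
  have h : HasDerivAt (fun u : ℂ => NormedSpace.exp (u • A))
      (A * NormedSpace.exp ((τ : ℂ) • A)) (τ : ℂ) := hasDerivAt_exp_smul_const' A (τ : ℂ)
  have h2 : HasDerivAt (fun u : ℂ => (NormedSpace.exp (u • A)) i j)
      ((A * NormedSpace.exp ((τ : ℂ) • A)) i j) (τ : ℂ) :=
    hasDerivAt_pi.1 (hasDerivAt_pi.1 h i) j
  exact h2.comp_ofReal

/-- `Ĝ₁` has the defining property of the Green function of `γ⁰∂₀ + P₁(∂)`. -/
theorem greenHat₁_spec (L : LinOp n r d₁ d₂) (ξ : Sp n) :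
    greenHat₁ L 0 ξ = (L.γ.map Complex.ofReal)⁻¹ ∧
    ∀ τ i j, HasDerivAt (fun τ => greenHat₁ L τ ξ i j)
      (-((L.γ.map Complex.ofReal)⁻¹ * symbolMat L.P₁ ξ * greenHat₁ L τ ξ) i j) τ := by
  refine ⟨by simp [greenHat₁], fun τ i j => ?_⟩
  set A := (L.γ.map Complex.ofReal)⁻¹ * symbolMat L.P₁ ξ with hA
  set B := (L.γ.map Complex.ofReal)⁻¹
  have e : ∀ τ : ℝ, greenHat₁ L τ ξ = NormedSpace.exp ((τ : ℂ) • (-A)) * B := by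
    intro τ
    rw [greenHat₁, ← hA, smul_neg, neg_smul]
  have h : HasDerivAt (fun τ : ℝ => ∑ k, NormedSpace.exp ((τ : ℂ) • (-A)) i k * B k j)
      (∑ k, (-A * NormedSpace.exp ((τ : ℂ) • (-A))) i k * B k j) τ :=
    HasDerivAt.fun_sum fun k _ => (hasDerivAt_exp_entry (-A) τ i k).mul_const _
  simp only [e, ← Matrix.mul_apply] at h ⊢
  convert h using 1
  rw [Matrix.neg_mul, Matrix.neg_mul, Matrix.neg_apply, ← Matrix.mul_assoc]

/-- `Ĝ₂` has the defining property of the Green function of `∂₀² + P₂(∂)`. -/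
theorem greenHat₂_spec (L : LinOp n r d₁ d₂) (ξ : Sp n) :
    greenHat₂ L 0 ξ = 0 ∧
    ∃ D : ℝ → Matrix (Fin d₂) (Fin d₂) ℂ, D 0 = 1 ∧
      (∀ τ i j, HasDerivAt (fun τ => greenHat₂ L τ ξ i j) (D τ i j) τ) ∧
      ∀ τ i j, HasDerivAt (fun τ => D τ i j)
        (-(symbolMat L.P₂ ξ * greenHat₂ L τ ξ) i j) τ := by
  set A : Matrix (Fin d₂ ⊕ Fin d₂) (Fin d₂ ⊕ Fin d₂) ℂ :=
    Matrix.fromBlocks 0 1 (-symbolMat L.P₂ ξ) 0 with hA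
  have e0 : NormedSpace.exp (((0 : ℝ) : ℂ) • A) = Matrix.fromBlocks 1 0 0 1 := by
    rw [Complex.ofReal_zero, zero_smul, NormedSpace.exp_zero, Matrix.fromBlocks_one]
  have eb : ∀ τ : ℝ, A * NormedSpace.exp ((τ : ℂ) • A) = Matrix.fromBlocks
      (NormedSpace.exp ((τ : ℂ) • A)).toBlocks₂₁ (NormedSpace.exp ((τ : ℂ) • A)).toBlocks₂₂
      (-symbolMat L.P₂ ξ * (NormedSpace.exp ((τ : ℂ) • A)).toBlocks₁₁)
      (-symbolMat L.P₂ ξ * (NormedSpace.exp ((τ : ℂ) • A)).toBlocks₁₂) := by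
    intro τ
    conv_lhs => rw [← Matrix.fromBlocks_toBlocks (NormedSpace.exp ((τ : ℂ) • A)), hA,
      Matrix.fromBlocks_multiply]
    simp [hA]
  refine ⟨?_, fun τ => (NormedSpace.exp ((τ : ℂ) • A)).toBlocks₂₂, ?_, fun τ i j => ?_,
    fun τ i j => ?_⟩
  · rw [greenHat₂, ← hA, e0, Matrix.toBlocks_fromBlocks₁₂]
  · simp only [e0, Matrix.toBlocks_fromBlocks₂₂]
  · have h := hasDerivAt_exp_entry A τ (Sum.inl i) (Sum.inr j)
    rw [eb, Matrix.fromBlocks_apply₁₂] at h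
    exact h
  · have h := hasDerivAt_exp_entry A τ (Sum.inr i) (Sum.inr j)
    rw [eb, Matrix.fromBlocks_apply₂₂, Matrix.neg_mul, Matrix.neg_apply] at h
    exact h

/-- The spatial Fourier transform `Ĝ(τ, ξ) = ∫ G(τ, x) e^{-ix·ξ} dx` of the Green function `G`,
i.e. of the solution of `LG = 0` such that `1_{x⁰ ≥ 0} G` is a fundamental solution of `L`. -/
def greenHat (L : LinOp n r d₁ d₂) (τ : ℝ) (ξ : Sp n) :
    Matrix (Fin d₁ ⊕ Fin d₂) (Fin d₁ ⊕ Fin d₂) ℂ :=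
  Matrix.fromBlocks (greenHat₁ L τ ξ) 0 0 (greenHat₂ L τ ξ)

/-- `ψ = ∫_{y⁰ = t} G_y N(φ, ∂φ)(y) dy`, including that the right-hand side is well defined: the
series `N(φ, ∂φ)(t, y)` converges for almost every `y`, its sum is a function `F` in `L²`, and, for
every `τ ∈ I`, the product of `Ĝ(τ - t, ·)` with the Fourier transform of `F` is in `L²` and is the
Fourier transform of `ψ|_τ` (that is, `ψ|_τ` is the convolution of `G(τ - t, ·)` with `F`). -/
def IsDuhamelIntegral (L : LinOp n r d₁ d₂)
    (N : FormalMultilinearSeries ℝ (JetSpace n d₁ d₂) (Target d₁ d₂)) (t : I)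
    (φ ψ : I →ᵇ Cau n r d₁ d₂ m s) : Prop :=
  (∀ᵐ y : Sp n, Summable fun k => N k fun _ => jet φ t y) ∧
  ∃ F : Fin d₁ ⊕ Fin d₂ → Lp ℂ 2 (volume : Measure (Sp n)),
    (∀ j, F j =ᵐ[volume] fun y => (N.sum (jet φ t y) j : ℂ)) ∧
    ∀ (τ : I) (i : Fin d₁ ⊕ Fin d₂), ∃ h : Lp ℂ 2 (volume : Measure (Sp n)),
      (h =ᵐ[volume] fun η : Sp n =>
        ∑ j, greenHat L ((τ : ℝ) - t) ((2 * Real.pi) • η) i j * (𝓕 (F j)) η) ∧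
      𝓕 (comp ψ τ i) = Lp.toTemperedDistribution h

end LagrangeDuhamel

end

open LagrangeDuhamel

set_option linter.unusedSectionVars false

noncomputable section

namespace LagrangeDuhamel

/-! ### Tempered distributions whose Fourier transform is a weighted L² function. -/

section

section Hat

variable {n : ℕ} {m s s' : ℝ}

/-! The integrand of V_t(φ) depends on φ only through the Cauchy data [φ]_t, whose norm is at most
‖φ‖. Write F = N(φ,∂φ)(t,·) and let U(τ) be the evolution of Cauchy data under L. Convolving
G(τ-t,·) with F gives the field with data ((γ⁰)⁻¹F₁, 0, F₂) at time t, so [V_t(φ)]_τ = U(τ-t) Λ F =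
U(τ) U(-t) Λ F, where Λ produces these data. Thus V_t is a composition of linear maps with one
analytic map, the superposition operator c ↦ F.

The superposition operator is handled by multiplication H^a × H^b → H^b for a > n/2 and 0 ≤ b ≤ a
(`Sobolev.exists_mul`). Expanding N in monomials of the jet coordinates, each monomial that occurs
has at most one factor that lies only in H^b; the others lie in H^a. Independence and affineness of
N are converted into this count by scaling the derivative coordinates by 0 and 2 and comparing
coefficients (`countIn_eq_zero_of_indep`, `countIn_le_one_of_affine`). Hence the k-th term of F has
norm at most Q^k ‖N^(k)‖ (`exists_component`), and in every case F₁ lies in H^s and F₂ in H^b with b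
≥ s-r (`exists_nonlinearity`), so that Λ F is in Cau^s. The H^b factor may be unbounded, but as it
occurs at most once it does not affect pointwise convergence of the series (`summable_coeff`,
`rep_sum_ae_eq`).

The evolution is a matrix of Fourier multipliers. The E₁-block is unitary. For the E₂-block,
conservation of ⟨u,P₂u⟩ + |∂₀u|² and the lower bound on P₂ give a bound uniform in time if μ₀ > 0;
if μ₀ = 0, low frequencies are controlled by integrating ∂₀u, at the price of linear growth, which
is harmless on a bounded interval (`exists_exp_gen₂_bound`).

The operator L, the constants α, μ₀ and the interval enter only through the norms of U and Λ, that
is, as one factor common to all coefficients. A common positive factor leaves the radius of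
convergence alone, so Q depends only on the Sobolev constants and the dimensions
(`radius_le_mul_radius_ofScalars`). Normality and joint continuity in (t, φ) follow from uniform
bounds and strong continuity of U (`exists_isNormalFamily`). -/

theorem weight_pos (n : ℕ) (hm : 0 < m) (s : ℝ) (η : Sp n) : 0 < weight n m s η := by
  unfold weight
  have : 0 < m ^ 2 + ‖(2 * Real.pi) • η‖ ^ 2 := by positivity
  positivity

theorem weight_neg (n : ℕ) (m s : ℝ) (η : Sp n) : weight n m s (-η) = weight n m s η := by
  simp [weight]

theorem continuous_weight (n : ℕ) (hm : 0 < m) (s : ℝ) : Continuous (weight n m s) := by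
  unfold weight
  refine continuous_const.mul (Continuous.rpow_const (by fun_prop) fun η => Or.inl ?_)
  positivity

/-- The constant factor of the weights. -/
def weightConst (n : ℕ) : ℝ := ((2 * Real.pi) ^ ((n : ℝ) / 2)) ^ 2

theorem weightConst_pos (n : ℕ) : 0 < weightConst n := by
  unfold weightConst; positivity

theorem weight_inv (n : ℕ) (hm : 0 < m) (s : ℝ) (η : Sp n) :
    (weight n m s η)⁻¹ = (weightConst n)⁻¹ * weight n m (-s) η := by
  have h := weight_mul_weight_neg n hm s η
  have h1 := weight_pos n hm s η
  have h2 := weightConst_pos n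
  rw [← weightConst] at h
  field_simp
  linarith

/-- The Fourier transform of `T` is the function `h`. -/
def HasHat (T : 𝓢'(Sp n, ℂ)) (h : Sp n → ℂ) : Prop :=
  ∀ f : 𝓢(Sp n, ℂ), (𝓕 T) f = ∫ η, f η * h η

theorem HasHat.congr {T : 𝓢'(Sp n, ℂ)} {h h' : Sp n → ℂ} (H : HasHat T h) (e : h =ᵐ[volume] h') :
    HasHat T h' := by
  intro f
  rw [H f]
  exact integral_congr_ae (by filter_upwards [e] with η hη; rw [hη])

/-- `HasHat` frees the Fourier transform from the exponent s, so that the same distribution can be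
compared in different Sobolev spaces. The weight is removed by testing against f times the weight of
exponent -s. -/
theorem IsWeightedFourier.hasHat (hm : 0 < m) {T : 𝓢'(Sp n, ℂ)}
    {g : Lp ℂ 2 (volume : Measure (Sp n))} (H : IsWeightedFourier n m s T g) :
    HasHat T (fun η => g η / weight n m s η) := by
  intro f
  have h1 := H.apply hm (𝓕 f)
  rw [TemperedDistribution.fourier_apply, h1, Lp.toTemperedDistribution_apply,
    FourierTransform.fourierInv_fourier_eq, ← integral_const_mul]
  refine integral_congr_ae (ae_of_all _ fun η => ?_)
  simp only [smul_eq_mul]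
  rw [SchwartzMap.smulLeftCLM_apply_apply (weight_temperate n hm (-s)), div_eq_mul_inv (g η),
    ← Complex.ofReal_inv (weight n m s η), weight_inv n hm, ← weightConst]
  push_cast
  simp only [smul_eq_mul]
  ring

theorem HasHat.isWeightedFourier (hm : 0 < m) {T : 𝓢'(Sp n, ℂ)} {h : Sp n → ℂ}
    (H : HasHat T h) (hh : MemLp (fun η => (weight n m s η : ℂ) * h η) 2 volume) :
    IsWeightedFourier n m s T (hh.toLp _) := by
  unfold IsWeightedFourier
  ext f
  rw [TemperedDistribution.smulLeftCLM_apply_apply, H, Lp.toTemperedDistribution_apply]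
  refine integral_congr_ae ?_
  filter_upwards [hh.coeFn_toLp] with η hη
  rw [hη, SchwartzMap.smulLeftCLM_apply_apply (weight_temperate n hm s)]
  simp only [smul_eq_mul]
  ring

theorem HasHat.eq_dist {T T' : 𝓢'(Sp n, ℂ)} {h : Sp n → ℂ} (H : HasHat T h) (H' : HasHat T' h) :
    T = T' := by
  have : 𝓕 T = 𝓕 T' := by
    ext f
    rw [H f, H' f]
  rw [← FourierTransform.fourierInv_fourier_eq (F := 𝓢'(Sp n, ℂ)) T, this,
    FourierTransform.fourierInv_fourier_eq]

/-- The base m² + |ξ|² is at least m², and the exponent (s'-s)/2 is nonpositive; this is the origin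
of the constant m^(s'-s). -/
theorem weight_mono (hm : 0 < m) (h : s' ≤ s) (η : Sp n) :
    weight n m s' η ≤ m ^ (s' - s) * weight n m s η := by
  unfold weight
  have h0 : 0 < m ^ 2 + ‖(2 * Real.pi) • η‖ ^ 2 := by positivity
  have h1 : m ^ 2 ≤ m ^ 2 + ‖(2 * Real.pi) • η‖ ^ 2 := by
    have : 0 ≤ ‖(2 * Real.pi) • η‖ ^ 2 := by positivity
    linarith
  have h2 : (m ^ 2 + ‖(2 * Real.pi) • η‖ ^ 2) ^ (s' / 2) =
      (m ^ 2 + ‖(2 * Real.pi) • η‖ ^ 2) ^ ((s' - s) / 2) *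
        (m ^ 2 + ‖(2 * Real.pi) • η‖ ^ 2) ^ (s / 2) := by
    rw [← Real.rpow_add h0]; congr 1; ring
  have h3 : (m ^ 2 + ‖(2 * Real.pi) • η‖ ^ 2) ^ ((s' - s) / 2) ≤ m ^ (s' - s) := by
    have : m ^ (s' - s) = (m ^ 2) ^ ((s' - s) / 2) := by
      rw [← Real.rpow_natCast, ← Real.rpow_mul hm.le]; congr 1; push_cast; ring
    rw [this]
    exact Real.rpow_le_rpow_of_nonpos (by positivity) h1 (by linarith)
  rw [h2]
  calc _ = ((m ^ 2 + ‖(2 * Real.pi) • η‖ ^ 2) ^ ((s' - s) / 2)) *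
      ((2 * Real.pi) ^ ((n : ℝ) / 2) * (m ^ 2 + ‖(2 * Real.pi) • η‖ ^ 2) ^ (s / 2)) := by ring
    _ ≤ _ := by gcongr

theorem memLp_weight_mono (hm : 0 < m) (h : s' ≤ s) {u : Sp n → ℂ}
    (hu : MemLp (fun η => (weight n m s η : ℂ) * u η) 2 volume) :
    MemLp (fun η => (weight n m s' η : ℂ) * u η) 2 volume := by
  have h1 : AEStronglyMeasurable (fun η => (weight n m s' η : ℂ) * u η) volume := by
    have e : (fun η => (weight n m s' η : ℂ) * u η) = fun η =>
        ((weight n m s' η / weight n m s η : ℝ) : ℂ) * ((weight n m s η : ℂ) * u η) := by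
      funext η
      have : (weight n m s η : ℂ) ≠ 0 := by exact_mod_cast (weight_pos n hm s η).ne'
      push_cast
      field_simp
    rw [e]
    refine AEStronglyMeasurable.mul ?_ hu.1
    refine (Complex.continuous_ofReal.comp ?_).aestronglyMeasurable
    exact (continuous_weight n hm s').div (continuous_weight n hm s)
      fun η => (weight_pos n hm s η).ne'
  refine hu.of_le_mul (c := m ^ (s' - s)) h1 (ae_of_all _ fun η => ?_)
  rw [norm_mul, norm_mul, Complex.norm_real, Complex.norm_real,
    Real.norm_of_nonneg (weight_pos n hm _ η).le, Real.norm_of_nonneg (weight_pos n hm _ η).le,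
    ← mul_assoc]
  gcongr
  exact weight_mono hm h η

/-- Both functions are square integrable with the weight of exponent min(s, s'), and there
uniqueness of the L² representative applies. -/
theorem HasHat.ae_eq (hm : 0 < m) {T : 𝓢'(Sp n, ℂ)} {h h' : Sp n → ℂ} (H : HasHat T h)
    (H' : HasHat T h') (hh : MemLp (fun η => (weight n m s η : ℂ) * h η) 2 volume)
    (hh' : MemLp (fun η => (weight n m s' η : ℂ) * h' η) 2 volume) : h =ᵐ[volume] h' := by
  have k := memLp_weight_mono hm (min_le_left s s') hh
  have k' := memLp_weight_mono hm (min_le_right s s') hh'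
  have e := (H.isWeightedFourier hm k).unique (H'.isWeightedFourier hm k')
  have e2 := k.coeFn_toLp
  rw [e] at e2
  filter_upwards [e2, k'.coeFn_toLp] with η h1 h2
  rw [h1] at h2
  have := (weight_pos n hm (min s s') η).ne'
  exact mul_left_cancel₀ (by exact_mod_cast this) h2

/-- The distribution with Fourier transform `h`. -/
theorem exists_hasHat (hm : 0 < m) {h : Sp n → ℂ}
    (hh : MemLp (fun η => (weight n m s η : ℂ) * h η) 2 volume) :
    ∃ T : 𝓢'(Sp n, ℂ), HasHat T h := by
  refine ⟨𝓕⁻ (TemperedDistribution.smulLeftCLM ℂ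
    (fun η => (((weightConst n)⁻¹ * weight n m (-s) η : ℝ) : ℂ))
      (Lp.toTemperedDistribution (hh.toLp _))), fun f => ?_⟩
  have ht : (fun η : Sp n =>
      (((weightConst n)⁻¹ * weight n m (-s) η : ℝ) : ℂ)).HasTemperateGrowth := by
    simp only [Complex.ofReal_mul]
    exact (Function.HasTemperateGrowth.const _).mul (weight_temperate n hm (-s))
  rw [FourierTransform.fourier_fourierInv_eq, TemperedDistribution.smulLeftCLM_apply_apply,
    Lp.toTemperedDistribution_apply]
  refine integral_congr_ae ?_
  filter_upwards [hh.coeFn_toLp] with η hη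
  rw [hη, SchwartzMap.smulLeftCLM_apply_apply ht, ← weight_inv n hm]
  have : (weight n m s η : ℂ) ≠ 0 := by exact_mod_cast (weight_pos n hm s η).ne'
  simp only [smul_eq_mul]
  push_cast
  field_simp

theorem conj_fourierInv_real {f : 𝓢(Sp n, ℂ)} (hf : ∀ x, (f x).im = 0) (η : Sp n) :
    (𝓕⁻ f : 𝓢(Sp n, ℂ)) (-η) = (starRingEnd ℂ) ((𝓕⁻ f : 𝓢(Sp n, ℂ)) η) := by
  rw [SchwartzMap.fourierInv_coe, Real.fourierInv_eq', Real.fourierInv_eq', ← integral_conj]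
  refine integral_congr_ae (ae_of_all _ fun x => ?_)
  have h : (starRingEnd ℂ) (f x) = f x := Complex.conj_eq_iff_im.2 (hf x)
  simp only [smul_eq_mul, map_mul, h, ← Complex.exp_conj, inner_neg_right, Complex.conj_I,
    Complex.conj_ofReal]
  congr 2
  push_cast
  ring

/-- Splitting the constant as weight(s) · weight(-s) exhibits the product as one of two L²
functions. Without this, the integral in `HasHat` could be the default value 0 and could not be
split over sums. -/
theorem integrable_schwartz_mul (hm : 0 < m) {h : Sp n → ℂ}
    (hh : MemLp (fun η => (weight n m s η : ℂ) * h η) 2 volume) (f : 𝓢(Sp n, ℂ)) :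
    Integrable (fun η => f η * h η) := by
  have h1 : MemLp (SchwartzMap.smulLeftCLM ℂ (fun η => (weight n m (-s) η : ℂ)) f) 2
      (volume : Measure (Sp n)) := SchwartzMap.memLp _ 2 volume
  have h2 := (h1.integrable_mul hh).const_mul ((weightConst n : ℂ)⁻¹)
  refine h2.congr (ae_of_all _ fun η => ?_)
  simp only [Pi.mul_apply]
  rw [SchwartzMap.smulLeftCLM_apply_apply (weight_temperate n hm (-s))]
  have h3 := weight_mul_weight_neg n hm s η
  have h4 : (weightConst n : ℂ) ≠ 0 := by exact_mod_cast (weightConst_pos n).ne'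
  rw [← weightConst] at h3
  rw [← h3] at h4 ⊢
  simp only [smul_eq_mul]
  field_simp
  push_cast
  ring

/-- A distribution is real if its Fourier transform is Hermitian symmetric. -/
theorem HasHat.isRealDist {T : 𝓢'(Sp n, ℂ)} {h : Sp n → ℂ} (H : HasHat T h)
    (hs : ∀ᵐ η, h (-η) = (starRingEnd ℂ) (h η)) : IsRealDist T := by
  intro f hf
  have e : T f = ∫ η, (𝓕⁻ f : 𝓢(Sp n, ℂ)) η * h η := by
    rw [← H, TemperedDistribution.fourier_apply, FourierTransform.fourier_fourierInv_eq]
  rw [← Complex.conj_eq_iff_im, e, ← integral_conj, ← integral_neg_eq_self (fun η =>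
    (𝓕⁻ f : 𝓢(Sp n, ℂ)) η * h η)]
  refine integral_congr_ae ?_
  filter_upwards [hs] with η hη
  rw [hη, conj_fourierInv_real hf, map_mul]

/-- Complex conjugation of Schwartz functions. -/
def schwartzConj (f : 𝓢(Sp n, ℂ)) : 𝓢(Sp n, ℂ) :=
  SchwartzMap.postcompCLM (𝕜 := ℝ) (Complex.conjCLE : ℂ →L[ℝ] ℂ) f

theorem schwartzConj_apply (f : 𝓢(Sp n, ℂ)) (x : Sp n) :
    schwartzConj f x = (starRingEnd ℂ) (f x) := rfl

/-- Realness is applied to the real functions f + f̄ and i(f - f̄); these give the imaginary and the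
real part of the identity. -/
theorem IsRealDist.conj {T : 𝓢'(Sp n, ℂ)} (h : IsRealDist T) (f : 𝓢(Sp n, ℂ)) :
    T (schwartzConj f) = (starRingEnd ℂ) (T f) := by
  have h1 := h (f + schwartzConj f) fun x => by
    simp [schwartzConj_apply]
  have h2 := h (Complex.I • (f - schwartzConj f)) fun x => by
    simp [schwartzConj_apply]
  rw [map_add] at h1
  rw [map_smul, map_sub] at h2
  apply Complex.ext
  · simp at h2 ⊢
    linarith
  · simp at h1 ⊢
    linarith

theorem fourier_schwartzConj (f : 𝓢(Sp n, ℂ)) (η : Sp n) :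
    (𝓕 (schwartzConj f) : 𝓢(Sp n, ℂ)) η = (starRingEnd ℂ) ((𝓕 f : 𝓢(Sp n, ℂ)) (-η)) := by
  rw [SchwartzMap.fourier_coe, SchwartzMap.fourier_coe, Real.fourier_eq', Real.fourier_eq',
    ← integral_conj]
  refine integral_congr_ae (ae_of_all _ fun x => ?_)
  simp only [smul_eq_mul, map_mul, ← Complex.exp_conj, inner_neg_right, Complex.conj_I,
    Complex.conj_ofReal, schwartzConj_apply]
  congr 2
  push_cast
  ring

/-- The function η ↦ conj h(-η) is also a Fourier transform of T because T commutes with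
conjugation. Uniqueness of the transform gives the symmetry. -/
theorem IsRealDist.hat_symm (hm : 0 < m) {T : 𝓢'(Sp n, ℂ)} {h : Sp n → ℂ} (hT : IsRealDist T)
    (H : HasHat T h) (hh : MemLp (fun η => (weight n m s η : ℂ) * h η) 2 volume) :
    ∀ᵐ η, h (-η) = (starRingEnd ℂ) (h η) := by
  have hh' : MemLp (fun η => (weight n m s η : ℂ) * (starRingEnd ℂ) (h (-η))) 2 volume := by
    have h1 := (hh.comp_measurePreserving (Measure.measurePreserving_neg _)).star
    refine h1.ae_eq (ae_of_all _ fun η => ?_)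
    simp [weight_neg]
  have H' : HasHat T (fun η => (starRingEnd ℂ) (h (-η))) := by
    intro f
    have e1 : 𝓕 T f = (starRingEnd ℂ) (T (schwartzConj (𝓕 f))) := by
      rw [hT.conj]; simp
    have e2 : schwartzConj (𝓕 f) = 𝓕 (𝓕⁻ (schwartzConj (𝓕 f))) := by simp
    have e3 : ∀ η, (𝓕⁻ (schwartzConj (𝓕 f)) : 𝓢(Sp n, ℂ)) η = (starRingEnd ℂ) (f (-η)) := by
      intro η
      have h1 : (𝓕⁻ (schwartzConj (𝓕 f)) : 𝓢(Sp n, ℂ)) η = (𝓕 (schwartzConj (𝓕 f)) : 𝓢(Sp n, ℂ)) (-η) := by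
        rw [SchwartzMap.fourierInv_coe, SchwartzMap.fourier_coe, Real.fourierInv_eq_fourier_neg]
      have h2 : f (-η) = (𝓕⁻ (𝓕 f) : 𝓢(Sp n, ℂ)) (-η) := by simp
      rw [h1, fourier_schwartzConj, h2, SchwartzMap.fourierInv_coe, SchwartzMap.fourier_coe,
        Real.fourierInv_eq_fourier_neg]
    rw [e1, e2, ← TemperedDistribution.fourier_apply, H, ← integral_conj,
      ← integral_neg_eq_self]
    refine integral_congr_ae (ae_of_all _ fun η => ?_)
    simp [e3]
  filter_upwards [H.ae_eq hm H' hh hh'] with η hη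
  rw [hη, Complex.conj_conj]

end Hat

end

/-! ### The Sobolev spaces as Hilbert spaces, and Fourier multipliers between them. -/

section

namespace Sobolev

variable {n : ℕ} {m s s' : ℝ} [hm : Fact (0 < m)]

/-- The Fourier transform of an element of `H^s`, as a function. -/
def hat (T : Sobolev n m s) (η : Sp n) : ℂ := T.weighted η / weight n m s η

theorem hasHat (T : Sobolev n m s) : HasHat T.toDist T.hat := T.weighted_spec.hasHat hm.out

theorem weight_mul_hat (T : Sobolev n m s) (η : Sp n) :
    (weight n m s η : ℂ) * T.hat η = T.weighted η := by
  have : (weight n m s η : ℂ) ≠ 0 := by exact_mod_cast (weight_pos n hm.out s η).ne'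
  unfold hat
  field_simp

theorem memLp_hat (T : Sobolev n m s) :
    MemLp (fun η => (weight n m s η : ℂ) * T.hat η) 2 volume := by
  simp only [weight_mul_hat]
  exact Lp.memLp _

theorem aestronglyMeasurable_hat (T : Sobolev n m s) : AEStronglyMeasurable T.hat volume := by
  refine (Lp.aestronglyMeasurable _).div₀ ?_
  exact (Complex.continuous_ofReal.comp (continuous_weight n hm.out s)).aestronglyMeasurable

theorem isRealDist (T : Sobolev n m s) : IsRealDist T.toDist := T.2.1

theorem hat_symm (T : Sobolev n m s) : ∀ᵐ η, T.hat (-η) = (starRingEnd ℂ) (T.hat η) :=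
  T.isRealDist.hat_symm hm.out T.hasHat T.memLp_hat

theorem hat_eq_of_hasHat (T : Sobolev n m s) {h : Sp n → ℂ} (H : HasHat T.toDist h)
    (hh : MemLp (fun η => (weight n m s' η : ℂ) * h η) 2 volume) : T.hat =ᵐ[volume] h :=
  T.hasHat.ae_eq hm.out H T.memLp_hat hh

/-- Allowing two different exponents makes all inclusions and derivative maps checkable on the
Fourier side. -/
theorem toDist_eq_iff (T : Sobolev n m s) (T' : Sobolev n m s') :
    T.toDist = T'.toDist ↔ T.hat =ᵐ[volume] T'.hat := by
  constructor
  · intro h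
    refine T.hat_eq_of_hasHat ?_ T'.memLp_hat
    rw [h]
    exact T'.hasHat
  · intro h
    exact (T.hasHat.congr h).eq_dist T'.hasHat

theorem ext_hat {T T' : Sobolev n m s} (h : T.hat =ᵐ[volume] T'.hat) : T = T' :=
  Subtype.ext ((toDist_eq_iff T T').2 h)

theorem exists_of_dist {T : 𝓢'(Sp n, ℂ)} {h : Sp n → ℂ} (H : HasHat T h)
    (hh : MemLp (fun η => (weight n m s η : ℂ) * h η) 2 volume) (hT : IsRealDist T) :
    ∃ T' : Sobolev n m s, T'.toDist = T ∧ T'.hat =ᵐ[volume] h :=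
  ⟨⟨T, hT, _, H.isWeightedFourier hm.out hh⟩, rfl, hat_eq_of_hasHat _ H hh⟩

theorem exists_of_hat {h : Sp n → ℂ}
    (hh : MemLp (fun η => (weight n m s η : ℂ) * h η) 2 volume)
    (hs : ∀ᵐ η, h (-η) = (starRingEnd ℂ) (h η)) : ∃ T : Sobolev n m s, T.hat =ᵐ[volume] h := by
  obtain ⟨T, hT⟩ := exists_hasHat hm.out hh
  obtain ⟨T', -, h'⟩ := exists_of_dist hT hh (hT.isRealDist hs)
  exact ⟨T', h'⟩

theorem hat_add (T T' : Sobolev n m s) : (T + T').hat =ᵐ[volume] fun η => T.hat η + T'.hat η := by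
  unfold hat
  rw [map_add]
  filter_upwards [Lp.coeFn_add T.weighted T'.weighted] with η hη
  rw [hη, Pi.add_apply, add_div]

theorem hat_sub (T T' : Sobolev n m s) : (T - T').hat =ᵐ[volume] fun η => T.hat η - T'.hat η := by
  unfold hat
  rw [map_sub]
  filter_upwards [Lp.coeFn_sub T.weighted T'.weighted] with η hη
  rw [hη, Pi.sub_apply, sub_div]

theorem hat_smul (c : ℝ) (T : Sobolev n m s) :
    (c • T).hat =ᵐ[volume] fun η => (c : ℂ) * T.hat η := by
  unfold hat
  rw [map_smul]
  filter_upwards [Lp.coeFn_smul c T.weighted] with η hη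
  rw [hη, Pi.smul_apply, Complex.real_smul, mul_div_assoc]

theorem hat_zero : (0 : Sobolev n m s).hat =ᵐ[volume] fun _ => 0 := by
  have := hat_smul (n := n) (m := m) (s := s) 0 0
  simpa using this

theorem hat_sum {ι : Type*} (t : Finset ι) (T : ι → Sobolev n m s) :
    (∑ i ∈ t, T i).hat =ᵐ[volume] fun η => ∑ i ∈ t, (T i).hat η := by
  classical
  induction t using Finset.induction_on with
  | empty => simpa using hat_zero
  | insert a t ha ih =>
    rw [Finset.sum_insert ha]
    filter_upwards [hat_add (T a) (∑ i ∈ t, T i), ih] with η h1 h2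
    rw [h1, h2, Finset.sum_insert ha]

theorem norm_eq (T : Sobolev n m s) :
    ‖T‖ = (eLpNorm (fun η => (weight n m s η : ℂ) * T.hat η) 2 volume).toReal := by
  rw [norm_def, Lp.norm_def]
  simp only [weight_mul_hat]

theorem norm_sq_eq (T : Sobolev n m s) :
    ‖T‖ ^ 2 = ∫ η, ‖(weight n m s η : ℂ) * T.hat η‖ ^ 2 := by
  rw [norm_eq, T.memLp_hat.eLpNorm_eq_integral_rpow_norm (by simp) (by simp), ENNReal.toReal_ofReal
    (by positivity), ← Real.rpow_natCast, ← Real.rpow_mul (by positivity)]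
  simp

theorem enorm_eq (T : Sobolev n m s) :
    ENNReal.ofReal ‖T‖ = eLpNorm (fun η => (weight n m s η : ℂ) * T.hat η) 2 volume := by
  rw [norm_eq, ENNReal.ofReal_toReal T.memLp_hat.2.ne]

theorem norm_le_of_hat {T : Sobolev n m s} {T' : Sobolev n m s'} {B : ℝ} (hB : 0 ≤ B)
    (h : ∀ᵐ η, weight n m s' η * ‖T'.hat η‖ ≤ B * (weight n m s η * ‖T.hat η‖)) :
    ‖T'‖ ≤ B * ‖T‖ := by
  rw [norm_eq, norm_eq]
  have h1 : eLpNorm (fun η => (weight n m s' η : ℂ) * T'.hat η) 2 volume ≤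
      ENNReal.ofReal B * eLpNorm (fun η => (weight n m s η : ℂ) * T.hat η) 2 volume := by
    apply eLpNorm_le_mul_eLpNorm_of_ae_le_mul
    filter_upwards [h] with η hη
    rwa [norm_mul, norm_mul, Complex.norm_real, Complex.norm_real,
      Real.norm_of_nonneg (weight_pos n hm.out _ η).le,
      Real.norm_of_nonneg (weight_pos n hm.out _ η).le]
  have h2 := ENNReal.toReal_mono (ENNReal.mul_ne_top ENNReal.ofReal_ne_top T.memLp_hat.2.ne) h1
  rwa [ENNReal.toReal_mul, ENNReal.toReal_ofReal hB] at h2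

/-- The linear isometry `H^s → L²`. -/
def weightedₗᵢ : Sobolev n m s →ₗᵢ[ℝ] Lp ℂ 2 (volume : Measure (Sp n)) where
  toLinearMap := weighted
  norm_map' _ := rfl

/-- Dominated convergence in `H^s`. -/
theorem tendsto_of_dominated {ι : Type*} {l : Filter ι} [l.IsCountablyGenerated]
    {X : ι → Sobolev n m s} {X₀ : Sobolev n m s} {F : ι → Sp n → ℂ} {F₀ : Sp n → ℂ} {G : Sp n → ℝ}
    (hG : MemLp G 2 volume) (hF : ∀ i, (X i).hat =ᵐ[volume] F i) (hF₀ : X₀.hat =ᵐ[volume] F₀)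
    (hb : ∀ᶠ i in l, ∀ᵐ η, weight n m s η * ‖F i η‖ ≤ G η)
    (hb₀ : ∀ᵐ η, weight n m s η * ‖F₀ η‖ ≤ G η)
    (hlim : ∀ᵐ η, Tendsto (fun i => F i η) l (𝓝 (F₀ η))) : Tendsto X l (𝓝 X₀) := by
  rw [tendsto_iff_norm_sub_tendsto_zero]
  -- The squared norm is an integral, so ordinary dominated convergence applies, with majorant
  -- (2G)².
  have h1 : ∀ i, ‖X i - X₀‖ ^ 2 = ∫ η, (weight n m s η * ‖F i η - F₀ η‖) ^ 2 := by
    intro i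
    rw [norm_sq_eq]
    refine integral_congr_ae ?_
    filter_upwards [hat_sub (X i) X₀, hF i, hF₀] with η h1 h2 h3
    rw [h1, h2, h3, norm_mul, Complex.norm_real, Real.norm_of_nonneg (weight_pos n hm.out _ η).le]
  have h2 : Tendsto (fun i => ‖X i - X₀‖ ^ 2) l (𝓝 (∫ η : Sp n, (0 : ℝ))) := by
    simp only [h1]
    refine tendsto_integral_filter_of_dominated_convergence (fun η => (2 * G η) ^ 2) ?_ ?_ ?_ ?_
    · refine Eventually.of_forall fun i => ?_
      have := ((X i).aestronglyMeasurable_hat.congr (hF i)).sub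
        (X₀.aestronglyMeasurable_hat.congr hF₀)
      exact ((continuous_weight n hm.out s).aestronglyMeasurable.mul this.norm).pow 2
    · filter_upwards [hb] with i hi
      filter_upwards [hi, hb₀] with η h1 h2
      have hw := (weight_pos n hm.out s η).le
      rw [Real.norm_of_nonneg (by positivity)]
      have : weight n m s η * ‖F i η - F₀ η‖ ≤ 2 * G η := by
        calc _ ≤ weight n m s η * (‖F i η‖ + ‖F₀ η‖) := by gcongr; exact norm_sub_le _ _
          _ ≤ _ := by linarith
      gcongr
    · have := (hG.const_mul 2).integrable_sq
      exact this
    · filter_upwards [hlim] with η hη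
      have := (((tendsto_sub_nhds_zero_iff.2 hη).norm).const_mul (weight n m s η)).pow 2
      simpa using this
  rw [integral_zero] at h2
  have h3 := h2.sqrt
  simpa [Real.sqrt_sq] using h3

/-- The weighted Fourier transform is an isometry onto the g in L² with g(-η) = conj g(η). This is
the fixed set of the continuous map σ, hence closed. Completeness is needed to sum the series of the
nonlinearity. -/
instance : CompleteSpace (Sobolev n m s) := by
  have hc : IsClosed (Set.range (weighted : Sobolev n m s → Lp ℂ 2 (volume : Measure (Sp n)))) := by
    let σ : Lp ℂ 2 (volume : Measure (Sp n)) → Lp ℂ 2 (volume : Measure (Sp n)) := fun g =>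
      (Complex.conjCLE : ℂ →L[ℝ] ℂ).compLpL 2 volume
        (Lp.compMeasurePreserving _ (Measure.measurePreserving_neg volume) g)
    have hσ : Continuous σ := by
      refine (ContinuousLinearMap.continuous _).comp ?_
      exact (Lp.isometry_compMeasurePreserving (Measure.measurePreserving_neg volume)).continuous
    have hσe : ∀ g, σ g =ᵐ[volume] fun η => (starRingEnd ℂ) (g (-η)) := by
      intro g
      filter_upwards [ContinuousLinearMap.coeFn_compLpL (Complex.conjCLE : ℂ →L[ℝ] ℂ)
        (Lp.compMeasurePreserving _ (Measure.measurePreserving_neg volume) g),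
        Lp.coeFn_compMeasurePreserving g
          (Measure.measurePreserving_neg (volume : Measure (Sp n)))] with η h1 h2
      rw [h1, h2]
      rfl
    have : Set.range (weighted : Sobolev n m s → Lp ℂ 2 (volume : Measure (Sp n))) =
        {g | σ g = g} := by
      ext g
      constructor
      · rintro ⟨T, rfl⟩
        apply Lp.ext
        filter_upwards [hσe T.weighted, T.hat_symm] with η h1 h2
        rw [h1, ← weight_mul_hat, ← weight_mul_hat, h2, weight_neg]
        simp
      · intro hg
        have h1 : MemLp (fun η => (weight n m s η : ℂ) * (g η / weight n m s η)) 2 volume := by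
          refine (Lp.memLp g).ae_eq (ae_of_all _ fun η => ?_)
          have : (weight n m s η : ℂ) ≠ 0 := by exact_mod_cast (weight_pos n hm.out s η).ne'
          field_simp
        obtain ⟨T, hT⟩ := exists_of_hat (hm := hm) h1 (by
          have h2 := hσe g
          rw [show σ g = g from hg] at h2
          filter_upwards [h2] with η h3
          rw [weight_neg, map_div₀, Complex.conj_ofReal, h3, Complex.conj_conj])
        refine ⟨T, Lp.ext ?_⟩
        filter_upwards [hT] with η hη
        rw [← weight_mul_hat, hη]
        have : (weight n m s η : ℂ) ≠ 0 := by exact_mod_cast (weight_pos n hm.out s η).ne'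
        field_simp
    rw [this]
    exact isClosed_eq hσ continuous_id
  have : IsComplete (Set.range (weightedₗᵢ : Sobolev n m s →ₗᵢ[ℝ] Lp ℂ 2 (volume : Measure (Sp n)))) :=
    hc.isComplete
  rw [completeSpace_iff_isComplete_univ, ← weightedₗᵢ.isometry.isUniformInducing.isComplete_iff,
    Set.image_univ]
  exact this

end Sobolev

/-- A Fourier multiplier from `H^s` to `H^{s'}` that preserves real distributions. -/
structure IsMultiplier (n : ℕ) (m s s' : ℝ) (μ : Sp n → ℂ) (B : ℝ) : Prop where
  meas : AEStronglyMeasurable μ volume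
  symm : ∀ η, μ (-η) = (starRingEnd ℂ) (μ η)
  bound : ∀ η, weight n m s' η * ‖μ η‖ ≤ B * weight n m s η

namespace IsMultiplier

variable {n : ℕ} {m s s' : ℝ} [hm : Fact (0 < m)] {μ : Sp n → ℂ} {B : ℝ}

theorem nonneg (h : IsMultiplier n m s s' μ B) : 0 ≤ B := by
  have h1 := h.bound 0
  have h2 := weight_pos n hm.out s 0
  have h3 := weight_pos n hm.out s' 0
  have h4 : 0 ≤ B * weight n m s 0 := le_trans (by positivity) h1
  exact nonneg_of_mul_nonneg_left h4 h2

theorem exists_apply (h : IsMultiplier n m s s' μ B) (T : Sobolev n m s) :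
    ∃ T' : Sobolev n m s', T'.hat =ᵐ[volume] fun η => μ η * T.hat η := by
  apply Sobolev.exists_of_hat
  · refine T.memLp_hat.of_le_mul (c := B) ?_ (ae_of_all _ fun η => ?_)
    · exact (Complex.continuous_ofReal.comp (continuous_weight n hm.out s')).aestronglyMeasurable.mul
        (h.meas.mul T.aestronglyMeasurable_hat)
    · rw [norm_mul, norm_mul, norm_mul, Complex.norm_real, Complex.norm_real,
        Real.norm_of_nonneg (weight_pos n hm.out _ η).le,
        Real.norm_of_nonneg (weight_pos n hm.out _ η).le, ← mul_assoc, ← mul_assoc]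
      exact mul_le_mul_of_nonneg_right (h.bound η) (norm_nonneg _)
  · filter_upwards [T.hat_symm] with η hη
    rw [h.symm, hη, map_mul]

/-- The images are chosen one at a time; linearity follows since the Fourier transform determines
the element. -/
theorem exists_clm (h : IsMultiplier n m s s' μ B) :
    ∃ A : Sobolev n m s →L[ℝ] Sobolev n m s', ‖A‖ ≤ B ∧
      ∀ T, (A T).hat =ᵐ[volume] fun η => μ η * T.hat η := by
  choose A hA using h.exists_apply
  have hb : ∀ T, ‖A T‖ ≤ B * ‖T‖ := by
    intro T
    refine Sobolev.norm_le_of_hat h.nonneg ?_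
    filter_upwards [hA T] with η hη
    rw [hη, norm_mul, ← mul_assoc, ← mul_assoc]
    exact mul_le_mul_of_nonneg_right (h.bound η) (norm_nonneg _)
  let A' : Sobolev n m s →ₗ[ℝ] Sobolev n m s' :=
    { toFun := A
      map_add' := fun T T' => Sobolev.ext_hat <| by
        filter_upwards [hA T, hA T', hA (T + T'), Sobolev.hat_add (A T) (A T'),
          Sobolev.hat_add T T'] with η h1 h2 h3 h4 h5
        rw [h3, h4, h5, h1, h2, mul_add]
      map_smul' := fun c T => Sobolev.ext_hat <| by
        filter_upwards [hA T, hA (c • T), Sobolev.hat_smul c (A T),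
          Sobolev.hat_smul c T] with η h1 h2 h3 h4
        rw [RingHom.id_apply, h2, h3, h4, h1]
        ring }
  exact ⟨A'.mkContinuous B hb, A'.mkContinuous_norm_le h.nonneg hb, hA⟩

/-- The operator with symbol `μ`. -/
def clm (h : IsMultiplier n m s s' μ B) : Sobolev n m s →L[ℝ] Sobolev n m s' :=
  h.exists_clm.choose

theorem norm_clm_le (h : IsMultiplier n m s s' μ B) : ‖h.clm‖ ≤ B := h.exists_clm.choose_spec.1

theorem hat_clm (h : IsMultiplier n m s s' μ B) (T : Sobolev n m s) :
    (h.clm T).hat =ᵐ[volume] fun η => μ η * T.hat η := h.exists_clm.choose_spec.2 T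

theorem mono {B' : ℝ} (h : IsMultiplier n m s s' μ B) (hB : B ≤ B') :
    IsMultiplier n m s s' μ B' :=
  ⟨h.meas, h.symm, fun η => (h.bound η).trans
    (by have := (weight_pos n hm.out s η).le; gcongr)⟩

/-- The inclusion of H^s in H^s' is treated as a multiplier, so that loss of regularity and
differential operators belong to one calculus. -/
theorem one (h : s' ≤ s) : IsMultiplier n m s s' (fun _ => 1) (m ^ (s' - s)) where
  meas := aestronglyMeasurable_const
  symm _ := by simp
  bound η := by simpa using weight_mono hm.out h η

/-- Strong continuity of a family of multipliers. -/
theorem tendsto {ι : Type*} {l : Filter ι} [l.IsCountablyGenerated] {μ : ι → Sp n → ℂ}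
    {μ₀ : Sp n → ℂ} {B : ι → ℝ} {B₀ C : ℝ} (h : ∀ i, IsMultiplier n m s s' (μ i) (B i))
    (h₀ : IsMultiplier n m s s' μ₀ B₀) (hC : ∀ᶠ i in l, B i ≤ C)
    (hlim : ∀ η, Tendsto (fun i => μ i η) l (𝓝 (μ₀ η))) (T : Sobolev n m s) :
    Tendsto (fun i => (h i).clm T) l (𝓝 (h₀.clm T)) := by
  have hG : MemLp (fun η => (max C B₀) * ‖(weight n m s η : ℂ) * T.hat η‖) 2 volume :=
    T.memLp_hat.norm.const_mul _
  have key : ∀ (ν : Sp n → ℂ) (D : ℝ), IsMultiplier n m s s' ν D → D ≤ max C B₀ → ∀ η,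
      weight n m s' η * ‖ν η * T.hat η‖ ≤
        (max C B₀) * ‖(weight n m s η : ℂ) * T.hat η‖ := by
    intro ν D hν hD η
    rw [norm_mul, norm_mul, Complex.norm_real, Real.norm_of_nonneg (weight_pos n hm.out _ η).le,
      ← mul_assoc, ← mul_assoc]
    exact mul_le_mul_of_nonneg_right ((hν.mono hD).bound η) (norm_nonneg _)
  refine Sobolev.tendsto_of_dominated hG (fun i => (h i).hat_clm T) (h₀.hat_clm T) ?_
    (ae_of_all _ (key _ _ h₀ (le_max_right _ _))) (ae_of_all _ fun η => (hlim η).mul_const _)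
  filter_upwards [hC] with i hi
  exact ae_of_all _ (key _ _ (h i) (hi.trans (le_max_left _ _)))

/-- Strong differentiability of a family of multipliers. -/
theorem hasDerivAt {s'' : ℝ} {μ μ' : ℝ → Sp n → ℂ} {B B' : ℝ → ℝ}
    (h : ∀ τ, IsMultiplier n m s s' (μ τ) (B τ)) (h' : ∀ τ, IsMultiplier n m s s'' (μ' τ) (B' τ))
    (hs : s'' ≤ s') (hB' : ∀ R : ℝ, ∃ C, ∀ τ, |τ| ≤ R → B' τ ≤ C)
    (hd : ∀ τ η, HasDerivAt (fun τ => μ τ η) (μ' τ η) τ) (T : Sobolev n m s) (τ : ℝ) :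
    HasDerivAt (fun τ => (one (n := n) hs).clm ((h τ).clm T)) ((h' τ).clm T) τ := by
  rw [hasDerivAt_iff_tendsto_slope]
  obtain ⟨C, hC⟩ := hB' (|τ| + 1)
  have hG : MemLp (fun η => C * ‖(weight n m s η : ℂ) * T.hat η‖) 2 volume :=
    T.memLp_hat.norm.const_mul _
  have key : ∀ τ' η, |τ'| ≤ |τ| + 1 →
      weight n m s'' η * ‖μ' τ' η‖ ≤ C * weight n m s η := by
    intro τ' η hτ'
    exact ((h' τ').mono (hC _ hτ')).bound η
  refine Sobolev.tendsto_of_dominated (F := fun τ' η => slope (fun τ => μ τ η) τ τ' * T.hat η) hG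
    (fun τ' => ?_) ((h' τ).hat_clm T) ?_ (ae_of_all _ fun η => ?_) (ae_of_all _ fun η => ?_)
  · rw [slope_def_module]
    filter_upwards [Sobolev.hat_smul (τ' - τ)⁻¹ ((one (n := n) hs).clm ((h τ').clm T) -
      (one (n := n) hs).clm ((h τ).clm T)), Sobolev.hat_sub ((one (n := n) hs).clm ((h τ').clm T))
      ((one (n := n) hs).clm ((h τ).clm T)), (one (n := n) hs).hat_clm ((h τ').clm T),
      (one (n := n) hs).hat_clm ((h τ).clm T), (h τ').hat_clm T, (h τ).hat_clm T]
      with η h1 h2 h3 h4 h5 h6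
    rw [h1, h2, h3, h4, h5, h6, slope_def_module, Complex.real_smul]
    ring
  · have : ∀ᶠ τ' in 𝓝[≠] τ, τ' ∈ Metric.ball τ 1 :=
      mem_nhdsWithin_of_mem_nhds (Metric.ball_mem_nhds τ one_pos)
    filter_upwards [this] with τ' hτ'
    refine ae_of_all _ fun η => ?_
    have hw := weight_pos n hm.out s'' η
    -- The difference quotients are bounded by the mean value inequality, using the bound on μ' over
    -- the ball of radius 1 about τ. This is the dominating function, uniform in τ'.
    have h1 : ∀ x ∈ Metric.ball τ 1, ‖μ' x η‖ ≤ C * weight n m s η / weight n m s'' η := by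
      intro x hx
      rw [le_div_iff₀ hw, mul_comm]
      refine key x η ?_
      rw [Metric.mem_ball, Real.dist_eq] at hx
      have := abs_sub_abs_le_abs_sub x τ
      linarith
    have h2 := (convex_ball τ 1).norm_image_sub_le_of_norm_hasDerivWithin_le
      (f := fun τ => μ τ η) (fun x _ => (hd x η).hasDerivWithinAt) h1
      (Metric.mem_ball_self one_pos) hτ'
    have h3 : ‖slope (fun τ => μ τ η) τ τ'‖ ≤ C * weight n m s η / weight n m s'' η := by
      rw [slope_def_module, norm_smul, norm_inv]
      -- At τ' = τ the slope is 0 by convention, so the bound holds there as well.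
      rcases eq_or_ne τ' τ with rfl | hne
      · simp only [sub_self, norm_zero, mul_zero]
        exact (norm_nonneg _).trans (h1 τ' (Metric.mem_ball_self one_pos))
      · have : 0 < ‖τ' - τ‖ := norm_pos_iff.2 (sub_ne_zero.2 hne)
        rw [inv_mul_le_iff₀ this, mul_comm]
        exact h2
    rw [le_div_iff₀ hw] at h3
    rw [norm_mul, norm_mul, Complex.norm_real, Real.norm_of_nonneg (weight_pos n hm.out _ η).le,
      ← mul_assoc, ← mul_assoc]
    exact mul_le_mul_of_nonneg_right (by linarith) (norm_nonneg _)
  · rw [norm_mul, norm_mul, Complex.norm_real, Real.norm_of_nonneg (weight_pos n hm.out _ η).le,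
      ← mul_assoc, ← mul_assoc]
    exact mul_le_mul_of_nonneg_right (key τ η (by linarith)) (norm_nonneg _)
  · exact ((hasDerivAt_iff_tendsto_slope.1 (hd τ η))).mul_const _

end IsMultiplier

end

/-! ### Elements of H^s as functions: Fourier inversion and the Sobolev embedding. -/

section

section Functions

variable {n : ℕ} {m s : ℝ}

theorem toTemperedDistribution_injective {g g' : Lp ℂ 2 (volume : Measure (Sp n))}
    (h : Lp.toTemperedDistribution g = Lp.toTemperedDistribution g') : g = g' :=
  LinearMap.ker_eq_bot.1
    (Lp.ker_toTemperedDistributionCLM_eq_bot (F := ℂ) (E := Sp n) (μ := volume) (p := 2)) h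

theorem hasHat_toTemperedDistribution (g : Lp ℂ 2 (volume : Measure (Sp n))) :
    HasHat (Lp.toTemperedDistribution g) (𝓕 g : Lp ℂ 2 (volume : Measure (Sp n))) := by
  intro f
  rw [Lp.fourier_toTemperedDistribution_eq, Lp.toTemperedDistribution_apply]
  rfl

theorem isRealDist_toTemperedDistribution {g : Lp ℂ 2 (volume : Measure (Sp n))}
    (h : ∀ᵐ x, (g x).im = 0) : IsRealDist (Lp.toTemperedDistribution g) := by
  intro f hf
  rw [Lp.toTemperedDistribution_apply, ← Complex.conj_eq_iff_im, ← integral_conj]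
  refine integral_congr_ae ?_
  filter_upwards [h] with x hx
  rw [smul_eq_mul, map_mul, Complex.conj_eq_iff_im.2 hx, Complex.conj_eq_iff_im.2 (hf x)]

theorem im_eq_zero_of_isRealDist {g : Lp ℂ 2 (volume : Measure (Sp n))}
    (h : IsRealDist (Lp.toTemperedDistribution g)) : ∀ᵐ x, (g x).im = 0 := by
  have e : Lp.toTemperedDistribution ((Complex.conjCLE : ℂ →L[ℝ] ℂ).compLp g) =
      Lp.toTemperedDistribution g := by
    ext f
    have h1 := h.conj (schwartzConj f)
    have h2 : schwartzConj (schwartzConj f) = f := by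
      ext x; simp [schwartzConj_apply]
    rw [h2] at h1
    rw [h1, Lp.toTemperedDistribution_apply, Lp.toTemperedDistribution_apply, ← integral_conj]
    refine integral_congr_ae ?_
    filter_upwards [ContinuousLinearMap.coeFn_compLp (Complex.conjCLE : ℂ →L[ℝ] ℂ) g] with x hx
    rw [hx]
    simp [schwartzConj_apply]
  have e2 := toTemperedDistribution_injective e
  have e3 := ContinuousLinearMap.coeFn_compLp (Complex.conjCLE : ℂ →L[ℝ] ℂ) g
  rw [e2] at e3
  filter_upwards [e3] with x hx
  exact Complex.conj_eq_iff_im.1 hx.symm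

/-- The Fourier inversion formula for an integrable Fourier transform. -/
theorem HasHat.ae_eq_fourierInv {g : Lp ℂ 2 (volume : Measure (Sp n))} {h : Sp n → ℂ}
    (H : HasHat (Lp.toTemperedDistribution g) h) (hh : Integrable h) :
    g =ᵐ[volume] 𝓕⁻ h := by
  have hc : Continuous (𝓕⁻ h) := by
    rw [Real.fourierInv_eq_fourier_comp_neg]
    exact VectorFourier.fourierIntegral_continuous Real.continuous_fourierChar
      (by exact continuous_inner) hh.comp_neg
  -- Both sides are locally integrable, so it suffices to test against smooth compactly supported
  -- functions. These are Schwartz functions, and the transform is moved from h to the test function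
  -- by Fubini.
  refine ae_eq_of_integral_contDiff_smul_eq ((Lp.memLp g).locallyIntegrable (by simp))
    hc.locallyIntegrable fun φ hφ hφc => ?_
  have hg₁ : HasCompactSupport (Complex.ofRealCLM ∘ φ) := hφc.comp_left rfl
  have hg₂ : ContDiff ℝ (⊤ : ℕ∞) (Complex.ofRealCLM ∘ φ) := by fun_prop
  set Φ : 𝓢(Sp n, ℂ) := hg₁.toSchwartzMap hg₂ with hΦ
  have hΦa : ∀ x, Φ x = (φ x : ℂ) := fun x => rfl
  have h1 : ∫ x, φ x • g x = Lp.toTemperedDistribution g Φ := by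
    rw [Lp.toTemperedDistribution_apply]
    rfl
  have h2 : Lp.toTemperedDistribution g Φ = ∫ η, (𝓕⁻ Φ : 𝓢(Sp n, ℂ)) η * h η := by
    rw [← H, TemperedDistribution.fourier_apply, FourierTransform.fourier_fourierInv_eq]
  have h3 : ∫ η, (𝓕⁻ Φ : 𝓢(Sp n, ℂ)) η * h η = ∫ η, (𝓕 (Φ : Sp n → ℂ)) η * h (-η) := by
    rw [← integral_neg_eq_self]
    refine integral_congr_ae (ae_of_all _ fun η => ?_)
    simp only [SchwartzMap.fourierInv_coe]
    rw [Real.fourierInv_eq_fourier_neg, neg_neg]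
  have h4 : ∫ η, (𝓕 (Φ : Sp n → ℂ)) η * h (-η) = ∫ x, Φ x * (𝓕 fun y => h (-y)) x := by
    simpa using! VectorFourier.integral_fourierIntegral_smul_eq_flip (L := innerₗ (Sp n))
      Real.continuous_fourierChar continuous_inner Φ.integrable hh.comp_neg
  rw [h1, h2, h3, h4]
  refine integral_congr_ae (ae_of_all _ fun η => ?_)
  simp only [Real.fourierInv_eq_fourier_comp_neg]
  rfl

theorem weight_sq (hm : 0 < m) (η : Sp n) :
    weight n m s η ^ 2 = weightConst n * (m ^ 2 + ‖(2 * Real.pi) • η‖ ^ 2) ^ s := by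
  unfold weight weightConst
  have h : (m ^ 2 + ‖(2 * Real.pi) • η‖ ^ 2) ^ s =
      ((m ^ 2 + ‖(2 * Real.pi) • η‖ ^ 2) ^ (s / 2)) ^ 2 := by
    rw [pow_two (_ ^ (s / 2)), ← Real.rpow_add (by positivity), add_halves]
  rw [mul_pow, h]

/-- With c = min(m², (2π)²) one has c(1+|η|²) ≤ m² + |2πη|², which reduces the claim to the
integrability of (1+|η|²)^(-s) for 2s > n. -/
theorem integrable_weight_neg_sq (hm : 0 < m) (hs : (n : ℝ) / 2 < s) :
    Integrable (fun η : Sp n => weight n m (-s) η ^ 2) := by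
  have hs0 : 0 < s := lt_of_le_of_lt (by positivity) hs
  have h1 : Integrable (fun η : Sp n => (1 + ‖η‖ ^ 2) ^ (-(2 * s) / 2)) volume :=
    integrable_rpow_neg_one_add_norm_sq (by simp; linarith)
  set c := min (m ^ 2) ((2 * Real.pi) ^ 2) with hc
  have hc0 : 0 < c := lt_min (by positivity) (by positivity)
  refine (h1.const_mul (weightConst n * c ^ (-s))).mono'
    ((continuous_weight n hm (-s)).pow 2).aestronglyMeasurable (ae_of_all _ fun η => ?_)
  rw [Real.norm_of_nonneg (by positivity), weight_sq hm, mul_assoc]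
  have := (weightConst_pos n).le
  gcongr
  rw [show -(2 * s) / 2 = -s by ring, ← Real.mul_rpow hc0.le (by positivity)]
  refine Real.rpow_le_rpow_of_nonpos (by positivity) ?_ (by linarith)
  rw [norm_smul, mul_pow, Real.norm_of_nonneg (by positivity)]
  have h2 : c ≤ m ^ 2 := min_le_left _ _
  have h3 : c ≤ (2 * Real.pi) ^ 2 := min_le_right _ _
  have h4 : 0 ≤ ‖η‖ ^ 2 := by positivity
  nlinarith [mul_le_mul_of_nonneg_right h3 h4]

theorem memLp_weight_neg (hm : 0 < m) (hs : (n : ℝ) / 2 < s) :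
    MemLp (fun η : Sp n => weight n m (-s) η) 2 volume :=
  (memLp_two_iff_integrable_sq (continuous_weight n hm (-s)).aestronglyMeasurable).2
    (integrable_weight_neg_sq hm hs)

namespace Sobolev

variable [hm : Fact (0 < m)]

theorem hat_eq_weight_mul (T : Sobolev n m s) (η : Sp n) :
    T.hat η = (((weightConst n)⁻¹ * weight n m (-s) η : ℝ) : ℂ) *
      ((weight n m s η : ℂ) * T.hat η) := by
  rw [← weight_inv n hm.out]
  have : (weight n m s η : ℂ) ≠ 0 := by exact_mod_cast (weight_pos n hm.out s η).ne'
  push_cast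
  field_simp

theorem integrable_hat (hs : (n : ℝ) / 2 < s) (T : Sobolev n m s) : Integrable T.hat := by
  have h1 : MemLp (fun η : Sp n => (((weightConst n)⁻¹ * weight n m (-s) η : ℝ) : ℂ)) 2 volume :=
    ((memLp_weight_neg hm.out hs).const_mul _).ofReal
  have h2 := h1.integrable_mul T.memLp_hat
  refine h2.congr (ae_of_all _ fun η => ?_)
  rw [Pi.mul_apply, ← hat_eq_weight_mul]

/-- Cauchy–Schwarz: the transform is the inverse weight, in L² because s > n/2, times the weighted
transform. The added 1 only makes the constant positive. -/
theorem exists_integral_hat_le (n : ℕ) (m s : ℝ) [hm : Fact (0 < m)] (hs : (n : ℝ) / 2 < s) :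
    ∃ M : ℝ, 0 < M ∧ ∀ T : Sobolev n m s, ∫ η, ‖T.hat η‖ ≤ M * ‖T‖ := by
  have h1 : MemLp (fun η : Sp n => (((weightConst n)⁻¹ * weight n m (-s) η : ℝ) : ℂ)) 2 volume :=
    ((memLp_weight_neg hm.out hs).const_mul _).ofReal
  refine ⟨(eLpNorm (fun η : Sp n => (((weightConst n)⁻¹ * weight n m (-s) η : ℝ) : ℂ)) 2
    volume).toReal + 1, by positivity, fun T => ?_⟩
  have h2 := eLpNorm_smul_le_mul_eLpNorm (p := 2) (q := 2) (r := 1) T.memLp_hat.1 h1.1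
  have h3 : ((fun η : Sp n => (((weightConst n)⁻¹ * weight n m (-s) η : ℝ) : ℂ)) •
      fun η => (weight n m s η : ℂ) * T.hat η) = T.hat := by
    funext η
    rw [Pi.smul_apply', smul_eq_mul, ← hat_eq_weight_mul]
  rw [h3, eLpNorm_one_eq_lintegral_enorm] at h2
  rw [integral_norm_eq_lintegral_enorm T.aestronglyMeasurable_hat, norm_eq]
  have h4 := ENNReal.toReal_mono (ENNReal.mul_ne_top h1.2.ne T.memLp_hat.2.ne) h2
  rw [ENNReal.toReal_mul] at h4
  refine h4.trans ?_
  gcongr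
  linarith

theorem memLp_hat_two (hs : 0 ≤ s) (T : Sobolev n m s) : MemLp T.hat 2 volume := by
  have h := (memLp_weight_mono hm.out hs T.memLp_hat).const_mul
    ((((2 * Real.pi) ^ ((n : ℝ) / 2) : ℝ) : ℂ)⁻¹)
  refine h.ae_eq (ae_of_all _ fun η => ?_)
  have : (((2 * Real.pi) ^ ((n : ℝ) / 2) : ℝ) : ℂ) ≠ 0 := by
    have : (0 : ℝ) < (2 * Real.pi) ^ ((n : ℝ) / 2) := by positivity
    exact_mod_cast this.ne'
  simp only [weight, zero_div, Real.rpow_zero, mul_one]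
  field_simp

/-- Plancherel: the weight of exponent 0 is the constant (2π)^(n/2), and monotonicity of the weights
gives the bound. -/
theorem exists_toL2 (hs : 0 ≤ s) : ∃ A : Sobolev n m s →L[ℝ] Lp ℂ 2 (volume : Measure (Sp n)),
    ∀ T, T.toDist = Lp.toTemperedDistribution (A T) := by
  have h : ∀ T : Sobolev n m s, ∃ g : Lp ℂ 2 (volume : Measure (Sp n)),
      T.toDist = Lp.toTemperedDistribution g ∧
        ‖g‖ ≤ (((2 * Real.pi) ^ ((n : ℝ) / 2))⁻¹ * m ^ (0 - s)) * ‖T‖ := by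
    intro T
    have h2 := T.memLp_hat_two hs
    have h3 : 𝓕 (𝓕⁻ (h2.toLp _)) = h2.toLp _ := FourierTransform.fourier_fourierInv_eq _
    refine ⟨𝓕⁻ (h2.toLp _), ?_, ?_⟩
    · refine T.hasHat.eq_dist ?_
      refine (hasHat_toTemperedDistribution _).congr ?_
      rw [h3]
      exact h2.coeFn_toLp
    · rw [← Lp.norm_fourier_eq, h3]
      rw [← weightedₗᵢ.norm_map T]
      refine Lp.norm_le_mul_norm_of_ae_le_mul ?_
      filter_upwards [h2.coeFn_toLp] with η hη
      rw [hη]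
      change _ ≤ _ * ‖T.weighted η‖
      rw [← weight_mul_hat, norm_mul, Complex.norm_real,
        Real.norm_of_nonneg (weight_pos n hm.out _ η).le, ← mul_assoc]
      have h3 := weight_mono (n := n) hm.out hs η
      simp only [weight, zero_div, Real.rpow_zero, mul_one] at h3 ⊢
      have h4 : (0 : ℝ) < (2 * Real.pi) ^ ((n : ℝ) / 2) := by positivity
      have h5 : 1 ≤ ((2 * Real.pi) ^ ((n : ℝ) / 2))⁻¹ * m ^ (0 - s) * ((2 * Real.pi) ^ ((n : ℝ) / 2)
          * (m ^ 2 + ‖(2 * Real.pi) • η‖ ^ 2) ^ (s / 2)) := by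
        rw [mul_assoc, ← div_eq_inv_mul, le_div_iff₀ h4, one_mul]
        exact h3
      calc ‖T.hat η‖ = 1 * ‖T.hat η‖ := (one_mul _).symm
        _ ≤ _ := mul_le_mul_of_nonneg_right h5 (norm_nonneg _)
  choose A hA hAn using h
  let A' : Sobolev n m s →ₗ[ℝ] Lp ℂ 2 (volume : Measure (Sp n)) :=
    { toFun := A
      map_add' := fun T T' => toTemperedDistribution_injective <| by
        rw [← hA, map_add, hA, hA]
        simp only [← Lp.toTemperedDistributionCLM_apply, map_add]
      map_smul' := fun c T => toTemperedDistribution_injective <| by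
        have hc : c • A T = (c : ℂ) • A T := by
          rw [← algebraMap_smul ℂ c (A T)]
          rfl
        rw [← hA, map_smul, hA, RingHom.id_apply, hc, real_smul_dist]
        simp only [← Lp.toTemperedDistributionCLM_apply, map_smul] }
  exact ⟨A'.mkContinuous _ hAn, hA⟩

/-- The embedding of `H^s` into `L²` for `s ≥ 0`. -/
def toL2 (hs : 0 ≤ s) : Sobolev n m s →L[ℝ] Lp ℂ 2 (volume : Measure (Sp n)) :=
  (exists_toL2 hs).choose

theorem toDist_eq_toL2 (hs : 0 ≤ s) (T : Sobolev n m s) :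
    T.toDist = Lp.toTemperedDistribution (toL2 hs T) := (exists_toL2 hs).choose_spec T

theorem toL2_im (hs : 0 ≤ s) (T : Sobolev n m s) : ∀ᵐ x, (toL2 hs T x).im = 0 := by
  apply im_eq_zero_of_isRealDist
  rw [← toDist_eq_toL2]
  exact T.isRealDist

/-- The real function that represents an element of `H^s` for `s ≥ 0`. -/
def rep (hs : 0 ≤ s) : Sobolev n m s →ₗ[ℝ] (Sp n →ₘ[volume] ℝ) where
  toFun T := AEEqFun.mk (fun x => (toL2 hs T x).re)
    (Complex.continuous_re.comp_aestronglyMeasurable (Lp.aestronglyMeasurable _))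
  map_add' T T' := by
    rw [AEEqFun.mk_add_mk, AEEqFun.mk_eq_mk, map_add]
    filter_upwards [Lp.coeFn_add (toL2 hs T) (toL2 hs T')] with x hx
    rw [hx]
    simp
  map_smul' c T := by
    rw [RingHom.id_apply, AEEqFun.smul_mk, AEEqFun.mk_eq_mk, map_smul]
    filter_upwards [Lp.coeFn_smul c (toL2 hs T)] with x hx
    rw [hx]
    simp

theorem coeFn_rep (hs : 0 ≤ s) (T : Sobolev n m s) :
    rep hs T =ᵐ[volume] fun x => (toL2 hs T x).re := AEEqFun.coeFn_mk _ _

theorem toL2_ae_eq (hs : 0 ≤ s) (T : Sobolev n m s) :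
    toL2 hs T =ᵐ[volume] fun x => (rep hs T x : ℂ) := by
  filter_upwards [coeFn_rep hs T, toL2_im hs T] with x h1 h2
  rw [h1]
  exact Complex.ext (by simp) (by simpa using h2)

/-- All spaces H^s with s ≥ 0 are compared inside the single space of measurable functions modulo
null sets, where products are defined without any regularity. -/
theorem rep_eq_iff {s' : ℝ} (hs : 0 ≤ s) (hs' : 0 ≤ s') (T : Sobolev n m s)
    (T' : Sobolev n m s') : rep hs T = rep hs' T' ↔ T.toDist = T'.toDist := by
  rw [toDist_eq_toL2 hs, toDist_eq_toL2 hs']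
  constructor
  · intro h
    congr 1
    apply Lp.ext
    filter_upwards [toL2_ae_eq hs T, toL2_ae_eq hs' T'] with x h1 h2
    rw [h1, h2, h]
  · intro h
    have := toTemperedDistribution_injective h
    apply AEEqFun.ext
    filter_upwards [coeFn_rep hs T, coeFn_rep hs' T'] with x h1 h2
    rw [h1, h2, this]

theorem rep_injective (hs : 0 ≤ s) :
    Function.Injective (rep hs : Sobolev n m s →ₗ[ℝ] (Sp n →ₘ[volume] ℝ)) := by
  intro T T' h
  exact Subtype.ext ((rep_eq_iff hs hs T T').1 h)

/-- The arbitrary choice in `representative` is harmless since an L² function is determined by its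
distribution. -/
theorem representative_ae_eq (hs : 0 ≤ s) (T : Sobolev n m s) :
    representative T.toDist =ᵐ[volume] rep hs T := by
  have h : ∃ g : Lp ℂ 2 (volume : Measure (Sp n)), T.toDist = Lp.toTemperedDistribution g :=
    ⟨_, toDist_eq_toL2 hs T⟩
  have h2 : h.choose = toL2 hs T := toTemperedDistribution_injective <| by
    rw [← h.choose_spec, toDist_eq_toL2 hs T]
  filter_upwards [coeFn_rep hs T] with x hx
  rw [hx]
  unfold representative
  rw [dif_pos h, h2]

theorem toL2_ae_eq_fourierInv (hs : (n : ℝ) / 2 < s) (hs' : 0 ≤ s) (T : Sobolev n m s) :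
    toL2 hs' T =ᵐ[volume] 𝓕⁻ T.hat := by
  refine HasHat.ae_eq_fourierInv ?_ (T.integrable_hat hs)
  rw [← toDist_eq_toL2]
  exact T.hasHat

theorem norm_fourierInv_le {h : Sp n → ℂ} (x : Sp n) : ‖𝓕⁻ h x‖ ≤ ∫ η, ‖h η‖ := by
  rw [Real.fourierInv_eq_fourier_neg]
  exact VectorFourier.norm_fourierIntegral_le_integral_norm _ _ _ _ _

/-- The Sobolev embedding into bounded functions. -/
theorem exists_abs_rep_le (n : ℕ) (m s : ℝ) [hm : Fact (0 < m)] (hs : (n : ℝ) / 2 < s)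
    (hs' : 0 ≤ s) : ∃ M : ℝ, 0 < M ∧ ∀ T : Sobolev n m s, ∀ᵐ x, |rep hs' T x| ≤ M * ‖T‖ := by
  obtain ⟨M, hM, h⟩ := exists_integral_hat_le n m s hs
  refine ⟨M, hM, fun T => ?_⟩
  filter_upwards [toL2_ae_eq_fourierInv hs hs' T, coeFn_rep hs' T] with x h1 h2
  rw [h2, h1]
  exact (Complex.abs_re_le_norm _).trans ((norm_fourierInv_le x).trans (h T))

end Sobolev

end Functions

end

/-! ### Multiplication in Sobolev spaces. -/

section

section Product

variable {n : ℕ} {m a b : ℝ}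

/-- Since t ≤ 4 max(p,q), t^b is at most 4^b(p^b + q^b). The q^b part leaves p^(-a). The p^b part
leaves p^(b-a) q^(-b), whose exponents are both nonpositive, so it is at most min(p,q)^(-a). This is
the only place where b ≤ a and b ≥ 0 are combined. -/
theorem rpow_kernel_le {p q t : ℝ} (hp : 0 < p) (hq : 0 < q) (ht : 0 < t) (htpq : t ≤ 2 * (p + q))
    (hb : 0 ≤ b) (hab : b ≤ a) :
    t ^ b * p ^ (-a) * q ^ (-b) ≤ 4 ^ b * 2 * (p ^ (-a) + q ^ (-a)) := by
  have key : ∀ x y : ℝ, 0 < x → 0 < y → 0 ≤ x ^ (-y) := fun x y hx _ => by positivity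
  have hpa : 0 < p ^ (-a) := by positivity
  have hqa : 0 < q ^ (-a) := by positivity
  have h1 : t ^ b ≤ 4 ^ b * (p ^ b + q ^ b) := by
    have h0 : 0 < p ^ b := by positivity
    have h0' : 0 < q ^ b := by positivity
    rcases le_total p q with h | h
    · calc t ^ b ≤ (4 * q) ^ b := Real.rpow_le_rpow ht.le (by linarith) hb
        _ = 4 ^ b * q ^ b := Real.mul_rpow (by norm_num) hq.le
        _ ≤ _ := by gcongr; linarith
    · calc t ^ b ≤ (4 * p) ^ b := Real.rpow_le_rpow ht.le (by linarith) hb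
        _ = 4 ^ b * p ^ b := Real.mul_rpow (by norm_num) hp.le
        _ ≤ _ := by gcongr; linarith
  have h2 : p ^ (b - a) * q ^ (-b) ≤ p ^ (-a) + q ^ (-a) := by
    rcases le_total p q with h | h
    · have : q ^ (-b) ≤ p ^ (-b) := Real.rpow_le_rpow_of_nonpos hp h (by linarith)
      calc p ^ (b - a) * q ^ (-b) ≤ p ^ (b - a) * p ^ (-b) := by gcongr
        _ = p ^ (-a) := by rw [← Real.rpow_add hp]; congr 1; ring
        _ ≤ _ := by linarith
    · have : p ^ (b - a) ≤ q ^ (b - a) := Real.rpow_le_rpow_of_nonpos hq h (by linarith)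
      calc p ^ (b - a) * q ^ (-b) ≤ q ^ (b - a) * q ^ (-b) := by gcongr
        _ = q ^ (-a) := by rw [← Real.rpow_add hq]; congr 1; ring
        _ ≤ _ := by linarith
  have h3 : p ^ b * p ^ (-a) = p ^ (b - a) := by rw [← Real.rpow_add hp]; rfl
  have h4 : q ^ b * q ^ (-b) = 1 := by rw [← Real.rpow_add hq]; simp
  have h5 : (0 : ℝ) < 4 ^ b := by positivity
  calc t ^ b * p ^ (-a) * q ^ (-b) ≤ (4 ^ b * (p ^ b + q ^ b)) * p ^ (-a) * q ^ (-b) := by gcongr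
    _ = 4 ^ b * (p ^ b * p ^ (-a) * q ^ (-b) + (q ^ b * q ^ (-b)) * p ^ (-a)) := by ring
    _ = 4 ^ b * (p ^ (b - a) * q ^ (-b) + p ^ (-a)) := by rw [h3, h4, one_mul]
    _ ≤ 4 ^ b * ((p ^ (-a) + q ^ (-a)) + (p ^ (-a) + q ^ (-a))) := by gcongr; linarith
    _ = _ := by ring

/-- The case p = ⟨ξ⟩², q = ⟨z-ξ⟩², t = ⟨z⟩² of the preceding inequality; t ≤ 2(p+q) is the
parallelogram estimate. The right-hand side has an integral over ξ that does not depend on z. -/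
theorem weight_kernel_le (hm : 0 < m) (hb : 0 ≤ b) (hab : b ≤ a) (ξ z : Sp n) :
    (weight n m b z * (weight n m (-a) ξ * weight n m (-b) (z - ξ))) ^ 2 ≤
      weightConst n ^ 2 * (4 ^ b * 2) * (weight n m (-a) ξ ^ 2 + weight n m (-a) (z - ξ) ^ 2) := by
  rw [mul_pow, mul_pow, weight_sq hm, weight_sq hm, weight_sq hm, weight_sq hm]
  have hc := weightConst_pos n
  have h := rpow_kernel_le (p := m ^ 2 + ‖(2 * Real.pi) • ξ‖ ^ 2)
    (q := m ^ 2 + ‖(2 * Real.pi) • (z - ξ)‖ ^ 2) (t := m ^ 2 + ‖(2 * Real.pi) • z‖ ^ 2)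
    (by positivity) (by positivity) (by positivity) (by
      have h1 : (2 * Real.pi) • z = (2 * Real.pi) • ξ + (2 * Real.pi) • (z - ξ) := by
        rw [← smul_add, add_sub_cancel]
      have h2 := norm_add_le ((2 * Real.pi) • ξ) ((2 * Real.pi) • (z - ξ))
      rw [← h1] at h2
      have h3 := norm_nonneg ((2 * Real.pi) • z)
      have h4 := norm_nonneg ((2 * Real.pi) • ξ)
      have h5 := norm_nonneg ((2 * Real.pi) • (z - ξ))
      nlinarith [sq_nonneg (‖(2 * Real.pi) • ξ‖ - ‖(2 * Real.pi) • (z - ξ)‖), sq_nonneg m]) hb hab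
  calc _ = weightConst n ^ 3 * ((m ^ 2 + ‖(2 * Real.pi) • z‖ ^ 2) ^ b *
        (m ^ 2 + ‖(2 * Real.pi) • ξ‖ ^ 2) ^ (-a) *
        (m ^ 2 + ‖(2 * Real.pi) • (z - ξ)‖ ^ 2) ^ (-b)) := by ring
    _ ≤ weightConst n ^ 3 * (4 ^ b * 2 * ((m ^ 2 + ‖(2 * Real.pi) • ξ‖ ^ 2) ^ (-a) +
        (m ^ 2 + ‖(2 * Real.pi) • (z - ξ)‖ ^ 2) ^ (-a))) := by gcongr
    _ = _ := by ring

/-- The Cauchy–Schwarz inequality for the Lebesgue integral. -/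
theorem lintegral_mul_sq_le {α : Type*} [MeasurableSpace α] (μ : Measure α) {f g : α → ℝ≥0∞}
    (hf : AEMeasurable f μ) (hg : AEMeasurable g μ) :
    (∫⁻ x, f x * g x ∂μ) ^ 2 ≤ (∫⁻ x, f x ^ 2 ∂μ) * ∫⁻ x, g x ^ 2 ∂μ := by
  have h := ENNReal.lintegral_mul_le_Lp_mul_Lq μ Real.HolderConjugate.two_two hf hg
  simp only [Pi.mul_apply, ENNReal.rpow_two] at h
  calc _ ≤ ((∫⁻ x, f x ^ 2 ∂μ) ^ (1 / (2 : ℝ)) * (∫⁻ x, g x ^ 2 ∂μ) ^ (1 / (2 : ℝ))) ^ 2 := by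
        gcongr
    _ = _ := by
      rw [mul_pow, ← ENNReal.rpow_two, ← ENNReal.rpow_two, ← ENNReal.rpow_mul, ← ENNReal.rpow_mul]
      norm_num

theorem eLpNorm_two_sq {α : Type*} [MeasurableSpace α] (μ : Measure α) (f : α → ℂ) :
    eLpNorm f 2 μ ^ 2 = ∫⁻ x, ‖f x‖ₑ ^ 2 ∂μ := by
  rw [eLpNorm_eq_lintegral_rpow_enorm_toReal (by simp) (by simp), ← ENNReal.rpow_two,
    ← ENNReal.rpow_mul]
  simp

/-- The `L²`-bound of a weighted convolution by a bounded kernel. -/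
theorem lintegral_kernel_sq_le {u v : Sp n → ℝ≥0∞} (hu : AEMeasurable u volume)
    (hv : AEMeasurable v volume) {k : Sp n → Sp n → ℝ≥0∞}
    (hk : ∀ z, AEMeasurable (k z) volume) {K : ℝ≥0∞}
    (hK : ∀ z, ∫⁻ ξ, k z ξ ^ 2 ≤ K) :
    ∫⁻ z, (∫⁻ ξ, (u ξ * v (z - ξ)) * k z ξ) ^ 2 ≤ K * ((∫⁻ ξ, u ξ ^ 2) * ∫⁻ ξ, v ξ ^ 2) := by
  have hv' : ∀ z : Sp n, AEMeasurable (fun ξ => v (z - ξ)) volume := fun z =>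
    hv.comp_quasiMeasurePreserving
      (Measure.measurePreserving_sub_left volume z).quasiMeasurePreserving
  calc ∫⁻ z, (∫⁻ ξ, (u ξ * v (z - ξ)) * k z ξ) ^ 2
      ≤ ∫⁻ z, (∫⁻ ξ, (u ξ * v (z - ξ)) ^ 2) * K := by
        -- Cauchy–Schwarz in ξ for each z: the kernel contributes at most K, and the rest is
        -- integrated in z by Tonelli.
        refine lintegral_mono fun z => ?_
        exact (lintegral_mul_sq_le volume (hu.mul (hv' z)) (hk z)).trans
          (mul_le_mul' le_rfl (hK z))
    _ ≤ K * ∫⁻ z, ∫⁻ ξ, u ξ ^ 2 * v (z - ξ) ^ 2 := by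
        simp only [mul_pow, mul_comm _ K]
        rw [lintegral_const_mul'']
        have : AEMeasurable (fun p : Sp n × Sp n => u p.2 ^ 2 * v (p.1 - p.2) ^ 2)
            (volume.prod volume) := by
          refine ((hu.comp_quasiMeasurePreserving Measure.quasiMeasurePreserving_snd).pow_const
            2).mul ((hv.comp_quasiMeasurePreserving
              (quasiMeasurePreserving_sub_of_right_invariant volume volume)).pow_const 2)
        exact this.lintegral_prod_right'
    _ = K * ((∫⁻ ξ, u ξ ^ 2) * ∫⁻ ξ, v ξ ^ 2) := by
        congr 1
        rw [lintegral_lintegral_swap]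
        · have : ∀ ξ, ∫⁻ z, u ξ ^ 2 * v (z - ξ) ^ 2 = u ξ ^ 2 * ∫⁻ z, v z ^ 2 := by
            intro ξ
            rw [lintegral_const_mul'', lintegral_sub_right_eq_self (fun z => v z ^ 2) ξ]
            exact (hv.comp_quasiMeasurePreserving
              (measurePreserving_sub_right volume ξ).quasiMeasurePreserving).pow_const 2
          simp only [this]
          rw [lintegral_mul_const'' _ (hu.pow_const 2)]
        · exact ((hu.comp_quasiMeasurePreserving Measure.quasiMeasurePreserving_snd).pow_const
            2).mul ((hv.comp_quasiMeasurePreserving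
              (quasiMeasurePreserving_sub_of_right_invariant volume volume)).pow_const 2)

/-- The Fourier transform of a product is a convolution. -/
theorem hasHat_mul {f g u : Lp ℂ 2 (volume : Measure (Sp n))} {h : Sp n → ℂ} (hh : Integrable h)
    (hf : f =ᵐ[volume] 𝓕⁻ h) {k : Sp n → ℂ} (hk : MemLp k 2 volume)
    (hg : HasHat (Lp.toTemperedDistribution g) k) (hu : u =ᵐ[volume] fun x => f x * g x) :
    HasHat (Lp.toTemperedDistribution u) (fun z => ∫ ξ, h ξ * k (z - ξ)) := by
  intro φ
  set ψ : 𝓢(Sp n, ℂ) := 𝓕 φ with hψ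
  have hψg : Integrable (fun x => ψ x * g x) :=
    (SchwartzMap.memLp ψ 2 volume).integrable_mul (Lp.memLp g)
  -- Modulating ψ = 𝓕φ by the character of ξ corresponds to replacing φ by φ(· + ξ), to which the
  -- hypothesis on g is applied.
  have hinner : ∀ ξ : Sp n, ∫ x, Complex.exp (↑(2 * Real.pi * inner ℝ ξ x) * Complex.I) *
      (ψ x * g x) = ∫ z, φ z * k (z - ξ) := by
    intro ξ
    have h1 : ∀ x, (𝓕 (φ.compSubConstCLM ℂ (-ξ)) : 𝓢(Sp n, ℂ)) x =
        Complex.exp (↑(2 * Real.pi * inner ℝ ξ x) * Complex.I) * ψ x := by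
      intro x
      rw [hψ, SchwartzMap.fourier_coe, SchwartzMap.fourier_coe, Real.fourier_eq', Real.fourier_eq',
        ← integral_const_mul, ← integral_sub_right_eq_self _ ξ]
      refine integral_congr_ae (ae_of_all _ fun y => ?_)
      simp only [SchwartzMap.compSubConstCLM_apply, sub_neg_eq_add, sub_add_cancel, smul_eq_mul]
      rw [← mul_assoc, ← Complex.exp_add, inner_sub_left]
      congr 2
      push_cast
      ring
    have h2 := hg (φ.compSubConstCLM ℂ (-ξ))
    rw [TemperedDistribution.fourier_apply, Lp.toTemperedDistribution_apply] at h2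
    simp only [SchwartzMap.compSubConstCLM_apply, sub_neg_eq_add, smul_eq_mul, h1] at h2
    have h3 := integral_sub_right_eq_self (fun η => φ (η + ξ) * k η) ξ (μ := volume)
    simp only [sub_add_cancel] at h3
    rw [h3, ← h2]
    refine integral_congr_ae (ae_of_all _ fun y => ?_)
    simp only
    ring
  have hexp : Continuous fun p : Sp n × Sp n =>
      Complex.exp (↑(2 * Real.pi * inner ℝ p.2 p.1) * Complex.I) := by fun_prop
  have hexpn : ∀ t : ℝ, ‖Complex.exp (↑t * Complex.I)‖ = 1 := Complex.norm_exp_ofReal_mul_I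
  calc 𝓕 (Lp.toTemperedDistribution u) φ = ∫ x, ψ x * u x := by
        rw [TemperedDistribution.fourier_apply, Lp.toTemperedDistribution_apply]
        rfl
    _ = ∫ x, ∫ ξ, Complex.exp (↑(2 * Real.pi * inner ℝ ξ x) * Complex.I) * (ψ x * g x) * h ξ := by
        refine integral_congr_ae ?_
        filter_upwards [hu, hf] with x h1 h2
        rw [h1, h2, Real.fourierInv_eq']
        calc _ = (ψ x * g x) * ∫ ξ, Complex.exp (↑(2 * Real.pi * inner ℝ ξ x) * Complex.I) • h ξ := by
              ring
          _ = _ := by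
              rw [← integral_const_mul]
              refine integral_congr_ae (ae_of_all _ fun y => ?_)
              simp only [smul_eq_mul]
              ring
    _ = ∫ ξ, ∫ x, Complex.exp (↑(2 * Real.pi * inner ℝ ξ x) * Complex.I) * (ψ x * g x) * h ξ := by
        refine integral_integral_swap ?_
        have h1 : Integrable (fun p : Sp n × Sp n => (ψ p.1 * g p.1) * h p.2)
            (volume.prod volume) := hψg.mul_prod hh
        refine (h1.bdd_mul (c := 1) hexp.aestronglyMeasurable
          (ae_of_all _ fun p => (hexpn _).le)).congr (ae_of_all _ fun p => ?_)
        simp only [Function.uncurry]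
        ring
    _ = ∫ ξ, ∫ z, φ z * (h ξ * k (z - ξ)) := by
        congr 1
        funext ξ
        rw [integral_mul_const, hinner, ← integral_mul_const]
        refine integral_congr_ae (ae_of_all _ fun y => ?_)
        simp only
        ring
    _ = ∫ z, ∫ ξ, φ z * (h ξ * k (z - ξ)) := by
        refine integral_integral_swap ?_
        have hm : AEStronglyMeasurable (fun p : Sp n × Sp n => φ p.2 * (h p.1 * k (p.2 - p.1)))
            (volume.prod volume) := by
          refine (φ.continuous.comp continuous_snd).aestronglyMeasurable.mul
            (hh.1.comp_fst.mul ?_)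
          exact hk.1.comp_quasiMeasurePreserving
            ((quasiMeasurePreserving_sub_of_right_invariant volume volume).comp
              Measure.measurePreserving_swap.quasiMeasurePreserving)
        have hφ2 : MemLp φ 2 (volume : Measure (Sp n)) := SchwartzMap.memLp φ 2 volume
        have hkξ : ∀ ξ : Sp n, MemLp (fun z => k (z - ξ)) 2 volume := fun ξ =>
          hk.comp_measurePreserving (measurePreserving_sub_right volume ξ)
        have hI : ∀ ξ : Sp n, Integrable (fun z => φ z * k (z - ξ)) := fun ξ =>
          hφ2.integrable_mul (hkξ ξ)
        refine (integrable_prod_iff hm).2 ⟨ae_of_all _ fun ξ => ?_, ?_⟩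
        · refine ((hI ξ).const_mul (h ξ)).congr (ae_of_all _ fun z => ?_)
          simp only
          ring
        -- For fixed ξ, the elementary bound |φ k| ≤ |φ|² + |k|² and translation invariance estimate
        -- the inner integral uniformly in ξ; integrability of h does the rest.
        · refine (hh.norm.const_mul ((∫ z, ‖φ z‖ ^ 2) + ∫ z, ‖k z‖ ^ 2)).mono'
            hm.norm.integral_prod_right' (ae_of_all _ fun ξ => ?_)
          rw [Real.norm_of_nonneg (by positivity)]
          have h1 : ∀ z, ‖φ z * (h ξ * k (z - ξ))‖ = ‖h ξ‖ * ‖φ z * k (z - ξ)‖ := by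
            intro z
            simp only [norm_mul]
            ring
          simp only [h1]
          rw [integral_const_mul, mul_comm]
          gcongr
          rw [← integral_sub_right_eq_self (fun z => ‖k z‖ ^ 2) ξ,
            ← integral_add hφ2.norm.integrable_sq (hkξ ξ).norm.integrable_sq]
          refine integral_mono (hI ξ).norm
            (hφ2.norm.integrable_sq.add (hkξ ξ).norm.integrable_sq) fun z => ?_
          simp only [norm_mul]
          nlinarith [sq_nonneg (‖φ z‖ - ‖k (z - ξ)‖), norm_nonneg (φ z),
            norm_nonneg (k (z - ξ)), mul_nonneg (norm_nonneg (φ z)) (norm_nonneg (k (z - ξ)))]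
    _ = _ := by
        refine integral_congr_ae (ae_of_all _ fun z => ?_)
        simp only [integral_const_mul]

namespace Sobolev

variable [hm : Fact (0 < m)]

/-- The weighted convolution is an integral of two L² functions against the kernel k = ⟨z⟩^b
⟨ξ⟩^(-a) ⟨z-ξ⟩^(-b), up to constants. The square of k has a ξ-integral bounded in z, because a >
n/2. -/
theorem exists_mul_hat_le (n : ℕ) (m : ℝ) {a b : ℝ} [hm : Fact (0 < m)] (ha : (n : ℝ) / 2 < a)
    (hb : 0 ≤ b) (hab : b ≤ a) : ∃ K : ℝ, 0 < K ∧ ∀ (f : Sobolev n m a) (g : Sobolev n m b),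
      eLpNorm (fun z => (weight n m b z : ℂ) * ∫ ξ, f.hat ξ * g.hat (z - ξ)) 2 volume ≤
        ENNReal.ofReal (K * ‖f‖ * ‖g‖) := by
  set k : Sp n → Sp n → ℝ := fun z ξ => (weightConst n)⁻¹ ^ 2 *
    (weight n m b z * (weight n m (-a) ξ * weight n m (-b) (z - ξ))) with hkdef
  have hc := weightConst_pos n
  have hw : ∀ σ (η : Sp n), 0 < weight n m σ η := weight_pos n hm.out
  have hk0 : ∀ z ξ, 0 ≤ k z ξ := fun z ξ => by
    have h1 := hw b z
    have h2 := hw (-a) ξ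
    have h3 := hw (-b) (z - ξ)
    positivity
  have hkm : ∀ z, AEMeasurable (fun ξ => ENNReal.ofReal (k z ξ)) volume := by
    intro z
    refine Measurable.aemeasurable (Measurable.ennreal_ofReal ?_)
    refine Continuous.measurable ?_
    have h1 := continuous_weight n hm.out (-a)
    have h2 := continuous_weight n hm.out (-b)
    fun_prop
  set K₀ : ℝ := (weightConst n)⁻¹ ^ 4 * (weightConst n ^ 2 * (4 ^ b * 2)) *
    (2 * ∫ η : Sp n, weight n m (-a) η ^ 2) with hK₀
  have hi := integrable_weight_neg_sq (n := n) hm.out ha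
  have hK : ∀ z, ∫⁻ ξ, ENNReal.ofReal (k z ξ) ^ 2 ≤ ENNReal.ofReal K₀ := by
    intro z
    have h1 : Integrable (fun ξ : Sp n => weight n m (-a) (z - ξ) ^ 2) := hi.comp_sub_left z
    have h2 : ∫ ξ : Sp n, weight n m (-a) (z - ξ) ^ 2 = ∫ η : Sp n, weight n m (-a) η ^ 2 :=
      integral_sub_left_eq_self (fun η : Sp n => weight n m (-a) η ^ 2) volume z
    calc ∫⁻ ξ, ENNReal.ofReal (k z ξ) ^ 2 ≤ ∫⁻ ξ, ENNReal.ofReal ((weightConst n)⁻¹ ^ 4 *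
          (weightConst n ^ 2 * (4 ^ b * 2)) *
            (weight n m (-a) ξ ^ 2 + weight n m (-a) (z - ξ) ^ 2)) := by
          refine lintegral_mono fun ξ => ?_
          rw [← ENNReal.ofReal_pow (hk0 z ξ)]
          refine ENNReal.ofReal_le_ofReal ?_
          rw [hkdef, mul_pow, ← pow_mul, mul_assoc]
          exact mul_le_mul_of_nonneg_left (weight_kernel_le hm.out hb hab ξ z) (by positivity)
      _ = ENNReal.ofReal (∫ ξ, (weightConst n)⁻¹ ^ 4 * (weightConst n ^ 2 * (4 ^ b * 2)) *
            (weight n m (-a) ξ ^ 2 + weight n m (-a) (z - ξ) ^ 2)) := by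
          refine (ofReal_integral_eq_lintegral_ofReal ((hi.add h1).const_mul _)
            (ae_of_all _ fun ξ => ?_)).symm
          have := hw (-a) ξ
          have := hw (-a) (z - ξ)
          change (0 : ℝ) ≤ (weightConst n)⁻¹ ^ 4 * (weightConst n ^ 2 * (4 ^ b * 2)) *
            (weight n m (-a) ξ ^ 2 + weight n m (-a) (z - ξ) ^ 2)
          positivity
      _ = ENNReal.ofReal K₀ := by
          rw [integral_const_mul, integral_add hi h1, h2, ← two_mul]
  have hK₀0 : 0 ≤ K₀ := by
    have : 0 ≤ ∫ η : Sp n, weight n m (-a) η ^ 2 := integral_nonneg fun η => by positivity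
    positivity
  clear_value K₀
  -- K₀ bounds the squared norms. The constant √K₀ + 1 is positive and its square is at least K₀.
  refine ⟨Real.sqrt K₀ + 1, by positivity, fun f g => ?_⟩
  set u : Sp n → ℝ≥0∞ := fun ξ => ‖(weight n m a ξ : ℂ) * f.hat ξ‖ₑ with hu
  set v : Sp n → ℝ≥0∞ := fun ξ => ‖(weight n m b ξ : ℂ) * g.hat ξ‖ₑ with hv
  have h1 := lintegral_kernel_sq_le (u := u) (v := v) f.memLp_hat.1.enorm g.memLp_hat.1.enorm hkm hK
  rw [← eLpNorm_two_sq, ← eLpNorm_two_sq, ← enorm_eq, ← enorm_eq] at h1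
  have h2 : eLpNorm (fun z => (weight n m b z : ℂ) * ∫ ξ, f.hat ξ * g.hat (z - ξ)) 2 volume ^ 2 ≤
      ∫⁻ z, (∫⁻ ξ, (u ξ * v (z - ξ)) * ENNReal.ofReal (k z ξ)) ^ 2 := by
    rw [eLpNorm_two_sq]
    refine lintegral_mono fun z => ?_
    refine pow_le_pow_left' ?_ 2
    rw [← integral_const_mul]
    refine (enorm_integral_le_lintegral_enorm _).trans (le_of_eq ?_)
    congr 1
    funext ξ
    rw [hu, hv]
    simp only
    rw [← enorm_mul, ← Real.enorm_of_nonneg (hk0 z ξ), ← enorm_norm, ← enorm_norm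
      (weight n m a ξ * f.hat ξ * _), ← enorm_mul]
    congr 1
    simp only [norm_mul, Complex.norm_real, Real.norm_of_nonneg (hw _ _).le]
    have e1 := weight_mul_weight_neg n hm.out a ξ
    have e2 := weight_mul_weight_neg n hm.out b (z - ξ)
    rw [← weightConst] at e1 e2
    rw [hkdef]
    simp only
    have e3 : (weightConst n)⁻¹ ^ 2 * ((weight n m a ξ * weight n m (-a) ξ) *
        (weight n m b (z - ξ) * weight n m (-b) (z - ξ))) = 1 := by
      rw [e1, e2]
      field_simp
    linear_combination (-(weight n m b z * (‖f.hat ξ‖ * ‖g.hat (z - ξ)‖))) * e3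
  have h3 : eLpNorm (fun z => (weight n m b z : ℂ) * ∫ ξ, f.hat ξ * g.hat (z - ξ)) 2 volume ^ 2 ≤
      ENNReal.ofReal ((Real.sqrt K₀ + 1) * ‖f‖ * ‖g‖) ^ 2 := by
    refine (h2.trans h1).trans ?_
    rw [← ENNReal.ofReal_pow (norm_nonneg _), ← ENNReal.ofReal_pow (norm_nonneg _),
      ← ENNReal.ofReal_mul (by positivity), ← ENNReal.ofReal_mul hK₀0,
      ← ENNReal.ofReal_pow (by positivity)]
    refine ENNReal.ofReal_le_ofReal ?_
    rw [mul_assoc, mul_pow, mul_pow]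
    gcongr
    nlinarith [Real.sq_sqrt hK₀0, Real.sqrt_nonneg K₀]
  exact (ENNReal.pow_le_pow_left_iff two_ne_zero).1 h3

/-- Multiplication `H^a × H^b → H^b` for `a > n/2` and `0 ≤ b ≤ a`. -/
theorem exists_mul (n : ℕ) (m : ℝ) {a b : ℝ} [hm : Fact (0 < m)] (ha : (n : ℝ) / 2 < a)
    (ha' : 0 ≤ a) (hb : 0 ≤ b) (hab : b ≤ a) :
    ∃ K : ℝ, 0 < K ∧ ∀ (f : Sobolev n m a) (g : Sobolev n m b), ∃ T : Sobolev n m b,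
      rep hb T = rep ha' f * rep hb g ∧ ‖T‖ ≤ K * ‖f‖ * ‖g‖ := by
  obtain ⟨K, hK, h⟩ := exists_mul_hat_le n m ha hb hab
  refine ⟨K, hK, fun f g => ?_⟩
  have hfi := f.integrable_hat ha
  have hfa := toL2_ae_eq_fourierInv ha ha' f
  -- The product is in L² because f is bounded by the L¹-norm of its transform. Its transform is
  -- then the convolution, which the weighted estimate places in H^b.
  have hmem : MemLp (fun x => toL2 ha' f x * toL2 hb g x) 2 volume := by
    refine (Lp.memLp (toL2 hb g)).of_le_mul (c := ∫ η, ‖f.hat η‖)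
      ((Lp.aestronglyMeasurable _).mul (Lp.aestronglyMeasurable _)) ?_
    filter_upwards [hfa] with x hx
    rw [norm_mul, hx]
    exact mul_le_mul_of_nonneg_right (norm_fourierInv_le x) (norm_nonneg _)
  have hghat : HasHat (Lp.toTemperedDistribution (toL2 hb g)) g.hat := by
    rw [← toDist_eq_toL2]
    exact g.hasHat
  have hhat := hasHat_mul hfi hfa (g.memLp_hat_two hb) hghat hmem.coeFn_toLp
  have hreal : IsRealDist (Lp.toTemperedDistribution (hmem.toLp _)) := by
    apply isRealDist_toTemperedDistribution
    filter_upwards [hmem.coeFn_toLp, toL2_im ha' f, toL2_im hb g] with x h1 h2 h3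
    rw [h1, Complex.mul_im, h2, h3]
    simp
  have hmeas : AEStronglyMeasurable (fun z => ∫ ξ, f.hat ξ * g.hat (z - ξ)) volume := by
    have : AEStronglyMeasurable (fun p : Sp n × Sp n => f.hat p.2 * g.hat (p.1 - p.2))
        (volume.prod volume) :=
      f.aestronglyMeasurable_hat.comp_snd.mul
        (g.aestronglyMeasurable_hat.comp_quasiMeasurePreserving
          (quasiMeasurePreserving_sub_of_right_invariant volume volume))
    exact this.integral_prod_right'
  have hLp : MemLp (fun z => (weight n m b z : ℂ) * ∫ ξ, f.hat ξ * g.hat (z - ξ)) 2 volume :=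
    ⟨(Complex.continuous_ofReal.comp (continuous_weight n hm.out b)).aestronglyMeasurable.mul hmeas,
      (h f g).trans_lt ENNReal.ofReal_lt_top⟩
  obtain ⟨T, hT, hT'⟩ := exists_of_dist hhat hLp hreal
  refine ⟨T, ?_, ?_⟩
  · have e : toL2 hb T = hmem.toLp _ := toTemperedDistribution_injective <| by
      rw [← toDist_eq_toL2, hT]
    apply AEEqFun.ext
    filter_upwards [coeFn_rep hb T, AEEqFun.coeFn_mul (rep ha' f) (rep hb g), coeFn_rep ha' f,
      coeFn_rep hb g, hmem.coeFn_toLp, toL2_im ha' f] with x h1 h2 h3 h4 h5 h6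
    rw [h1, h2, Pi.mul_apply, h3, h4, e, h5, Complex.mul_re, h6]
    ring
  · have e : eLpNorm (fun z => (weight n m b z : ℂ) * T.hat z) 2 volume =
        eLpNorm (fun z => (weight n m b z : ℂ) * ∫ ξ, f.hat ξ * g.hat (z - ξ)) 2 volume := by
      refine eLpNorm_congr_ae ?_
      filter_upwards [hT'] with z hz
      rw [hz]
    rw [norm_eq, e]
    exact ENNReal.toReal_le_of_le_ofReal (by positivity) (h f g)

end Sobolev

end Product

end

/-! ### Coefficients of polynomials, and multilinear maps built from products. -/

section

section Coefficients

variable {S : Type*} [Fintype S] {k : ℕ}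

/-- Equal monomials mean equal multiplicities, so the fibres of α and β over each index are in
bijection; gluing these bijections gives σ. -/
theorem exists_perm_of_sum_single_eq {α β : Fin k → S}
    (h : ∑ j, Finsupp.single (α j) 1 = ∑ j, Finsupp.single (β j) (1 : ℕ)) :
    ∃ σ : Equiv.Perm (Fin k), α = fun j => β (σ j) := by
  classical
  have hc : ∀ x, Fintype.card {j // α j = x} = Fintype.card {j // β j = x} := by
    intro x
    have := DFunLike.congr_fun h x
    simp only [Finsupp.coe_finsetSum, Finset.sum_apply, Finsupp.single_apply,
      Finset.sum_boole] at this
    simpa [Fintype.card_subtype] using this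
  let e : ∀ x, {j // α j = x} ≃ {j // β j = x} := fun x => Fintype.equivOfCardEq (hc x)
  refine ⟨((Equiv.sigmaFiberEquiv α).symm.trans (Equiv.sigmaCongrRight e)).trans
    (Equiv.sigmaFiberEquiv β), ?_⟩
  funext j
  exact (e (α j) ⟨j, rfl⟩).2.symm

/-- The symmetric coefficients of a polynomial function are determined by its values. -/
theorem symmetric_coeff_eq_zero {D : (Fin k → S) → ℝ}
    (hD : ∀ (σ : Equiv.Perm (Fin k)) (α : Fin k → S), (D fun j => α (σ j)) = D α)
    (h : ∀ z : S → ℝ, ∑ α, D α * ∏ j, z (α j) = 0) (β : Fin k → S) : D β = 0 := by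
  classical
  set P : MvPolynomial S ℝ := ∑ α : Fin k → S, MvPolynomial.monomial
    (∑ j, Finsupp.single (α j) 1) (D α) with hP
  have hm : ∀ α : Fin k → S, MvPolynomial.monomial (∑ j, Finsupp.single (α j) 1) (D α) =
      MvPolynomial.C (D α) * ∏ j, MvPolynomial.X (α j) := by
    intro α
    exact MvPolynomial.monomial_sum_index _ _ _
  have h0 : P = 0 := by
    refine MvPolynomial.funext fun z => ?_
    rw [hP, map_sum, map_zero, ← h z]
    refine Finset.sum_congr rfl fun α _ => ?_
    simp [hm]
  have h1 : MvPolynomial.coeff (∑ j, Finsupp.single (β j) 1) P = 0 := by rw [h0]; simp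
  rw [hP, MvPolynomial.coeff_sum] at h1
  simp only [MvPolynomial.coeff_monomial] at h1
  -- By symmetry all words with the monomial of β carry the same coefficient D β. The coefficient of
  -- the polynomial is D β times the number of such words, which is positive.
  have h2 : ∀ α : Fin k → S, (if ∑ j, Finsupp.single (α j) 1 = ∑ j, Finsupp.single (β j) 1 then D α
      else 0) = (if ∑ j, Finsupp.single (α j) 1 = ∑ j, Finsupp.single (β j) 1 then 1 else 0) *
        D β := by
    intro α
    split_ifs with hα
    · obtain ⟨σ, rfl⟩ := exists_perm_of_sum_single_eq hα
      rw [hD, one_mul]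
    · rw [zero_mul]
  simp only [h2] at h1
  rw [← Finset.sum_mul, mul_eq_zero] at h1
  refine h1.resolve_left (ne_of_gt ?_)
  refine Finset.sum_pos' (fun α _ => by split_ifs <;> norm_num) ⟨β, Finset.mem_univ _, ?_⟩
  simp

open Classical in
/-- The number of indices in `B`. -/
def countIn (B : Set S) (α : Fin k → S) : ℕ := (Finset.univ.filter fun j => α j ∈ B).card

open Classical in
/-- Multiplication of the coordinates in `B` by `c`. -/
def scaleOn (B : Set S) (c : ℝ) (z : S → ℝ) (x : S) : ℝ := if x ∈ B then c * z x else z x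

theorem prod_scaleOn (B : Set S) (c : ℝ) (z : S → ℝ) (α : Fin k → S) :
    ∏ j, scaleOn B c z (α j) = c ^ countIn B α * ∏ j, z (α j) := by
  classical
  have : ∀ j, scaleOn B c z (α j) = (if α j ∈ B then c else 1) * z (α j) := by
    intro j
    unfold scaleOn
    split_ifs <;> simp
  simp only [this]
  rw [Finset.prod_mul_distrib]
  congr 1
  rw [Finset.prod_ite]
  simp [countIn]

theorem countIn_perm (B : Set S) (α : Fin k → S) (σ : Equiv.Perm (Fin k)) :
    countIn B (fun j => α (σ j)) = countIn B α := by
  classical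
  unfold countIn
  refine Finset.card_bij (fun j _ => σ j) (by simp) (by simp) fun j hj => ⟨σ.symm j, ?_, by simp⟩
  simpa using hj

/-- Scaling the coordinates in B by 0 multiplies a term by 0^count, so the coefficients D α (1 -
0^count) define the zero polynomial. -/
theorem countIn_eq_zero_of_indep {D : (Fin k → S) → ℝ}
    (hD : ∀ (σ : Equiv.Perm (Fin k)) (α : Fin k → S), (D fun j => α (σ j)) = D α) (B : Set S)
    (h : ∀ z : S → ℝ, ∑ α, D α * ∏ j, z (α j) = ∑ α, D α * ∏ j, scaleOn B 0 z (α j))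
    {α : Fin k → S} (hα : D α ≠ 0) : countIn B α = 0 := by
  have h1 := symmetric_coeff_eq_zero (D := fun α => D α * (1 - 0 ^ countIn B α))
    (fun σ α => by simp only [hD, countIn_perm]) (fun z => by
      have := h z
      simp only [prod_scaleOn] at this
      rw [← sub_eq_zero, ← Finset.sum_sub_distrib] at this
      refine Eq.trans ?_ this
      refine Finset.sum_congr rfl fun α _ => ?_
      ring) α
  by_contra hne
  rw [zero_pow hne, sub_zero, mul_one] at h1
  exact hα h1

/-- The second difference at the scales 2, 1, 0 multiplies a term by 2^c - 2 + 0^c with c the count.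
This vanishes for c = 0 and c = 1 and is at least 2 for c ≥ 2. -/
theorem countIn_le_one_of_affine {D : (Fin k → S) → ℝ}
    (hD : ∀ (σ : Equiv.Perm (Fin k)) (α : Fin k → S), (D fun j => α (σ j)) = D α) (B : Set S)
    (h : ∀ z : S → ℝ, (∑ α, D α * ∏ j, scaleOn B 2 z (α j)) - 2 * (∑ α, D α * ∏ j, z (α j)) +
      ∑ α, D α * ∏ j, scaleOn B 0 z (α j) = 0)
    {α : Fin k → S} (hα : D α ≠ 0) : countIn B α ≤ 1 := by
  have h1 := symmetric_coeff_eq_zero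
    (D := fun α => D α * (2 ^ countIn B α - 2 + 0 ^ countIn B α))
    (fun σ α => by simp only [hD, countIn_perm]) (fun z => by
      refine Eq.trans ?_ (h z)
      simp only [prod_scaleOn]
      rw [Finset.mul_sum, ← Finset.sum_sub_distrib, ← Finset.sum_add_distrib]
      refine Finset.sum_congr rfl fun α _ => ?_
      ring) α
  by_contra! hne
  rw [zero_pow (by omega), mul_eq_zero] at h1
  have h2 : (2 : ℝ) ^ 2 ≤ 2 ^ countIn B α := pow_le_pow_right₀ (by norm_num) hne
  rcases h1 with h1 | h1
  · exact hα h1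
  · linarith

/-- If no index is in B, any position may serve as the exceptional one; k ≠ 0 ensures that there is
a position. -/
theorem exists_forall_notMem_of_countIn_le_one {B : Set S} {α : Fin k → S} (hk : k ≠ 0)
    (h : countIn B α ≤ 1) : ∃ j₀, ∀ j, j ≠ j₀ → α j ∉ B := by
  classical
  unfold countIn at h
  rw [Finset.card_le_one] at h
  by_cases hex : ∃ j₀, α j₀ ∈ B
  · obtain ⟨j₀, hj₀⟩ := hex
    exact ⟨j₀, fun j hj hjB => hj (h j (by simpa using hjB) j₀ (by simpa using hj₀))⟩
  · push Not at hex
    exact ⟨⟨0, Nat.pos_of_ne_zero hk⟩, fun j _ => hex j⟩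

/-- A pointwise bound of a polynomial with at most one factor in `B`. -/
theorem abs_sum_coeff_le {D : (Fin k → S) → ℝ} {B : Set S} {ν M W : ℝ} (hk : k ≠ 0)
    (hν : ∀ α, |D α| ≤ ν) (hD : ∀ α, D α ≠ 0 → countIn B α ≤ 1) (hM : 0 < M) (hMW : M ≤ W)
    {z : S → ℝ} (hz : ∀ x ∉ B, |z x| ≤ M) (hz' : ∀ x, |z x| ≤ W) :
    |∑ α, D α * ∏ j, z (α j)| ≤ W / M * (ν * (Fintype.card S * M) ^ k) := by
  classical
  have hterm : ∀ α : Fin k → S, |D α * ∏ j, z (α j)| ≤ W / M * (ν * M ^ k) := by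
    intro α
    have hν0 : 0 ≤ ν := (abs_nonneg _).trans (hν α)
    by_cases h0 : D α = 0
    · rw [h0, zero_mul, abs_zero]
      have : 0 < W := hM.trans_le hMW
      positivity
    · obtain ⟨j₀, hj₀⟩ := exists_forall_notMem_of_countIn_le_one hk (hD α h0)
      rw [abs_mul, Finset.abs_prod, ← Finset.mul_prod_erase _ _ (Finset.mem_univ j₀)]
      have h1 : ∏ j ∈ Finset.univ.erase j₀, |z (α j)| ≤ M ^ (k - 1) := by
        calc _ ≤ ∏ j ∈ Finset.univ.erase j₀, M := by
              refine Finset.prod_le_prod (fun j _ => abs_nonneg _) fun j hj => ?_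
              exact hz _ (hj₀ j (Finset.ne_of_mem_erase hj))
          _ = _ := by simp
      have h2 : M ^ k = M * M ^ (k - 1) := by
        rw [← pow_succ', Nat.sub_add_cancel (Nat.pos_of_ne_zero hk)]
      have h3 : W / M * (ν * M ^ k) = ν * (W * M ^ (k - 1)) := by
        rw [h2]; field_simp
      rw [h3]
      exact mul_le_mul (hν α) (mul_le_mul (hz' _) h1 (Finset.prod_nonneg fun _ _ => abs_nonneg _)
        (hM.le.trans hMW)) (mul_nonneg (abs_nonneg _)
          (Finset.prod_nonneg fun _ _ => abs_nonneg _)) hν0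
  calc |∑ α, D α * ∏ j, z (α j)| ≤ ∑ α, |D α * ∏ j, z (α j)| := Finset.abs_sum_le_sum_abs _ _
    _ ≤ ∑ _α : Fin k → S, W / M * (ν * M ^ k) := Finset.sum_le_sum fun α _ => hterm α
    _ = _ := by
      rw [Finset.sum_const, Finset.card_univ, Fintype.card_fun, Fintype.card_fin, nsmul_eq_mul,
        mul_pow]
      push_cast
      ring

end Coefficients

section AEEqFun

variable {Ω : Type*} [MeasurableSpace Ω] {μ : Measure Ω}

theorem aeEqFun_add_mul (u v w : Ω →ₘ[μ] ℝ) : (u + v) * w = u * w + v * w := by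
  apply AEEqFun.ext
  filter_upwards [AEEqFun.coeFn_mul (u + v) w, AEEqFun.coeFn_add u v,
    AEEqFun.coeFn_add (u * w) (v * w), AEEqFun.coeFn_mul u w, AEEqFun.coeFn_mul v w]
    with x h1 h2 h3 h4 h5
  simp [h1, h2, h3, h4, h5, add_mul]

theorem aeEqFun_smul_mul (c : ℝ) (u w : Ω →ₘ[μ] ℝ) : (c • u) * w = c • (u * w) := by
  apply AEEqFun.ext
  filter_upwards [AEEqFun.coeFn_mul (c • u) w, AEEqFun.coeFn_smul c u,
    AEEqFun.coeFn_smul c (u * w), AEEqFun.coeFn_mul u w] with x h1 h2 h3 h4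
  simp [h1, h2, h3, h4, mul_assoc]

theorem coeFn_finset_prod {ι : Type*} (t : Finset ι) (u : ι → Ω →ₘ[μ] ℝ) :
    (∏ i ∈ t, u i : Ω →ₘ[μ] ℝ) =ᵐ[μ] fun x => ∏ i ∈ t, u i x := by
  classical
  induction t using Finset.induction_on with
  | empty => exact AEEqFun.coeFn_one
  | insert i t hi ih =>
    rw [Finset.prod_insert hi]
    filter_upwards [AEEqFun.coeFn_mul (u i) (∏ i ∈ t, u i), ih] with x h1 h2
    rw [h1, Finset.prod_insert hi, Pi.mul_apply, h2]

theorem coeFn_finset_sum {ι : Type*} (t : Finset ι) (u : ι → Ω →ₘ[μ] ℝ) :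
    (∑ i ∈ t, u i : Ω →ₘ[μ] ℝ) =ᵐ[μ] fun x => ∑ i ∈ t, u i x := by
  classical
  induction t using Finset.induction_on with
  | empty => exact AEEqFun.coeFn_zero
  | insert i t hi ih =>
    rw [Finset.sum_insert hi]
    filter_upwards [AEEqFun.coeFn_add (u i) (∑ i ∈ t, u i), ih] with x h1 h2
    rw [h1, Finset.sum_insert hi, Pi.add_apply, h2]

/-- The product of functions that depend linearly on the arguments. -/
def prodMultilinear {ι X : Type*} [Fintype ι] [AddCommGroup X] [Module ℝ X]
    (R : ι → X →ₗ[ℝ] (Ω →ₘ[μ] ℝ)) : MultilinearMap ℝ (fun _ : ι => X) (Ω →ₘ[μ] ℝ) where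
  toFun x := ∏ j, R j (x j)
  map_update_add' := by
    intro inst x i y y'
    have h : ∀ y, ∏ j, R j (Function.update x i y j) =
        R i y * ∏ j ∈ Finset.univ.erase i, R j (x j) := by
      intro y
      rw [← Finset.mul_prod_erase _ _ (Finset.mem_univ i), Function.update_self]
      congr 1
      refine Finset.prod_congr rfl fun j hj => ?_
      rw [Function.update_of_ne (Finset.ne_of_mem_erase hj)]
    rw [h, h, h, map_add, aeEqFun_add_mul]
  map_update_smul' := by
    intro inst x i c y
    have h : ∀ y, ∏ j, R j (Function.update x i y j) =
        R i y * ∏ j ∈ Finset.univ.erase i, R j (x j) := by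
      intro y
      rw [← Finset.mul_prod_erase _ _ (Finset.mem_univ i), Function.update_self]
      congr 1
      refine Finset.prod_congr rfl fun j hj => ?_
      rw [Function.update_of_ne (Finset.ne_of_mem_erase hj)]
    rw [h, h, map_smul, aeEqFun_smul_mul]

end AEEqFun

section Multilinear

open Sobolev

variable {n : ℕ} {m a b : ℝ} [hm : Fact (0 < m)] {S : Type*} [Fintype S] {X : Type*}
  [NormedAddCommGroup X] [NormedSpace ℝ X]

/-- The single function g of H^b absorbs the factors of H^a one after the other; each multiplication
costs a factor K C. -/
theorem exists_rep_prod {ha : 0 ≤ a} {hb : 0 ≤ b} {K C : ℝ} (hK : 0 < K) (hC : 0 ≤ C)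
    (hmul : ∀ (f : Sobolev n m a) (g : Sobolev n m b), ∃ T : Sobolev n m b,
      rep hb T = rep ha f * rep hb g ∧ ‖T‖ ≤ K * ‖f‖ * ‖g‖)
    {ι : Type*} (t : Finset ι) (u : ι → (Sp n →ₘ[volume] ℝ)) (x : ι → X)
    (hu : ∀ j ∈ t, ∃ f : Sobolev n m a, rep ha f = u j ∧ ‖f‖ ≤ C * ‖x j‖) (g : Sobolev n m b) :
    ∃ T : Sobolev n m b, rep hb T = (∏ j ∈ t, u j) * rep hb g ∧
      ‖T‖ ≤ (K * C) ^ t.card * (∏ j ∈ t, ‖x j‖) * ‖g‖ := by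
  classical
  induction t using Finset.induction_on with
  | empty => exact ⟨g, by simp, by simp⟩
  | insert j t hj ih =>
    obtain ⟨T, hT, hTn⟩ := ih fun i hi => hu i (Finset.mem_insert_of_mem hi)
    obtain ⟨f, hf, hfn⟩ := hu j (Finset.mem_insert_self _ _)
    obtain ⟨T', hT', hTn'⟩ := hmul f T
    refine ⟨T', ?_, hTn'.trans ?_⟩
    · rw [hT', hT, hf, Finset.prod_insert hj, mul_assoc]
    · rw [Finset.card_insert_of_notMem hj, Finset.prod_insert hj]
      have : 0 ≤ ∏ i ∈ t, ‖x i‖ := Finset.prod_nonneg fun _ _ => norm_nonneg _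
      calc K * ‖f‖ * ‖T‖ ≤ K * (C * ‖x j‖) * ((K * C) ^ t.card * (∏ j ∈ t, ‖x j‖) * ‖g‖) := by
            gcongr
        _ = _ := by ring

/-- The multilinear map with values in `H^b` given by a polynomial in functions of `H^a` and at
most one function of `H^b`. -/
theorem exists_multilinear {ha : 0 ≤ a} {hb : 0 ≤ b} {K C : ℝ} (hK : 1 ≤ K) (hC : 0 ≤ C)
    (hmul : ∀ (f : Sobolev n m a) (g : Sobolev n m b), ∃ T : Sobolev n m b,
      rep hb T = rep ha f * rep hb g ∧ ‖T‖ ≤ K * ‖f‖ * ‖g‖)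
    (R : S → X →ₗ[ℝ] (Sp n →ₘ[volume] ℝ)) (B : Set S)
    (hR : ∀ α ∉ B, ∀ x, ∃ f : Sobolev n m a, rep ha f = R α x ∧ ‖f‖ ≤ C * ‖x‖)
    (hR' : ∀ α x, ∃ f : Sobolev n m b, rep hb f = R α x ∧ ‖f‖ ≤ C * ‖x‖)
    {k : ℕ} (hk : k ≠ 0) {D : (Fin k → S) → ℝ} {ν : ℝ} (hν : ∀ α, |D α| ≤ ν)
    (hD : ∀ α, D α ≠ 0 → countIn B α ≤ 1) :
    ∃ Φ : ContinuousMultilinearMap ℝ (fun _ : Fin k => X) (Sobolev n m b),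
      (ν ≥ 0 → ‖Φ‖ ≤ (Fintype.card S * (K * C)) ^ k * ν) ∧
      ∀ x, rep hb (Φ x) = ∑ α : Fin k → S, D α • ∏ j, R (α j) (x j) := by
  classical
  have hterm : ∀ (α : Fin k → S) (x : Fin k → X), ∃ T : Sobolev n m b,
      rep hb T = D α • ∏ j, R (α j) (x j) ∧ ‖T‖ ≤ (K * C) ^ k * ν * ∏ j, ‖x j‖ := by
    intro α x
    have hν0 : 0 ≤ ν := (abs_nonneg _).trans (hν α)
    have hx : 0 ≤ ∏ j, ‖x j‖ := Finset.prod_nonneg fun _ _ => norm_nonneg _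
    by_cases h0 : D α = 0
    · refine ⟨0, by rw [h0, zero_smul, map_zero], ?_⟩
      rw [norm_zero]
      positivity
    · obtain ⟨j₀, hj₀⟩ := exists_forall_notMem_of_countIn_le_one hk (hD α h0)
      obtain ⟨g, hg, hgn⟩ := hR' (α j₀) (x j₀)
      obtain ⟨T, hT, hTn⟩ := exists_rep_prod (by linarith) hC hmul (Finset.univ.erase j₀)
        (fun j => R (α j) (x j)) x
        (fun j hj => hR (α j) (hj₀ j (Finset.ne_of_mem_erase hj)) (x j)) g
      refine ⟨D α • T, ?_, ?_⟩
      · rw [map_smul, hT, hg, Finset.prod_erase_mul _ _ (Finset.mem_univ j₀)]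
      · rw [norm_smul, Real.norm_eq_abs]
        have e : (Finset.univ.erase j₀).card = k - 1 := by simp
        rw [e] at hTn
        have h2 : (K * C) ^ k = (K * C) * (K * C) ^ (k - 1) := by
          rw [← pow_succ', Nat.sub_add_cancel (Nat.pos_of_ne_zero hk)]
        have h3 : 0 ≤ ∏ j ∈ Finset.univ.erase j₀, ‖x j‖ :=
          Finset.prod_nonneg fun _ _ => norm_nonneg _
        calc |D α| * ‖T‖ ≤ ν * ((K * C) ^ (k - 1) * (∏ j ∈ Finset.univ.erase j₀, ‖x j‖) *
              (K * (C * ‖x j₀‖))) := by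
              refine mul_le_mul (hν α) (hTn.trans ?_) (norm_nonneg _) hν0
              gcongr
              refine hgn.trans ?_
              exact le_mul_of_one_le_left (by positivity) hK
          _ = (K * C) ^ k * ν * ((∏ j ∈ Finset.univ.erase j₀, ‖x j‖) * ‖x j₀‖) := by
              rw [h2]; ring
          _ = _ := by rw [Finset.prod_erase_mul _ _ (Finset.mem_univ j₀)]
  choose T hT hTn using hterm
  -- The elements T α x are chosen separately for each x. Multilinearity of their sum is read off
  -- from the pointwise product, since `rep` is linear and injective.
  let Ψ : MultilinearMap ℝ (fun _ : Fin k => X) (Sp n →ₘ[volume] ℝ) :=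
    ∑ α : Fin k → S, D α • prodMultilinear fun j => R (α j)
  have hΨ : ∀ x, Ψ x = ∑ α : Fin k → S, D α • ∏ j, R (α j) (x j) := by
    intro x
    simp [Ψ, prodMultilinear]
  have hTΨ : ∀ x, rep hb (∑ α, T α x) = Ψ x := by
    intro x
    rw [map_sum, hΨ]
    exact Finset.sum_congr rfl fun α _ => hT α x
  let Φ₀ : MultilinearMap ℝ (fun _ : Fin k => X) (Sobolev n m b) :=
    { toFun := fun x => ∑ α, T α x
      map_update_add' := by
        intro inst x i y y'
        apply rep_injective hb
        rw [map_add, hTΨ, hTΨ, hTΨ]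
        exact Ψ.map_update_add' x i y y'
      map_update_smul' := by
        intro inst x i c y
        apply rep_injective hb
        rw [map_smul, hTΨ, hTΨ]
        exact Ψ.map_update_smul' x i c y }
  have hb0 : ∀ x, ‖Φ₀ x‖ ≤ ((Fintype.card S * (K * C)) ^ k * ν) * ∏ j, ‖x j‖ := by
    intro x
    calc ‖∑ α, T α x‖ ≤ ∑ α, ‖T α x‖ := norm_sum_le _ _
      _ ≤ ∑ _α : Fin k → S, (K * C) ^ k * ν * ∏ j, ‖x j‖ := Finset.sum_le_sum fun α _ => hTn α x
      _ = _ := by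
        rw [Finset.sum_const, Finset.card_univ, Fintype.card_fun, Fintype.card_fin, nsmul_eq_mul,
          mul_pow]
        push_cast
        ring
  refine ⟨Φ₀.mkContinuous _ hb0, fun hν0 => Φ₀.mkContinuous_norm_le (by positivity) hb0, fun x => ?_⟩
  rw [← hΨ]
  exact hTΨ x

end Multilinear

end

/-! ### Series of products, and the coordinates of the jet space. -/

section

section Series

open Sobolev

variable {n : ℕ} {m a b : ℝ} [hm : Fact (0 < m)] {S : Type*} [Fintype S] {X : Type*}
  [NormedAddCommGroup X] [NormedSpace ℝ X]

/-- A formal series whose terms are polynomials in functions of `H^a` and at most one function of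
`H^b`. -/
theorem exists_series {ha : 0 ≤ a} {hb : 0 ≤ b} {K C : ℝ} (hK : 1 ≤ K) (hC : 0 ≤ C)
    (hmul : ∀ (f : Sobolev n m a) (g : Sobolev n m b), ∃ T : Sobolev n m b,
      rep hb T = rep ha f * rep hb g ∧ ‖T‖ ≤ K * ‖f‖ * ‖g‖)
    (R : S → X →ₗ[ℝ] (Sp n →ₘ[volume] ℝ)) (B : Set S)
    (hR : ∀ α ∉ B, ∀ x, ∃ f : Sobolev n m a, rep ha f = R α x ∧ ‖f‖ ≤ C * ‖x‖)
    (hR' : ∀ α x, ∃ f : Sobolev n m b, rep hb f = R α x ∧ ‖f‖ ≤ C * ‖x‖)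
    {D : (k : ℕ) → (Fin k → S) → ℝ} {ν : ℕ → ℝ} (hν0 : ∀ k, 0 ≤ ν k)
    (hν : ∀ k α, |D k α| ≤ ν k) (hD0 : D 0 = 0)
    (hsymm : ∀ (k : ℕ) (σ : Equiv.Perm (Fin k)) (α : Fin k → S), (D k fun j => α (σ j)) = D k α)
    (hD : ∀ k α, D k α ≠ 0 → countIn B α ≤ 1) :
    ∃ Φ : FormalMultilinearSeries ℝ X (Sobolev n m b), IsSymmetricSeries Φ ∧
      (∀ k, ‖Φ k‖ ≤ (Fintype.card S * (K * C)) ^ k * ν k) ∧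
      ∀ k x, rep hb (Φ k x) = ∑ α : Fin k → S, D k α • ∏ j, R (α j) (x j) := by
  have h : ∀ k, ∃ Φ : ContinuousMultilinearMap ℝ (fun _ : Fin k => X) (Sobolev n m b),
      (‖Φ‖ ≤ (Fintype.card S * (K * C)) ^ k * ν k) ∧
      ∀ x, rep hb (Φ x) = ∑ α : Fin k → S, D k α • ∏ j, R (α j) (x j) := by
    intro k
    by_cases hk : k = 0
    -- In degree 0 there is no factor to be placed in H^b; the term vanishes because N(0) = 0.
    · subst hk
      refine ⟨0, by simpa using hν0 0, fun x => ?_⟩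
      rw [hD0]
      simp
    · obtain ⟨Φ, h1, h2⟩ := exists_multilinear hK hC hmul R B hR hR' hk (hν k) (hD k)
      exact ⟨Φ, h1 (hν0 k), h2⟩
  choose Φ hΦ hΦ' using h
  refine ⟨Φ, fun k σ x => ?_, hΦ, hΦ'⟩
  apply rep_injective hb
  rw [hΦ', hΦ']
  -- Permuting the arguments is compensated by reindexing the words α, under which the coefficients
  -- are invariant.
  refine Fintype.sum_equiv (Equiv.arrowCongr σ (Equiv.refl S)) _ _ fun α => ?_
  have e : (Equiv.arrowCongr σ (Equiv.refl S)) α = fun j => α (σ.symm j) := rfl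
  rw [e, hsymm k σ.symm α]
  congr 1
  exact Fintype.prod_equiv σ _ _ fun j => by simp

/-- Almost everywhere convergence to the sum of a series in `H^b`. -/
theorem rep_sum_ae_eq {hb : 0 ≤ b} {f : ℕ → Sobolev n m b} {F : Sobolev n m b} (hF : HasSum f F)
    {g : ℕ → Sp n → ℝ} (hg : ∀ k, rep hb (f k) =ᵐ[volume] g k)
    (hs : ∀ᵐ y, Summable fun k => g k y) : ∀ᵐ y, HasSum (fun k => g k y) (rep hb F y) := by
  have h1 : Tendsto (fun K => toL2 hb (∑ k ∈ Finset.range K, f k)) atTop (𝓝 (toL2 hb F)) :=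
    ((toL2 hb).continuous.tendsto F).comp hF.tendsto_sum_nat
  -- Convergence in L² yields almost everywhere convergence only along a subsequence. Pointwise
  -- summability then identifies the limit with the full sum.
  have h2 := tendstoInMeasure_of_tendsto_Lp h1
  obtain ⟨ns, hns, h3⟩ := h2.exists_seq_tendsto_ae
  have h4 : ∀ᵐ y, ∀ K, toL2 hb (∑ k ∈ Finset.range K, f k) y =
      ((∑ k ∈ Finset.range K, g k y : ℝ) : ℂ) := by
    rw [ae_all_iff]
    intro K
    filter_upwards [toL2_ae_eq hb (∑ k ∈ Finset.range K, f k),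
      coeFn_finset_sum (Finset.range K) fun k => rep hb (f k), ae_all_iff.2 hg] with y h1 h2 h3
    rw [h1, map_sum, h2]
    simp only [h3]
  filter_upwards [h3, h4, hs, toL2_ae_eq hb F] with y h3 h4 h5 h6
  have h7 := (h5.hasSum.tendsto_sum_nat.comp hns.tendsto_atTop)
  have h8 := (Complex.continuous_ofReal.tendsto _).comp h7
  simp only [h4, h6] at h3
  have h9 := tendsto_nhds_unique h3 h8
  have h10 : rep hb F y = ∑' k, g k y := by exact_mod_cast h9
  rw [h10]
  exact h5.hasSum

/-- Used at a fixed point, where the coordinates in B are finite but not bounded uniformly in the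
point. They enter only through the factor W/M, which depends on the point but not on k, so
convergence is governed by M alone. -/
theorem summable_coeff {D : (k : ℕ) → (Fin k → S) → ℝ} {ν : ℕ → ℝ}
    (hν : ∀ k α, |D k α| ≤ ν k) (hD0 : D 0 = 0) {B : Set S}
    (hD : ∀ k α, D k α ≠ 0 → countIn B α ≤ 1) {M : ℝ} (hM : 0 < M) {z : S → ℝ}
    (hz : ∀ x ∉ B, |z x| ≤ M)
    (hs : Summable fun k => ν k * (Fintype.card S * M) ^ k) :
    Summable fun k => ∑ α : Fin k → S, D k α * ∏ j, z (α j) := by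
  set W := M + ∑ x, |z x| with hW
  have hMW : M ≤ W := by
    have : 0 ≤ ∑ x, |z x| := Finset.sum_nonneg fun _ _ => abs_nonneg _
    linarith
  have hz' : ∀ x, |z x| ≤ W := fun x => by
    have := Finset.single_le_sum (fun x _ => abs_nonneg (z x)) (Finset.mem_univ x)
    linarith
  refine Summable.of_norm_bounded (hs.mul_left (W / M)) fun k => ?_
  by_cases hk : k = 0
  · subst hk
    rw [hD0]
    have h1 : 0 ≤ ν 0 := (abs_nonneg _).trans (hν 0 finZeroElim)
    simp only [Pi.zero_apply, zero_mul, Finset.sum_const_zero, norm_zero]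
    have : 0 < W := hM.trans_le hMW
    positivity
  · exact abs_sum_coeff_le hk (hν k) (hD k) hM hMW hz hz'

end Series

/-! ### Coefficients of the nonlinearity in jet coordinates. -/

section Jets

variable {n d₁ d₂ : ℕ}

/-- The index set of the coordinates of `E₍₁₎`. -/
abbrev JetIndex (n d₁ d₂ : ℕ) : Type :=
  (Fin d₁ ⊕ Fin d₂) ⊕ (Fin d₂ ⊕ (Fin n × (Fin d₁ ⊕ Fin d₂)))

/-- The element of `E₍₁₎` with given coordinates. -/
def ofJetCoord : (JetIndex n d₁ d₂ → ℝ) →ₗ[ℝ] JetSpace n d₁ d₂ where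
  toFun ζ := (fun i => ζ (Sum.inl i), fun j => ζ (Sum.inr (Sum.inl j)),
    fun l i => ζ (Sum.inr (Sum.inr (l, i))))
  map_add' _ _ := rfl
  map_smul' _ _ := rfl

/-- The standard basis of `E₍₁₎`. -/
def jetBasis (x : JetIndex n d₁ d₂) : JetSpace n d₁ d₂ := ofJetCoord (Pi.single x 1)

theorem norm_jetBasis_le (x : JetIndex n d₁ d₂) : ‖jetBasis x‖ ≤ 1 := by
  have h : ∀ y, ‖(Pi.single x 1 : JetIndex n d₁ d₂ → ℝ) y‖ ≤ 1 := by
    intro y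
    rw [Pi.single_apply]
    split_ifs <;> simp
  refine norm_prod_le_iff.2 ⟨?_, norm_prod_le_iff.2 ⟨?_, ?_⟩⟩
  · exact (pi_norm_le_iff_of_nonneg zero_le_one).2 fun i => h _
  · exact (pi_norm_le_iff_of_nonneg zero_le_one).2 fun i => h _
  · exact (pi_norm_le_iff_of_nonneg zero_le_one).2 fun l =>
      (pi_norm_le_iff_of_nonneg zero_le_one).2 fun i => h _

/-- The coefficients of the `i`-th component of the `k`-th term of `N`. -/
def jetCoeff (N : FormalMultilinearSeries ℝ (JetSpace n d₁ d₂) (Target d₁ d₂))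
    (i : Fin d₁ ⊕ Fin d₂) (k : ℕ) (α : Fin k → JetIndex n d₁ d₂) : ℝ :=
  N k (fun j => jetBasis (α j)) i

theorem abs_jetCoeff_le (N : FormalMultilinearSeries ℝ (JetSpace n d₁ d₂) (Target d₁ d₂))
    (i : Fin d₁ ⊕ Fin d₂) (k : ℕ) (α : Fin k → JetIndex n d₁ d₂) : |jetCoeff N i k α| ≤ ‖N k‖ := by
  rw [← Real.norm_eq_abs]
  refine (norm_le_pi_norm (N k fun j => jetBasis (α j)) i).trans ?_
  refine ((N k).le_opNorm _).trans ?_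
  refine mul_le_of_le_one_right (norm_nonneg _) ?_
  exact Finset.prod_le_one (fun _ _ => norm_nonneg _) fun j _ => norm_jetBasis_le _

theorem apply_eq_sum_jetCoeff
    (N : FormalMultilinearSeries ℝ (JetSpace n d₁ d₂) (Target d₁ d₂)) (i : Fin d₁ ⊕ Fin d₂)
    (k : ℕ) (ζ : JetIndex n d₁ d₂ → ℝ) :
    N k (fun _ => ofJetCoord ζ) i = ∑ α, jetCoeff N i k α * ∏ j, ζ (α j) := by
  have h1 : ofJetCoord ζ = ∑ x, ζ x • jetBasis x := by
    unfold jetBasis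
    simp only [← map_smul]
    rw [← map_sum]
    congr 1
    funext y
    simp [Finset.sum_apply, Pi.single_apply]
  rw [h1, ContinuousMultilinearMap.map_sum, Finset.sum_apply]
  refine Finset.sum_congr rfl fun α _ => ?_
  rw [ContinuousMultilinearMap.map_smul_univ, Pi.smul_apply, smul_eq_mul, mul_comm]
  rfl

theorem jetCoeff_perm {N : FormalMultilinearSeries ℝ (JetSpace n d₁ d₂) (Target d₁ d₂)}
    (hN : IsSymmetricSeries N) (i : Fin d₁ ⊕ Fin d₂) (k : ℕ) (σ : Equiv.Perm (Fin k))
    (α : Fin k → JetIndex n d₁ d₂) : (jetCoeff N i k fun j => α (σ j)) = jetCoeff N i k α := by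
  unfold jetCoeff
  rw [hN k σ fun j => jetBasis (α j)]

/-- The indices of the derivatives. -/
def derivIndices (n d₁ d₂ : ℕ) : Set (JetIndex n d₁ d₂) := Set.range Sum.inr

/-- The indices of the time derivatives. -/
def timeIndices (n d₁ d₂ : ℕ) : Set (JetIndex n d₁ d₂) := Set.range (Sum.inr ∘ Sum.inl)

theorem ofJetCoord_scaleOn_deriv (c : ℝ) (ζ : JetIndex n d₁ d₂ → ℝ) :
    ofJetCoord (scaleOn (derivIndices n d₁ d₂) c ζ) =
      ((ofJetCoord ζ).1, c • (ofJetCoord ζ).2.1, c • (ofJetCoord ζ).2.2) := by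
  simp only [ofJetCoord, derivIndices]
  refine Prod.ext ?_ (Prod.ext ?_ ?_)
  · funext i; simp [scaleOn]
  · funext i; simp [scaleOn]
  · funext l i; simp [scaleOn]

theorem ofJetCoord_scaleOn_time (c : ℝ) (ζ : JetIndex n d₁ d₂ → ℝ) :
    ofJetCoord (scaleOn (timeIndices n d₁ d₂) c ζ) =
      ((ofJetCoord ζ).1, c • (ofJetCoord ζ).2.1, (ofJetCoord ζ).2.2) := by
  simp only [ofJetCoord, timeIndices]
  refine Prod.ext ?_ (Prod.ext ?_ ?_)
  · funext i; simp [scaleOn]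
  · funext i; simp [scaleOn]
  · funext l i; simp [scaleOn]

theorem FirstPartIndep.countIn_eq_zero
    {N : FormalMultilinearSeries ℝ (JetSpace n d₁ d₂) (Target d₁ d₂)} (hN : IsSymmetricSeries N)
    (h : FirstPartIndep N) (i : Fin d₁) (k : ℕ) (α : Fin k → JetIndex n d₁ d₂)
    (hα : jetCoeff N (Sum.inl i) k α ≠ 0) : countIn (derivIndices n d₁ d₂) α = 0 := by
  refine countIn_eq_zero_of_indep (jetCoeff_perm hN (Sum.inl i) k) _ (fun ζ => ?_) hα
  rw [← apply_eq_sum_jetCoeff, ← apply_eq_sum_jetCoeff, h, ofJetCoord_scaleOn_deriv, zero_smul,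
    zero_smul]

theorem SecondPartIndep.countIn_eq_zero
    {N : FormalMultilinearSeries ℝ (JetSpace n d₁ d₂) (Target d₁ d₂)} (hN : IsSymmetricSeries N)
    (h : SecondPartIndep N) (i : Fin d₂) (k : ℕ) (α : Fin k → JetIndex n d₁ d₂)
    (hα : jetCoeff N (Sum.inr i) k α ≠ 0) : countIn (derivIndices n d₁ d₂) α = 0 := by
  refine countIn_eq_zero_of_indep (jetCoeff_perm hN (Sum.inr i) k) _ (fun ζ => ?_) hα
  rw [← apply_eq_sum_jetCoeff, ← apply_eq_sum_jetCoeff, ofJetCoord_scaleOn_deriv, zero_smul,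
    zero_smul]
  exact congrFun (h k (ofJetCoord ζ)) i

theorem SecondPartIndepTime.countIn_eq_zero
    {N : FormalMultilinearSeries ℝ (JetSpace n d₁ d₂) (Target d₁ d₂)} (hN : IsSymmetricSeries N)
    (h : SecondPartIndepTime N) (i : Fin d₂) (k : ℕ) (α : Fin k → JetIndex n d₁ d₂)
    (hα : jetCoeff N (Sum.inr i) k α ≠ 0) : countIn (timeIndices n d₁ d₂) α = 0 := by
  refine countIn_eq_zero_of_indep (jetCoeff_perm hN (Sum.inr i) k) _ (fun ζ => ?_) hα
  rw [← apply_eq_sum_jetCoeff, ← apply_eq_sum_jetCoeff, ofJetCoord_scaleOn_time, zero_smul]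
  exact congrFun (h k (ofJetCoord ζ)) i

/-- The second difference of the sum of N is itself the sum of a power series. If it vanishes near
0, uniqueness of power series makes every homogeneous term vanish, hence at all z. -/
theorem apply_scale_eq_zero {N : FormalMultilinearSeries ℝ (JetSpace n d₁ d₂) (Target d₁ d₂)}
    (hN : 0 < N.radius) (A A' : JetSpace n d₁ d₂ →L[ℝ] JetSpace n d₁ d₂)
    (h : ∀ᶠ z in 𝓝 0, part₂ (N.sum (A z)) - (2 : ℝ) • part₂ (N.sum z) + part₂ (N.sum (A' z)) = 0)
    (k : ℕ) (z : JetSpace n d₁ d₂) (i : Fin d₂) :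
    N k (fun _ => A z) (Sum.inr i) - 2 * N k (fun _ => z) (Sum.inr i) +
      N k (fun _ => A' z) (Sum.inr i) = 0 := by
  have h0 : HasFPowerSeriesAt N.sum N 0 := (N.hasFPowerSeriesOnBall hN).hasFPowerSeriesAt
  let p : Target d₁ d₂ →L[ℝ] (Fin d₂ → ℝ) :=
    ContinuousLinearMap.pi fun j => ContinuousLinearMap.proj (Sum.inr j)
  have hp : ∀ z, p z = part₂ z := fun z => rfl
  have hA : ∀ A : JetSpace n d₁ d₂ →L[ℝ] JetSpace n d₁ d₂,
      HasFPowerSeriesAt (fun z => part₂ (N.sum (A z)))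
        (p.compFormalMultilinearSeries (N.compContinuousLinearMap A)) 0 := by
    intro A
    have h1 : HasFPowerSeriesAt N.sum N (A 0) := by rw [map_zero]; exact h0
    obtain ⟨r, hr⟩ := h1.compContinuousLinearMap
    exact ⟨r, p.comp_hasFPowerSeriesOnBall hr⟩
  have h1 := ((hA A).sub ((hA (ContinuousLinearMap.id ℝ _)).const_smul (c := (2 : ℝ)))).add (hA A')
  have h2 := (h1.congr h).apply_eq_zero k z
  have h3 := congrFun h2 i
  simpa [p, sub_eq_add_neg, Function.comp_def] using h3

/-- A map affine in ∂u has zero second difference at the scales 2, 1, 0 of ∂u. The analyticity of J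
and K is not needed for this. -/
theorem SecondPartAffine.countIn_le_one
    {N : FormalMultilinearSeries ℝ (JetSpace n d₁ d₂) (Target d₁ d₂)} (hN : IsSymmetricSeries N)
    (hr : 0 < N.radius) (h : SecondPartAffine N) (i : Fin d₂) (k : ℕ)
    (α : Fin k → JetIndex n d₁ d₂) (hα : jetCoeff N (Sum.inr i) k α ≠ 0) :
    countIn (derivIndices n d₁ d₂) α ≤ 1 := by
  obtain ⟨J, K, -, -, hJK⟩ := h
  let A : ℝ → JetSpace n d₁ d₂ →L[ℝ] JetSpace n d₁ d₂ := fun c =>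
    (ContinuousLinearMap.fst ℝ _ _).prod (c • ContinuousLinearMap.snd ℝ _ _)
  have hA : ∀ c z, A c z = (z.1, c • z.2) := fun c z => rfl
  refine countIn_le_one_of_affine (jetCoeff_perm hN (Sum.inr i) k) _ (fun ζ => ?_) hα
  rw [← apply_eq_sum_jetCoeff, ← apply_eq_sum_jetCoeff, ← apply_eq_sum_jetCoeff,
    ofJetCoord_scaleOn_deriv, ofJetCoord_scaleOn_deriv]
  refine apply_scale_eq_zero hr (A 2) (A 0) ?_ k (ofJetCoord ζ) i
  have ht : ∀ c, Tendsto (A c) (𝓝 0) (𝓝 0) := fun c => by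
    simpa using (A c).continuous.tendsto 0
  filter_upwards [hJK, (ht 2).eventually hJK, (ht 0).eventually hJK] with z h1 h2 h3
  rw [h1, h2, h3]
  simp only [hA, map_smul]
  module

theorem SecondPartAffineTime.countIn_le_one
    {N : FormalMultilinearSeries ℝ (JetSpace n d₁ d₂) (Target d₁ d₂)} (hN : IsSymmetricSeries N)
    (hr : 0 < N.radius) (h : SecondPartAffineTime N) (i : Fin d₂) (k : ℕ)
    (α : Fin k → JetIndex n d₁ d₂) (hα : jetCoeff N (Sum.inr i) k α ≠ 0) :
    countIn (timeIndices n d₁ d₂) α ≤ 1 := by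
  obtain ⟨J, K, -, -, hJK⟩ := h
  let A : ℝ → JetSpace n d₁ d₂ →L[ℝ] JetSpace n d₁ d₂ := fun c =>
    (ContinuousLinearMap.fst ℝ _ _).prod (((c • ContinuousLinearMap.fst ℝ _ _).prod
      (ContinuousLinearMap.snd ℝ _ _)).comp (ContinuousLinearMap.snd ℝ _ _))
  have hA : ∀ c z, A c z = (z.1, c • z.2.1, z.2.2) := fun c z => rfl
  refine countIn_le_one_of_affine (jetCoeff_perm hN (Sum.inr i) k) _ (fun ζ => ?_) hα
  rw [← apply_eq_sum_jetCoeff, ← apply_eq_sum_jetCoeff, ← apply_eq_sum_jetCoeff,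
    ofJetCoord_scaleOn_time, ofJetCoord_scaleOn_time]
  refine apply_scale_eq_zero hr (A 2) (A 0) ?_ k (ofJetCoord ζ) i
  have ht : ∀ c, Tendsto (A c) (𝓝 0) (𝓝 0) := fun c => by
    simpa using (A c).continuous.tendsto 0
  filter_upwards [hJK, (ht 2).eventually hJK, (ht 0).eventually hJK] with z h1 h2 h3
  rw [h1, h2, h3]
  simp only [hA, map_smul]
  module

end Jets

end

/-! ### Symbols of differential operators. -/

section

section Symbols

variable {n : ℕ} {m s : ℝ}

theorem continuous_symbol (p : MvPolynomial (Fin n) ℝ) : Continuous (symbol p) := by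
  unfold symbol
  simp only [MvPolynomial.aeval_eq_eval₂Hom]
  simp only [MvPolynomial.coe_eval₂Hom, MvPolynomial.eval₂_eq]
  fun_prop

/-- The coefficients are real and iξ is purely imaginary; this is why real differential operators
preserve real distributions. -/
theorem symbol_neg (p : MvPolynomial (Fin n) ℝ) (ξ : Sp n) :
    symbol p (-ξ) = (starRingEnd ℂ) (symbol p ξ) := by
  unfold symbol
  simp only [MvPolynomial.aeval_eq_eval₂Hom, MvPolynomial.coe_eval₂Hom, MvPolynomial.eval₂_eq,
    map_sum, map_mul, map_prod, map_pow]
  simp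

/-- The weight `⟨ξ⟩ = (m² + |ξ|²)^{1/2}`. -/
def bracket (m : ℝ) (ξ : Sp n) : ℝ := (m ^ 2 + ‖ξ‖ ^ 2) ^ ((1 : ℝ) / 2)

theorem bracket_pos (hm : 0 < m) (ξ : Sp n) : 0 < bracket m ξ := by
  unfold bracket; positivity

theorem bracket_sq (ξ : Sp n) : bracket m ξ ^ 2 = m ^ 2 + ‖ξ‖ ^ 2 := by
  unfold bracket
  rw [← Real.rpow_natCast, ← Real.rpow_mul (by positivity)]
  norm_num

theorem le_bracket (hm : 0 < m) (ξ : Sp n) : m ≤ bracket m ξ :=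
  le_of_sq_le_sq (by rw [bracket_sq]; nlinarith [sq_nonneg ‖ξ‖]) (bracket_pos hm ξ).le

theorem norm_le_bracket (hm : 0 < m) (ξ : Sp n) : ‖ξ‖ ≤ bracket m ξ :=
  le_of_sq_le_sq (by rw [bracket_sq]; nlinarith [sq_nonneg m]) (bracket_pos hm ξ).le

theorem weight_add_natCast (hm : 0 < m) (s : ℝ) (k : ℕ) (η : Sp n) :
    weight n m (s + k) η = weight n m s η * bracket m ((2 * Real.pi) • η) ^ k := by
  have h : 0 < m ^ 2 + ‖(2 * Real.pi) • η‖ ^ 2 := by positivity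
  unfold weight bracket
  rw [mul_assoc, ← Real.rpow_natCast (_ ^ ((1 : ℝ) / 2)) k, ← Real.rpow_mul h.le, ← Real.rpow_add h]
  congr 2
  ring

/-- A monomial of degree d ≤ k is at most ⟨ξ⟩^d. The missing k - d powers are supplied by m⁻¹⟨ξ⟩ ≥
1. -/
theorem exists_norm_symbol_le (hm : 0 < m) (p : MvPolynomial (Fin n) ℝ) {k : ℕ}
    (hp : p.totalDegree ≤ k) : ∃ C : ℝ, 0 ≤ C ∧ ∀ ξ, ‖symbol p ξ‖ ≤ C * bracket m ξ ^ k := by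
  refine ⟨∑ a ∈ p.support, |p.coeff a| * (m⁻¹) ^ (k - a.sum fun _ e => e),
    Finset.sum_nonneg fun a _ => by positivity, fun ξ => ?_⟩
  have hb := bracket_pos hm ξ
  unfold symbol
  rw [MvPolynomial.aeval_eq_eval₂Hom, MvPolynomial.coe_eval₂Hom, MvPolynomial.eval₂_eq,
    Finset.sum_mul]
  refine (norm_sum_le _ _).trans (Finset.sum_le_sum fun a ha => ?_)
  have hd : (a.sum fun _ e => e) ≤ k := (MvPolynomial.le_totalDegree ha).trans hp
  have h1 : ‖∏ i ∈ a.support, (Complex.I * (ξ i : ℂ)) ^ a i‖ ≤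
      bracket m ξ ^ (a.sum fun _ e => e) := by
    rw [norm_prod, Finsupp.sum, ← Finset.prod_pow_eq_pow_sum]
    refine Finset.prod_le_prod (fun _ _ => norm_nonneg _) fun i _ => ?_
    rw [norm_pow, norm_mul, Complex.norm_I, one_mul, Complex.norm_real]
    have := (PiLp.norm_apply_le ξ i).trans (norm_le_bracket hm ξ)
    gcongr
  rw [norm_mul]
  have h2 : ‖(algebraMap ℝ ℂ) (MvPolynomial.coeff a p)‖ = |p.coeff a| := by simp
  rw [h2, mul_assoc]
  refine mul_le_mul_of_nonneg_left (h1.trans ?_) (abs_nonneg _)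
  have h3 : 1 ≤ m⁻¹ * bracket m ξ := by
    rw [inv_mul_eq_div, one_le_div hm]
    exact le_bracket hm ξ
  calc bracket m ξ ^ (a.sum fun _ e => e)
      ≤ (m⁻¹ * bracket m ξ) ^ (k - a.sum fun _ e => e) * bracket m ξ ^ (a.sum fun _ e => e) :=
        le_mul_of_one_le_left (by positivity) (one_le_pow₀ h3)
    _ = _ := by
      rw [mul_pow, mul_assoc, ← pow_add, Nat.sub_add_cancel hd]

theorem exists_isMultiplier_symbol (s : ℝ) [hm : Fact (0 < m)] (p : MvPolynomial (Fin n) ℝ)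
    {k : ℕ} (hp : p.totalDegree ≤ k) :
    ∃ B, IsMultiplier n m s (s - k) (fun η => symbol p ((2 * Real.pi) • η)) B := by
  obtain ⟨C, hC, h⟩ := exists_norm_symbol_le hm.out p hp
  refine ⟨C, ((continuous_symbol p).comp (by fun_prop)).aestronglyMeasurable, fun η => ?_,
    fun η => ?_⟩
  · rw [smul_neg, symbol_neg]
  · have h1 := weight_add_natCast hm.out (s - k) k η
    rw [sub_add_cancel] at h1
    have h2 := (weight_pos n hm.out (s - k) η).le
    rw [h1]
    calc _ ≤ weight n m (s - k) η * (C * bracket m ((2 * Real.pi) • η) ^ k) := by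
          gcongr; exact h _
      _ = _ := by ring

theorem HasHat.lineDeriv {T : 𝓢'(Sp n, ℂ)} {h : Sp n → ℂ} (H : HasHat T h) (l : Fin n) :
    HasHat (∂_{EuclideanSpace.single l (1 : ℝ)} T)
      (fun η => Complex.I * (((2 * Real.pi) • η) l : ℂ) * h η) := by
  intro f
  have hg : (fun η : Sp n => inner ℝ η (EuclideanSpace.single l (1 : ℝ))).HasTemperateGrowth := by
    fun_prop
  have e : (fun η : Sp n => inner ℝ η (EuclideanSpace.single l (1 : ℝ))) = fun η => η l := by
    funext η
    rw [EuclideanSpace.inner_single_right]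
    simp
  rw [TemperedDistribution.fourier_lineDerivOp_eq]
  change (2 * Real.pi * Complex.I : ℂ) •
    (TemperedDistribution.smulLeftCLM ℂ _ (𝓕 T) f) = _
  rw [TemperedDistribution.smulLeftCLM_apply_apply, H, smul_eq_mul, ← integral_const_mul]
  congr 1
  funext η
  rw [SchwartzMap.smulLeftCLM_apply_apply]
  · rw [congrFun e η]
    simp
    ring
  · exact Function.HasTemperateGrowth.comp Function.Complex.hasTemperateGrowth_ofReal hg

theorem Sobolev.exists_lineDeriv [hm : Fact (0 < m)] (n : ℕ) {s a : ℝ} (ha : a ≤ s - 1)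
    (l : Fin n) : ∃ A : Sobolev n m s →L[ℝ] Sobolev n m a,
      ∀ T, (A T).toDist = ∂_{EuclideanSpace.single l (1 : ℝ)} T.toDist := by
  obtain ⟨B, hB⟩ := exists_isMultiplier_symbol (m := m) s (MvPolynomial.X l : MvPolynomial (Fin n) ℝ)
    (k := 1) (by simp)
  have ha' : a ≤ s - (1 : ℕ) := by simpa using ha
  refine ⟨(IsMultiplier.one ha').clm.comp hB.clm, fun T => ?_⟩
  refine (HasHat.congr (Sobolev.hasHat _) ?_).eq_dist (T.hasHat.lineDeriv l)
  refine ((IsMultiplier.one ha').hat_clm _).trans ?_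
  filter_upwards [hB.hat_clm T] with η hη
  rw [one_mul]
  refine hη.trans ?_
  simp [symbol]

theorem Sobolev.exists_inclusion [hm : Fact (0 < m)] (n : ℕ) {s a : ℝ} (ha : a ≤ s) :
    ∃ A : Sobolev n m s →L[ℝ] Sobolev n m a, ∀ T, (A T).toDist = T.toDist := by
  refine ⟨(IsMultiplier.one ha).clm, fun T => ?_⟩
  rw [Sobolev.toDist_eq_iff]
  filter_upwards [(IsMultiplier.one ha).hat_clm T] with η hη
  rw [hη, one_mul]

end Symbols

/-! ### The components of the nonlinearity as analytic functions of the Cauchy data. -/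

section Nonlinearity

open Sobolev

variable {n r d₁ d₂ : ℕ} {m s : ℝ} [hm : Fact (0 < m)]

/-- The coordinates of `(φ, ∂φ)` as tempered distributions. -/
def jetDist (c : Cau n r d₁ d₂ m s) : JetIndex n d₁ d₂ → 𝓢'(Sp n, ℂ)
  | Sum.inl i => (c.fst i).toDist
  | Sum.inr (Sum.inl j) => (c.snd j).toDist
  | Sum.inr (Sum.inr (l, i)) => ∂_{EuclideanSpace.single l (1 : ℝ)} (c.fst i).toDist

/-- The value of `(φ, ∂φ)` at a point. -/
def jetFun (c : Cau n r d₁ d₂ m s) (y : Sp n) : JetSpace n d₁ d₂ :=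
  ofJetCoord fun x => representative (jetDist c x) y

/-- The coordinate `x` is given by a continuous linear map to `H^a`. -/
def HasCoord (n r d₁ d₂ : ℕ) (m s a : ℝ) [Fact (0 < m)] (x : JetIndex n d₁ d₂) : Prop :=
  ∃ A : Cau n r d₁ d₂ m s →L[ℝ] Sobolev n m a, ∀ c, (A c).toDist = jetDist c x

theorem hasCoord_value {a : ℝ} (ha : a ≤ s) (i : Fin d₁ ⊕ Fin d₂) :
    HasCoord n r d₁ d₂ m s a (Sum.inl i) := by
  obtain ⟨A, hA⟩ := Sobolev.exists_inclusion (m := m) n ha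
  exact ⟨A.comp ((PiLp.proj 1 (fun _ : Fin d₁ ⊕ Fin d₂ => Sobolev n m s) i).comp
    (WithLp.fstL 1 ℝ _ _)), fun c => hA _⟩

theorem hasCoord_time {a : ℝ} (ha : a ≤ s - r) (j : Fin d₂) :
    HasCoord n r d₁ d₂ m s a (Sum.inr (Sum.inl j)) := by
  obtain ⟨A, hA⟩ := Sobolev.exists_inclusion (m := m) n ha
  exact ⟨A.comp ((PiLp.proj 1 (fun _ : Fin d₂ => Sobolev n m (s - r)) j).comp
    (WithLp.sndL 1 ℝ _ _)), fun c => hA _⟩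

theorem hasCoord_space {a : ℝ} (ha : a ≤ s - 1) (l : Fin n) (i : Fin d₁ ⊕ Fin d₂) :
    HasCoord n r d₁ d₂ m s a (Sum.inr (Sum.inr (l, i))) := by
  obtain ⟨A, hA⟩ := Sobolev.exists_lineDeriv (m := m) n ha l
  exact ⟨A.comp ((PiLp.proj 1 (fun _ : Fin d₁ ⊕ Fin d₂ => Sobolev n m s) i).comp
    (WithLp.fstL 1 ℝ _ _)), fun c => hA _⟩

/-- Coordinates in Z occur in no monomial and may be given arbitrary values. They need not even be
represented by functions, for example ∂₀u₂ when s < r. -/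
theorem apply_jetFun_eq {N : FormalMultilinearSeries ℝ (JetSpace n d₁ d₂) (Target d₁ d₂)}
    {i : Fin d₁ ⊕ Fin d₂} {Z : Set (JetIndex n d₁ d₂)}
    (hZ : ∀ k α, jetCoeff N i k α ≠ 0 → countIn Z α = 0) {k : ℕ} (c : Cau n r d₁ d₂ m s)
    {z : JetIndex n d₁ d₂ → ℝ} {y : Sp n}
    (hz : ∀ x ∉ Z, z x = representative (jetDist c x) y) :
    N k (fun _ => jetFun c y) i = ∑ α, jetCoeff N i k α * ∏ j, z (α j) := by
  unfold jetFun
  rw [apply_eq_sum_jetCoeff]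
  refine Finset.sum_congr rfl fun α _ => ?_
  by_cases hα : jetCoeff N i k α = 0
  · rw [hα, zero_mul, zero_mul]
  · congr 1
    refine Finset.prod_congr rfl fun j _ => (hz _ fun hj => ?_).symm
    have h1 := hZ k α hα
    classical
    unfold countIn at h1
    rw [Finset.card_eq_zero, Finset.filter_eq_empty_iff] at h1
    exact h1 (Finset.mem_univ j) hj

theorem ae_sum_smul_prod {S : Type*} [Fintype S] {k : ℕ} (D : (Fin k → S) → ℝ)
    (R : S → (Sp n →ₘ[volume] ℝ)) :
    ∀ᵐ y, (∑ α : Fin k → S, D α • ∏ j, R (α j) : Sp n →ₘ[volume] ℝ) y =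
      ∑ α : Fin k → S, D α * ∏ j, R (α j) y := by
  have e4 : ∀ α : Fin k → S, ∀ᵐ y, (D α • ∏ j, R (α j) : Sp n →ₘ[volume] ℝ) y =
      D α * ∏ j, R (α j) y := by
    intro α
    filter_upwards [AEEqFun.coeFn_smul (D α) (∏ j, R (α j)),
      coeFn_finset_prod Finset.univ fun j => R (α j)] with y h5 h6
    rw [h5, Pi.smul_apply, h6, smul_eq_mul]
  filter_upwards [ae_all_iff.2 e4, coeFn_finset_sum Finset.univ fun α : Fin k → S =>
    (D α • ∏ j, R (α j) : Sp n →ₘ[volume] ℝ)] with y h5 h6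
  exact Eq.trans h6 (Finset.sum_congr rfl fun α _ => h5 α)

/-- The component `Nⁱ(φ, ∂φ)`, as an analytic function of the Cauchy data of `φ` with values in
`H^b`. -/
theorem exists_component {a b : ℝ} (ha : (n : ℝ) / 2 < a) (hb : 0 ≤ b) (hab : b ≤ a)
    (Z B : Set (JetIndex n d₁ d₂)) (hB : ∀ x ∉ Z, x ∉ B → HasCoord n r d₁ d₂ m s a x)
    (hZ : ∀ x ∉ Z, HasCoord n r d₁ d₂ m s b x) :
    ∃ Q : ℝ, 0 < Q ∧ ∀ (N : FormalMultilinearSeries ℝ (JetSpace n d₁ d₂) (Target d₁ d₂))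
      (i : Fin d₁ ⊕ Fin d₂), IsSymmetricSeries N → N 0 = 0 →
      (∀ k α, jetCoeff N i k α ≠ 0 → countIn Z α = 0) →
      (∀ k α, jetCoeff N i k α ≠ 0 → countIn B α ≤ 1) →
      ∃ Φ : FormalMultilinearSeries ℝ (Cau n r d₁ d₂ m s) (Sobolev n m b),
        IsSymmetricSeries Φ ∧ (∀ k, ‖Φ k‖ ≤ Q ^ k * ‖N k‖) ∧
        ∀ (c : Cau n r d₁ d₂ m s) (t : ℝ), 0 < t → ‖c‖ ≤ t →
          (Summable fun k => ‖N k‖ * (Q * t) ^ k) → ∀ F, HasSum (fun k => Φ k fun _ => c) F →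
          ∀ᵐ y, HasSum (fun k => N k (fun _ => jetFun c y) i) (rep hb F y) := by
  classical
  have ha0 : 0 ≤ a := le_trans (by positivity) ha.le
  obtain ⟨K, hK0, hK⟩ := Sobolev.exists_mul n m ha ha0 hb hab
  obtain ⟨M, hM0, hM⟩ := Sobolev.exists_abs_rep_le n m a ha ha0
  -- `A x` gives the coordinate x in H^b, with the dummy value 0 on Z. Outside B, `A' x` gives the
  -- same function in H^a.
  have hA : ∀ x, ∃ A : Cau n r d₁ d₂ m s →L[ℝ] Sobolev n m b,
      (x ∉ Z → ∀ c, (A c).toDist = jetDist c x) ∧ (x ∈ Z → A = 0) := by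
    intro x
    by_cases hx : x ∈ Z
    · exact ⟨0, fun h => absurd hx h, fun _ => rfl⟩
    · obtain ⟨A, hA⟩ := hZ x hx
      exact ⟨A, fun _ => hA, fun h => absurd h hx⟩
  choose A hA hA0 using hA
  have hA' : ∀ x, ∃ A' : Cau n r d₁ d₂ m s →L[ℝ] Sobolev n m a,
      x ∉ B → ∀ c, rep ha0 (A' c) = rep hb (A x c) := by
    intro x
    by_cases hx : x ∈ Z
    · refine ⟨0, fun _ c => ?_⟩
      rw [hA0 x hx]
      simp
    · by_cases hxB : x ∈ B
      · exact ⟨0, fun h => absurd hxB h⟩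
      · obtain ⟨A', h'⟩ := hB x hx hxB
        refine ⟨A', fun _ c => ?_⟩
        rw [Sobolev.rep_eq_iff, h', hA x hx]
  choose A' hA' using hA'
  set C : ℝ := ∑ x, (‖A x‖ + ‖A' x‖) with hC
  have hC0 : 0 ≤ C := Finset.sum_nonneg fun _ _ => by positivity
  have hCx : ∀ x, ‖A x‖ + ‖A' x‖ ≤ C := fun x =>
    Finset.single_le_sum (f := fun x => ‖A x‖ + ‖A' x‖) (fun _ _ => by positivity)
      (Finset.mem_univ x)
  have hAC : ∀ x c, ‖A x c‖ ≤ C * ‖c‖ := fun x c => (A x).le_of_opNorm_le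
    (by linarith [hCx x, norm_nonneg (A' x)]) c
  have hAC' : ∀ x c, ‖A' x c‖ ≤ C * ‖c‖ := fun x c => (A' x).le_of_opNorm_le
    (by linarith [hCx x, norm_nonneg (A x)]) c
  set S : ℝ := (Fintype.card (JetIndex n d₁ d₂) : ℝ) with hS
  have hS0 : 0 ≤ S := by positivity
  have hK1 : (1 : ℝ) ≤ max 1 K := le_max_left _ _
  -- The first summand of Q controls the norms of the terms in H^b, the second the pointwise
  -- convergence through the sup-norm bound M; the 1 makes Q positive.
  set Q : ℝ := S * (max 1 K * C) + S * (M * (C + 1)) + 1 with hQ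
  have hQ1 : S * (max 1 K * C) ≤ Q := by
    have : 0 ≤ S * (M * (C + 1)) := by positivity
    linarith
  have hQ2 : S * (M * (C + 1)) ≤ Q := by
    have : 0 ≤ S * (max 1 K * C) := by positivity
    linarith
  have hQ0 : 0 < Q := by positivity
  refine ⟨Q, hQ0, fun N i hN hN0 hNZ hNB => ?_⟩
  have hD0 : jetCoeff N i 0 = 0 := by funext α; simp [jetCoeff, hN0]
  obtain ⟨Φ, h1, h2, h3⟩ := exists_series (ha := ha0) (hb := hb) (K := max 1 K) (C := C) hK1 hC0
    (fun f g => by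
      obtain ⟨T, h, h'⟩ := hK f g
      refine ⟨T, h, h'.trans ?_⟩
      gcongr
      exact le_max_right _ _)
    (fun x => (rep hb).comp (A x).toLinearMap) B
    (fun x hx c => ⟨A' x c, hA' x hx c, hAC' x c⟩) (fun x c => ⟨A x c, rfl, hAC x c⟩)
    (D := jetCoeff N i) (ν := fun k => ‖N k‖) (fun k => norm_nonneg _)
    (fun k α => abs_jetCoeff_le N i k α)
    hD0 (jetCoeff_perm hN i) hNB
  refine ⟨Φ, h1, fun k => (h2 k).trans ?_, fun c t ht hct hsum F hF => ?_⟩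
  · gcongr
  · have e1 : ∀ᵐ y, ∀ x, x ∉ Z → rep hb (A x c) y = representative (jetDist c x) y := by
      rw [ae_all_iff]
      intro x
      by_cases hx : x ∈ Z
      · exact ae_of_all _ fun y h => absurd hx h
      · filter_upwards [representative_ae_eq hb (A x c)] with y hy _
        rw [← hy, hA x hx]
    -- C + 1 in place of C keeps the pointwise bound positive when all coordinate maps vanish.
    have e2 : ∀ᵐ y, ∀ x, x ∉ B → |rep hb (A x c) y| ≤ M * ((C + 1) * t) := by
      rw [ae_all_iff]
      intro x
      by_cases hx : x ∈ B
      · exact ae_of_all _ fun y h => absurd hx h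
      · filter_upwards [hM (A' x c)] with y hy _
        rw [← hA' x hx]
        refine hy.trans ?_
        gcongr
        refine (hAC' x c).trans ?_
        gcongr
        linarith
    have e3 : ∀ᵐ y, ∀ k, rep hb (Φ k fun _ => c) y =
        ∑ α : Fin k → JetIndex n d₁ d₂, jetCoeff N i k α * ∏ j, rep hb (A (α j) c) y := by
      rw [ae_all_iff]
      intro k
      rw [h3]
      exact ae_sum_smul_prod (jetCoeff N i k) fun x => rep hb (A x c)
    have e5 : ∀ᵐ y, ∀ k, rep hb (Φ k fun _ => c) y = N k (fun _ => jetFun c y) i := by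
      filter_upwards [e1, e3] with y h5 h6 k
      rw [h6, apply_jetFun_eq hNZ c h5]
    refine rep_sum_ae_eq hF (g := fun k y => N k (fun _ => jetFun c y) i) (fun k => ?_) ?_
    · filter_upwards [e5] with y hy using hy k
    · filter_upwards [e3, e5, e2] with y h5 h6 h7
      have h8 := summable_coeff (B := B) (D := jetCoeff N i) (ν := fun k => ‖N k‖)
        (fun k α => abs_jetCoeff_le N i k α) hD0 hNB (M := M * ((C + 1) * t)) (by positivity)
        (z := fun x => rep hb (A x c) y) h7 ?_
      · exact h8.congr fun k => by rw [← h6, h5]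
      refine Summable.of_nonneg_of_le (fun k => by positivity) (fun k => ?_) hsum
      refine mul_le_mul_of_nonneg_left (pow_le_pow_left₀ (by positivity) ?_ k) (norm_nonneg _)
      calc (Fintype.card (JetIndex n d₁ d₂) : ℝ) * (M * ((C + 1) * t))
          = S * (M * (C + 1)) * t := by rw [hS]; ring
        _ ≤ Q * t := by gcongr

end Nonlinearity

end

/-! ### Choice of Sobolev exponents in the three cases. -/

section

section Nonlinearity

open Sobolev

variable {n r d₁ d₂ : ℕ} {m s : ℝ} [hm : Fact (0 < m)]

/-- `Nⁱ(φ, ∂φ)` is an analytic function of the Cauchy data of `φ`, with values in `H^b`. -/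
def IsComponentAnalytic (r : ℕ) (m s : ℝ) [Fact (0 < m)] {b : ℝ} (hb : 0 ≤ b) (Q : ℝ)
    (N : FormalMultilinearSeries ℝ (JetSpace n d₁ d₂) (Target d₁ d₂)) (i : Fin d₁ ⊕ Fin d₂) :
    Prop :=
  ∃ Φ : FormalMultilinearSeries ℝ (Cau n r d₁ d₂ m s) (Sobolev n m b),
    IsSymmetricSeries Φ ∧ (∀ k, ‖Φ k‖ ≤ Q ^ k * ‖N k‖) ∧
    ∀ (c : Cau n r d₁ d₂ m s) (t : ℝ), 0 < t → ‖c‖ ≤ t →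
      (Summable fun k => ‖N k‖ * (Q * t) ^ k) → ∀ F, HasSum (fun k => Φ k fun _ => c) F →
      ∀ᵐ y, HasSum (fun k => N k (fun _ => jetFun c y) i) (rep hb F y)

theorem IsComponentAnalytic.mono {b : ℝ} {hb : 0 ≤ b} {Q Q' : ℝ} (hQ : 0 < Q) (hQQ : Q ≤ Q')
    {N : FormalMultilinearSeries ℝ (JetSpace n d₁ d₂) (Target d₁ d₂)} {i : Fin d₁ ⊕ Fin d₂}
    (h : IsComponentAnalytic r m s hb Q N i) : IsComponentAnalytic r m s hb Q' N i := by
  obtain ⟨Φ, h1, h2, h3⟩ := h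
  refine ⟨Φ, h1, fun k => (h2 k).trans (by gcongr), fun c t ht hc hs => h3 c t ht hc ?_⟩
  refine Summable.of_nonneg_of_le (fun k => by positivity) (fun k => ?_) hs
  gcongr

theorem countIn_empty {S : Type*} {k : ℕ} (α : Fin k → S) : countIn (∅ : Set S) α = 0 := by
  simp [countIn]

theorem hasCoord_of_notMem_derivIndices {x : JetIndex n d₁ d₂} (hx : x ∉ derivIndices n d₁ d₂) :
    HasCoord n r d₁ d₂ m s s x := by
  rcases x with i | x
  · exact hasCoord_value le_rfl i
  · exact absurd ⟨x, rfl⟩ hx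

theorem hasCoord_of_notMem_timeIndices (x : JetIndex n d₁ d₂) (hx : x ∉ timeIndices n d₁ d₂) :
    HasCoord n r d₁ d₂ m s (s - 1) x := by
  rcases x with i | j | ⟨l, i⟩
  · exact hasCoord_value (by linarith) i
  · exact absurd ⟨j, rfl⟩ hx
  · exact hasCoord_space le_rfl l i

/-- The exponent s - r accommodates every coordinate: ∂₀u₂ by definition of the Cauchy data, and the
spatial derivatives because r ≥ 1. -/
theorem hasCoord_all (hr : 1 ≤ r) (x : JetIndex n d₁ d₂) :
    HasCoord n r d₁ d₂ m s (s - r) x := by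
  have h1 : (1 : ℝ) ≤ r := by exact_mod_cast hr
  rcases x with i | j | ⟨l, i⟩
  · exact hasCoord_value (by linarith) i
  · exact hasCoord_time le_rfl j
  · exact hasCoord_space (by linarith) l i

/-- The nonlinearity is analytic as a function of the Cauchy data, in all the cases considered. -/
theorem exists_nonlinearity (n r d₁ d₂ : ℕ) (hr : 1 ≤ r) (m s : ℝ) [hm : Fact (0 < m)] :
    ∃ Q : ℝ, 0 < Q ∧ ∀ N : FormalMultilinearSeries ℝ (JetSpace n d₁ d₂) (Target d₁ d₂),
      IsSymmetricSeries N → 0 < N.radius → N 0 = 0 → FirstPartIndep N →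
      ((SecondPartIndep N ∧ (n : ℝ) / 2 < s) ∨
        (SecondPartAffine N ∧ (n : ℝ) / 2 < s ∧ s - r < (n : ℝ) / 2 ∧ 0 ≤ s - r) ∨
        ((n : ℝ) / 2 + 1 < s ∧
          ((n : ℝ) / 2 < s - r ∨ (0 ≤ s - r ∧ SecondPartAffineTime N) ∨
            SecondPartIndepTime N))) →
      ∃ (b : ℝ) (hb : 0 ≤ b) (hs : 0 ≤ s), s - r ≤ b ∧
        (∀ i, IsComponentAnalytic r m s hs Q N (Sum.inl i)) ∧
        ∀ j, IsComponentAnalytic r m s hb Q N (Sum.inr j) := by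
  have hr1 : (1 : ℝ) ≤ r := by exact_mod_cast hr
  have hn0 : (0 : ℝ) ≤ (n : ℝ) / 2 := by positivity
  -- Q has to be fixed before N and its case are known. Each configuration of exponents gets a
  -- constant, with the dummy value 1 if its condition p on n, r, s fails, and Q is the sum of all
  -- of them.
  have key : ∀ (p : Prop) (a b : ℝ) (Z B : Set (JetIndex n d₁ d₂)),
      (p → (n : ℝ) / 2 < a ∧ 0 ≤ b ∧ b ≤ a ∧ (∀ x ∉ Z, x ∉ B → HasCoord n r d₁ d₂ m s a x) ∧
        (∀ x ∉ Z, HasCoord n r d₁ d₂ m s b x)) →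
      ∃ Q : ℝ, 0 < Q ∧ (p → ∀ (N : FormalMultilinearSeries ℝ (JetSpace n d₁ d₂) (Target d₁ d₂))
        (i : Fin d₁ ⊕ Fin d₂), IsSymmetricSeries N → N 0 = 0 →
        (∀ k α, jetCoeff N i k α ≠ 0 → countIn Z α = 0) →
        (∀ k α, jetCoeff N i k α ≠ 0 → countIn B α ≤ 1) →
        ∃ hb : 0 ≤ b, IsComponentAnalytic r m s hb Q N i) := by
    intro p a b Z B h
    by_cases hp : p
    · obtain ⟨h1, h2, h3, h4, h5⟩ := h hp
      obtain ⟨Q, hQ, h6⟩ := exists_component h1 h2 h3 Z B h4 h5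
      exact ⟨Q, hQ, fun _ N i e1 e2 e3 e4 => ⟨h2, h6 N i e1 e2 e3 e4⟩⟩
    · exact ⟨1, one_pos, fun h => absurd h hp⟩
  have h0 : ∀ (N : FormalMultilinearSeries ℝ (JetSpace n d₁ d₂) (Target d₁ d₂))
      (i : Fin d₁ ⊕ Fin d₂) k α, jetCoeff N i k α ≠ 0 →
      countIn (∅ : Set (JetIndex n d₁ d₂)) α = 0 := fun N i k α _ => countIn_empty α
  have h1 : ∀ (N : FormalMultilinearSeries ℝ (JetSpace n d₁ d₂) (Target d₁ d₂))
      (i : Fin d₁ ⊕ Fin d₂) k α, jetCoeff N i k α ≠ 0 →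
      countIn (∅ : Set (JetIndex n d₁ d₂)) α ≤ 1 := fun N i k α _ => by simp [countIn_empty]
  -- No derivatives: the algebra H^s. This serves N₁ in all cases, and N₂ in the first.
  obtain ⟨Q₀, hQ₀, H₀⟩ := key ((n : ℝ) / 2 < s) s s (derivIndices n d₁ d₂) ∅ fun h =>
    ⟨h, by linarith, le_rfl, fun x hx _ => hasCoord_of_notMem_derivIndices hx,
      fun x hx => hasCoord_of_notMem_derivIndices hx⟩
  -- At most one derivative factor, taken in H^(s-r), multiplied by functions of H^s.
  obtain ⟨Q₂, hQ₂, H₂⟩ := key ((n : ℝ) / 2 < s ∧ 0 ≤ s - r) s (s - r) ∅ (derivIndices n d₁ d₂)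
    fun h => ⟨h.1, h.2, by linarith, fun x _ hx => hasCoord_of_notMem_derivIndices hx,
      fun x _ => hasCoord_all hr x⟩
  -- For s - r > n/2 all coordinates lie in the algebra H^(s-r).
  obtain ⟨Q₃, hQ₃, H₃⟩ := key ((n : ℝ) / 2 < s - r) (s - r) (s - r) ∅ ∅
    fun h => ⟨h, by linarith, le_rfl, fun x _ _ => hasCoord_all hr x,
      fun x _ => hasCoord_all hr x⟩
  -- At most one factor ∂₀u₂, in H^(s-r); u and its spatial derivatives lie in H^(s-1), where s - 1
  -- > n/2.
  obtain ⟨Q₄, hQ₄, H₄⟩ := key ((n : ℝ) / 2 + 1 < s ∧ 0 ≤ s - r) (s - 1) (s - r) ∅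
    (timeIndices n d₁ d₂)
    fun h => ⟨by linarith [h.1], h.2, by linarith,
      fun x _ hx => hasCoord_of_notMem_timeIndices x hx, fun x _ => hasCoord_all hr x⟩
  -- Without ∂₀u₂, everything happens in the algebra H^(s-1), and s - 1 ≥ s - r.
  obtain ⟨Q₅, hQ₅, H₅⟩ := key ((n : ℝ) / 2 + 1 < s) (s - 1) (s - 1) (timeIndices n d₁ d₂) ∅
    fun h => ⟨by linarith, by linarith, le_rfl,
      fun x hx _ => hasCoord_of_notMem_timeIndices x hx,
      fun x hx => hasCoord_of_notMem_timeIndices x hx⟩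
  refine ⟨Q₀ + Q₂ + Q₃ + Q₄ + Q₅, by positivity, fun N hN hrad hN0 hN1 hcase => ?_⟩
  have hs : (n : ℝ) / 2 < s := by
    rcases hcase with ⟨-, h⟩ | ⟨-, h, -⟩ | ⟨h, -⟩ <;> linarith
  have hs0 : 0 ≤ s := by linarith
  have hfirst : ∀ i : Fin d₁,
      IsComponentAnalytic r m s hs0 (Q₀ + Q₂ + Q₃ + Q₄ + Q₅) N (Sum.inl i) := fun i =>
    (H₀ hs N (Sum.inl i) hN hN0 (hN1.countIn_eq_zero hN i) (h1 N _)).2.mono hQ₀ (by linarith)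
  rcases hcase with ⟨h, -⟩ | ⟨h, -, -, hsr⟩ | ⟨hs1, h | ⟨hsr, h⟩ | h⟩
  · exact ⟨s, hs0, hs0, by linarith, hfirst, fun j =>
      (H₀ hs N (Sum.inr j) hN hN0 (h.countIn_eq_zero hN j) (h1 N _)).2.mono hQ₀ (by linarith)⟩
  · exact ⟨s - r, hsr, hs0, le_rfl, hfirst, fun j =>
      (H₂ ⟨hs, hsr⟩ N (Sum.inr j) hN hN0 (h0 N _) (h.countIn_le_one hN hrad j)).2.mono hQ₂
        (by linarith)⟩
  · exact ⟨s - r, by linarith, hs0, le_rfl, hfirst, fun j =>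
      (H₃ h N (Sum.inr j) hN hN0 (h0 N _) (h1 N _)).2.mono hQ₃ (by linarith)⟩
  · exact ⟨s - r, hsr, hs0, le_rfl, hfirst, fun j =>
      (H₄ ⟨hs1, hsr⟩ N (Sum.inr j) hN hN0 (h0 N _) (h.countIn_le_one hN hrad j)).2.mono hQ₄
        (by linarith)⟩
  · exact ⟨s - 1, by linarith, hs0, by linarith, hfirst, fun j =>
      (H₅ hs1 N (Sum.inr j) hN hN0 (h.countIn_eq_zero hN j) (h1 N _)).2.mono hQ₅ (by linarith)⟩

end Nonlinearity

end

/-! ### Matrix exponentials, the propagator and conservation of energy. -/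

section

section MatrixExp

variable {ι : Type} [Fintype ι] [DecidableEq ι]

open scoped Matrix.Norms.Operator in
theorem continuous_exp_matrix :
    Continuous (fun A : Matrix ι ι ℂ => NormedSpace.exp A) :=
  NormedSpace.exp_continuous (𝔸 := Matrix ι ι ℂ)

open scoped Matrix.Norms.Operator in
/-- Conservation of energy: if `AᴴH + HA = 0`, then the flow `exp(τA)` preserves `H`. -/
theorem exp_conjTranspose_mul_mul_exp {A H : Matrix ι ι ℂ}
    (h : A.conjTranspose * H + H * A = 0) (τ : ℝ) :
    (NormedSpace.exp ((τ : ℂ) • A)).conjTranspose * H * NormedSpace.exp ((τ : ℂ) • A) = H := by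
  -- The factor exp(uAᴴ) replaces the adjoint of exp(uA) so that the expression is holomorphic in u;
  -- for real u the two agree.
  have hd : ∀ u : ℂ, HasDerivAt (fun u : ℂ => NormedSpace.exp (u • A.conjTranspose) * H *
      NormedSpace.exp (u • A)) 0 u := by
    intro u
    have h1 : HasDerivAt (fun u : ℂ => NormedSpace.exp (u • A.conjTranspose))
      (NormedSpace.exp (u • A.conjTranspose) * A.conjTranspose) u :=
      hasDerivAt_exp_smul_const A.conjTranspose u
    have h2 : HasDerivAt (fun u : ℂ => NormedSpace.exp (u • A))
      (A * NormedSpace.exp (u • A)) u := hasDerivAt_exp_smul_const' A u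
    have h3 := (h1.mul_const H).mul h2
    have h4 : NormedSpace.exp (u • A.conjTranspose) * A.conjTranspose * H *
          NormedSpace.exp (u • A) +
        NormedSpace.exp (u • A.conjTranspose) * H * (A * NormedSpace.exp (u • A)) =
        NormedSpace.exp (u • A.conjTranspose) * (A.conjTranspose * H + H * A) *
          NormedSpace.exp (u • A) := by noncomm_ring
    rw [h4, h, mul_zero, zero_mul] at h3
    exact h3
  have h1 := is_const_of_deriv_eq_zero (fun u => (hd u).differentiableAt) (fun u => (hd u).deriv)
    (τ : ℂ) 0
  have h2 : (NormedSpace.exp ((τ : ℂ) • A)).conjTranspose =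
      NormedSpace.exp ((τ : ℂ) • A.conjTranspose) := by
    rw [← Matrix.exp_conjTranspose, Matrix.conjTranspose_smul]
    simp
  rw [h2]
  simpa using h1

theorem exp_map_conj (A : Matrix ι ι ℂ) :
    NormedSpace.exp (A.map (starRingEnd ℂ)) = (NormedSpace.exp A).map (starRingEnd ℂ) := by
  have h : ∀ B : Matrix ι ι ℂ, B.map (starRingEnd ℂ) = B.conjTranspose.transpose := fun B => rfl
  rw [h, h, Matrix.exp_transpose, Matrix.exp_conjTranspose]

theorem exp_add_smul (A : Matrix ι ι ℂ) (τ τ' : ℝ) :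
    NormedSpace.exp (((τ + τ' : ℝ) : ℂ) • A) =
      NormedSpace.exp ((τ : ℂ) • A) * NormedSpace.exp ((τ' : ℂ) • A) := by
  rw [Complex.ofReal_add, add_smul]
  exact Matrix.exp_add_of_commute _ _ ((Commute.refl A).smul_left _ |>.smul_right _)

end MatrixExp

section Generator

variable {n r d₁ d₂ : ℕ}

/-- The generator of the `E₁`-part of the evolution. -/
def gen₁ (L : LinOp n r d₁ d₂) (ξ : Sp n) : Matrix (Fin d₁) (Fin d₁) ℂ :=
  -((L.γ.map Complex.ofReal)⁻¹ * symbolMat L.P₁ ξ)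

/-- The generator of the `E₂`-part of the evolution, as a first-order system. -/
def gen₂ (L : LinOp n r d₁ d₂) (ξ : Sp n) : Matrix (Fin d₂ ⊕ Fin d₂) (Fin d₂ ⊕ Fin d₂) ℂ :=
  Matrix.fromBlocks 0 1 (-symbolMat L.P₂ ξ) 0

/-- The index set of the components of the Cauchy data. -/
abbrev CauIndex (d₁ d₂ : ℕ) : Type := Fin d₁ ⊕ (Fin d₂ ⊕ Fin d₂)

/-- The generator of the evolution of Cauchy data. -/
def gen (L : LinOp n r d₁ d₂) (ξ : Sp n) : Matrix (CauIndex d₁ d₂) (CauIndex d₁ d₂) ℂ :=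
  Matrix.fromBlocks (gen₁ L ξ) 0 0 (gen₂ L ξ)

/-- The evolution of Cauchy data. -/
def propagator (L : LinOp n r d₁ d₂) (τ : ℝ) (ξ : Sp n) :
    Matrix (CauIndex d₁ d₂) (CauIndex d₁ d₂) ℂ :=
  Matrix.fromBlocks (NormedSpace.exp ((τ : ℂ) • gen₁ L ξ)) 0 0
    (NormedSpace.exp ((τ : ℂ) • gen₂ L ξ))

theorem propagator_add (L : LinOp n r d₁ d₂) (τ τ' : ℝ) (ξ : Sp n) :
    propagator L (τ + τ') ξ = propagator L τ ξ * propagator L τ' ξ := by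
  simp only [propagator, exp_add_smul, Matrix.fromBlocks_multiply]
  simp

theorem hasDerivAt_propagator (L : LinOp n r d₁ d₂) (τ : ℝ) (ξ : Sp n)
    (k l : CauIndex d₁ d₂) : HasDerivAt (fun τ => propagator L τ ξ k l)
      ((gen L ξ * propagator L τ ξ) k l) τ := by
  have e : gen L ξ * propagator L τ ξ = Matrix.fromBlocks
      (gen₁ L ξ * NormedSpace.exp ((τ : ℂ) • gen₁ L ξ)) 0 0
      (gen₂ L ξ * NormedSpace.exp ((τ : ℂ) • gen₂ L ξ)) := by
    simp [propagator, gen, Matrix.fromBlocks_multiply]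
  rw [e]
  rcases k with k | k <;> rcases l with l | l
  · exact hasDerivAt_exp_entry _ τ k l
  · exact hasDerivAt_const _ _
  · exact hasDerivAt_const _ _
  · exact hasDerivAt_exp_entry _ τ k l

theorem symbolMat_neg {d : ℕ} (P : Matrix (Fin d) (Fin d) (MvPolynomial (Fin n) ℝ)) (ξ : Sp n) :
    symbolMat P (-ξ) = (symbolMat P ξ).map (starRingEnd ℂ) := by
  ext i j
  exact symbol_neg _ _

theorem map_ofReal_inv {d : ℕ} {g : Matrix (Fin d) (Fin d) ℝ} (hg : IsUnit g) :
    (g.map Complex.ofReal)⁻¹ = g⁻¹.map Complex.ofReal := by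
  refine Matrix.inv_eq_right_inv ?_
  have h := Matrix.map_mul (L := g) (M := g⁻¹) (f := Complex.ofRealHom)
  have h2 : g * g⁻¹ = 1 := Matrix.mul_nonsing_inv _ ((Matrix.isUnit_iff_isUnit_det g).1 hg)
  rw [h2] at h
  refine h.symm.trans ?_
  ext i j
  simp [Matrix.one_apply]

theorem gen₁_neg (L : LinOp n r d₁ d₂) (ξ : Sp n) :
    gen₁ L (-ξ) = (gen₁ L ξ).map (starRingEnd ℂ) := by
  unfold gen₁
  rw [map_ofReal_inv L.isUnit_γ, symbolMat_neg]
  ext i j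
  simp [Matrix.mul_apply]

theorem gen₂_neg (L : LinOp n r d₁ d₂) (ξ : Sp n) :
    gen₂ L (-ξ) = (gen₂ L ξ).map (starRingEnd ℂ) := by
  unfold gen₂
  rw [symbolMat_neg, Matrix.fromBlocks_map]
  congr 1
  · ext; simp
  · ext i j
    simp [Matrix.one_apply]
  · ext; simp

theorem smul_map_conj {ι : Type*} (τ : ℝ) (A : Matrix ι ι ℂ) :
    (τ : ℂ) • A.map (starRingEnd ℂ) = ((τ : ℂ) • A).map (starRingEnd ℂ) := by
  ext; simp

/-- The coefficients of L are real. This symmetry makes the entries multipliers between spaces of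
real distributions. -/
theorem propagator_neg (L : LinOp n r d₁ d₂) (τ : ℝ) (ξ : Sp n) :
    propagator L τ (-ξ) = (propagator L τ ξ).map (starRingEnd ℂ) := by
  unfold propagator
  rw [gen₁_neg, gen₂_neg, smul_map_conj, smul_map_conj, exp_map_conj, exp_map_conj,
    Matrix.fromBlocks_map]
  congr 1 <;> · ext; simp

theorem continuous_symbolMat {d : ℕ} (P : Matrix (Fin d) (Fin d) (MvPolynomial (Fin n) ℝ)) :
    Continuous (symbolMat P) :=
  continuous_matrix fun i j => continuous_symbol (P i j)

theorem continuous_gen₁ (L : LinOp n r d₁ d₂) : Continuous (gen₁ L) :=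
  (continuous_const.matrix_mul (continuous_symbolMat L.P₁)).neg

theorem continuous_gen₂ (L : LinOp n r d₁ d₂) : Continuous (gen₂ L) :=
  continuous_const.matrix_fromBlocks continuous_const (continuous_symbolMat L.P₂).neg
    continuous_const

theorem continuous_propagator (L : LinOp n r d₁ d₂) (τ : ℝ) : Continuous (propagator L τ) :=
  have h : Continuous fun ξ => (τ : ℂ) • gen₂ L ξ := (continuous_const_smul (τ : ℂ)).comp (continuous_gen₂ L)
  have h' : Continuous fun ξ => (τ : ℂ) • gen₁ L ξ := (continuous_const_smul (τ : ℂ)).comp (continuous_gen₁ L)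
  Continuous.matrix_fromBlocks
    (continuous_exp_matrix.comp h') continuous_const
    continuous_const (continuous_exp_matrix.comp h)

theorem greenHat₁_eq (L : LinOp n r d₁ d₂) (τ : ℝ) (ξ : Sp n) :
    greenHat₁ L τ ξ = NormedSpace.exp ((τ : ℂ) • gen₁ L ξ) * (L.γ.map Complex.ofReal)⁻¹ := by
  rw [greenHat₁, gen₁, smul_neg, neg_smul]

theorem greenHat₂_eq (L : LinOp n r d₁ d₂) (τ : ℝ) (ξ : Sp n) :
    greenHat₂ L τ ξ = (NormedSpace.exp ((τ : ℂ) • gen₂ L ξ)).toBlocks₁₂ := rfl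

/-- The `E₁`-part of the evolution is unitary. -/
theorem norm_exp_gen₁_le (L : LinOp n r d₁ d₂) (τ : ℝ) (ξ : Sp n) (k l : Fin d₁) :
    ‖NormedSpace.exp ((τ : ℂ) • gen₁ L ξ) k l‖ ≤ 1 := by
  set A := gen₁ L ξ with hA
  have hH := L.hermitian ξ
  -- The hypothesis that i(γ⁰)⁻¹P₁ is Hermitian says that A is skew-Hermitian, so the form H = 1 is
  -- conserved and each column of the exponential has norm 1.
  have h : A.conjTranspose * 1 + 1 * A = 0 := by
    have h1 : (-(Complex.I • A)).conjTranspose = -(Complex.I • A) := by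
      rw [hA, gen₁, smul_neg, neg_neg]
      exact hH
    rw [Matrix.conjTranspose_neg, Matrix.conjTranspose_smul, neg_inj] at h1
    have h2 : Complex.I • (A.conjTranspose + A) = 0 := by
      rw [smul_add, ← h1]
      simp
    rw [mul_one, one_mul]
    exact (smul_eq_zero.1 h2).resolve_left Complex.I_ne_zero
  have h1 := exp_conjTranspose_mul_mul_exp h τ
  set M := NormedSpace.exp ((τ : ℂ) • A)
  have h2 := congrFun (congrFun h1 l) l
  rw [mul_one, Matrix.mul_apply, Matrix.one_apply_eq] at h2
  simp only [Matrix.conjTranspose_apply, ← starRingEnd_apply, ← Complex.normSq_eq_conj_mul_self]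
    at h2
  have h3 : ∑ j, Complex.normSq (M j l) = 1 := by exact_mod_cast h2
  have h4 : Complex.normSq (M k l) ≤ 1 := by
    rw [← h3]
    exact Finset.single_le_sum (f := fun j => Complex.normSq (M j l))
      (fun j _ => Complex.normSq_nonneg _) (Finset.mem_univ k)
  rw [Complex.normSq_eq_norm_sq] at h4
  exact (sq_le_one_iff₀ (norm_nonneg _)).1 h4

open scoped ComplexOrder in
/-- Conservation of energy for the `E₂`-part of the evolution. -/
theorem energy_exp_gen₂ (L : LinOp n r d₁ d₂) (τ : ℝ) (ξ : Sp n) (l : Fin d₂ ⊕ Fin d₂) :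
    star (fun k => NormedSpace.exp ((τ : ℂ) • gen₂ L ξ) (Sum.inl k) l) ⬝ᵥ
        (Matrix.mulVec (symbolMat L.P₂ ξ)
          fun k => NormedSpace.exp ((τ : ℂ) • gen₂ L ξ) (Sum.inl k) l) +
      ((∑ k, ‖NormedSpace.exp ((τ : ℂ) • gen₂ L ξ) (Sum.inr k) l‖ ^ 2 : ℝ) : ℂ) =
    (Matrix.fromBlocks (symbolMat L.P₂ ξ) 0 0 1 :
      Matrix (Fin d₂ ⊕ Fin d₂) (Fin d₂ ⊕ Fin d₂) ℂ) l l := by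
  set P := symbolMat L.P₂ ξ with hP
  have hPH : P.conjTranspose = P := (L.positive ξ).1
  -- The conserved form is the energy diag(P₂, 1); the diagonal entry of the identity is the energy
  -- of the solution with the l-th basis vector as data.
  have h : (gen₂ L ξ).conjTranspose * Matrix.fromBlocks P 0 0 1 +
      Matrix.fromBlocks P 0 0 1 * gen₂ L ξ = 0 := by
    rw [gen₂, ← hP, Matrix.fromBlocks_conjTranspose, Matrix.fromBlocks_multiply,
      Matrix.fromBlocks_multiply, Matrix.fromBlocks_add]
    simp [hPH]
  have h1 := exp_conjTranspose_mul_mul_exp h τ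
  set M := NormedSpace.exp ((τ : ℂ) • gen₂ L ξ)
  rw [← congrFun (congrFun h1 l) l, Matrix.mul_assoc, Matrix.mul_apply, Fintype.sum_sum_type]
  congr 1
  · refine Finset.sum_congr rfl fun k _ => ?_
    rw [Matrix.mul_apply, Fintype.sum_sum_type]
    simp [Matrix.mulVec, dotProduct]
  · push_cast
    refine Finset.sum_congr rfl fun k _ => ?_
    rw [Matrix.mul_apply, Fintype.sum_sum_type]
    simp [Matrix.one_apply]
    exact (Complex.conj_mul' _).symm

-- Both parts of the energy are nonnegative, so each is at most the initial energy; the lower bound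
-- of P₂ turns the potential part into a bound of the amplitude.
open scoped ComplexOrder in
theorem energy_le (L : LinOp n r d₁ d₂) {α μ₀ : ℝ} (hα : 0 < α) (hμ : 0 ≤ μ₀)
    (hL : L.LowerBound α μ₀) (τ : ℝ) (ξ : Sp n) (l : Fin d₂ ⊕ Fin d₂) {h : ℝ}
    (hh : ‖(Matrix.fromBlocks (symbolMat L.P₂ ξ) 0 0 1 :
      Matrix (Fin d₂ ⊕ Fin d₂) (Fin d₂ ⊕ Fin d₂) ℂ) l l‖ ≤ h) (k : Fin d₂) :
    α * (μ₀ + ‖ξ‖ ^ (2 * r)) * ‖NormedSpace.exp ((τ : ℂ) • gen₂ L ξ) (Sum.inl k) l‖ ^ 2 ≤ h ∧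
      ‖NormedSpace.exp ((τ : ℂ) • gen₂ L ξ) (Sum.inr k) l‖ ^ 2 ≤ h := by
  have h1 := congrArg Complex.re (energy_exp_gen₂ L τ ξ l)
  set M := NormedSpace.exp ((τ : ℂ) • gen₂ L ξ)
  set P := symbolMat L.P₂ ξ with hP
  set a : Fin d₂ → ℂ := fun k => M (Sum.inl k) l with ha
  have hc0 : 0 ≤ α * (μ₀ + ‖ξ‖ ^ (2 * r)) := by positivity
  rw [Complex.add_re, Complex.ofReal_re] at h1
  have h2 := (Complex.re_le_norm _).trans hh
  rw [← h1] at h2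
  have h3 := (hL ξ).re_dotProduct_nonneg a
  generalize α * (μ₀ + ‖ξ‖ ^ (2 * r)) = c at *
  rw [Matrix.sub_mulVec, dotProduct_sub, Matrix.smul_mulVec, Matrix.one_mulVec] at h3
  have h4 : star a ⬝ᵥ (((c : ℝ) : ℂ) • a) = ((c * ∑ k, ‖a k‖ ^ 2 : ℝ) : ℂ) := by
    rw [dotProduct_smul, smul_eq_mul, Complex.ofReal_mul]
    congr 1
    simp only [dotProduct, Pi.star_apply, ← starRingEnd_apply,
      Complex.conj_mul']
    simp only [Complex.ofReal_sum, Complex.ofReal_pow]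
  rw [h4, map_sub] at h3
  simp only [RCLike.re_to_complex, Complex.ofReal_re] at h3
  have h5 : ‖a k‖ ^ 2 ≤ ∑ k, ‖a k‖ ^ 2 :=
    Finset.single_le_sum (f := fun k => ‖a k‖ ^ 2) (fun _ _ => by positivity) (Finset.mem_univ k)
  have h6 : ‖M (Sum.inr k) l‖ ^ 2 ≤ ∑ k, ‖M (Sum.inr k) l‖ ^ 2 :=
    Finset.single_le_sum (f := fun k => ‖M (Sum.inr k) l‖ ^ 2) (fun _ _ => by positivity)
      (Finset.mem_univ k)
  have h7 : c * ‖a k‖ ^ 2 ≤ c * ∑ k, ‖a k‖ ^ 2 := by gcongr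
  have h8 : 0 ≤ c * ‖a k‖ ^ 2 := by positivity
  have h9 : 0 ≤ ‖M (Sum.inr k) l‖ ^ 2 := by positivity
  constructor
  · change c * ‖a k‖ ^ 2 ≤ h
    linarith
  · linarith

end Generator

end

/-! ### Uniform bounds of the propagator in weighted norms. -/

section

section Bounds

variable {n r d₁ d₂ : ℕ} {m s : ℝ}

theorem bracket_pow_le (m : ℝ) (r : ℕ) (ξ : Sp n) :
    (bracket m ξ ^ r) ^ 2 ≤ 2 ^ r * ((m ^ r) ^ 2 + ‖ξ‖ ^ (2 * r)) := by
  have h : (m ^ 2 + ‖ξ‖ ^ 2) ^ r ≤ 2 ^ (r - 1) * ((m ^ 2) ^ r + (‖ξ‖ ^ 2) ^ r) :=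
    add_pow_le (by positivity) (by positivity) r
  have h2 : (2 : ℝ) ^ (r - 1) ≤ 2 ^ r := pow_le_pow_right₀ one_le_two (Nat.sub_le r 1)
  calc (bracket m ξ ^ r) ^ 2 = (m ^ 2 + ‖ξ‖ ^ 2) ^ r := by
        rw [← bracket_sq, ← pow_mul, ← pow_mul, mul_comm]
    _ ≤ _ := h
    _ ≤ 2 ^ r * ((m ^ 2) ^ r + (‖ξ‖ ^ 2) ^ r) := by gcongr
    _ = _ := by rw [← pow_mul, ← pow_mul, ← pow_mul, mul_comm 2 r]

/-- The amplitude is the initial value plus the time integral of the velocity. This replaces the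
energy bound where P₂ may degenerate. -/
theorem norm_exp_gen₂_inl_le {L : LinOp n r d₁ d₂} {τ : ℝ} {ξ : Sp n} {l : Fin d₂ ⊕ Fin d₂} {g : ℝ}
    (hg : ∀ (τ : ℝ) k, ‖NormedSpace.exp ((τ : ℂ) • gen₂ L ξ) (Sum.inr k) l‖ ≤ g) (k : Fin d₂) :
    ‖NormedSpace.exp ((τ : ℂ) • gen₂ L ξ) (Sum.inl k) l‖ ≤
      ‖(1 : Matrix (Fin d₂ ⊕ Fin d₂) (Fin d₂ ⊕ Fin d₂) ℂ) (Sum.inl k) l‖ + |τ| * g := by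
  have hd : ∀ τ : ℝ, HasDerivAt (fun τ : ℝ => NormedSpace.exp ((τ : ℂ) • gen₂ L ξ) (Sum.inl k) l)
      (NormedSpace.exp ((τ : ℂ) • gen₂ L ξ) (Sum.inr k) l) τ := by
    intro τ
    have h := hasDerivAt_exp_entry (gen₂ L ξ) τ (Sum.inl k) l
    have e : (gen₂ L ξ * NormedSpace.exp ((τ : ℂ) • gen₂ L ξ)) (Sum.inl k) l =
        NormedSpace.exp ((τ : ℂ) • gen₂ L ξ) (Sum.inr k) l := by
      rw [Matrix.mul_apply, Fintype.sum_sum_type]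
      simp [gen₂, Matrix.one_apply]
    rwa [e] at h
  have h1 := convex_univ.norm_image_sub_le_of_norm_hasDerivWithin_le (x := 0) (y := τ)
    (fun τ _ => (hd τ).hasDerivWithinAt) (fun τ _ => hg τ k) (mem_univ _) (mem_univ _)
  simp only [Complex.ofReal_zero, zero_smul, NormedSpace.exp_zero, sub_zero, Real.norm_eq_abs]
    at h1
  linarith [norm_le_norm_add_norm_sub' (NormedSpace.exp ((τ : ℂ) • gen₂ L ξ) (Sum.inl k) l)
    ((1 : Matrix (Fin d₂ ⊕ Fin d₂) (Fin d₂ ⊕ Fin d₂) ℂ) (Sum.inl k) l)]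

/-- The entries of the evolution of the `E₂`-part, with respect to the weights `⟨ξ⟩^r` and `1`. -/
theorem exists_exp_gen₂_bound (hm : 0 < m) (L : LinOp n r d₁ d₂) {α μ₀ : ℝ} (hα : 0 < α)
    (hμ : 0 ≤ μ₀) (hL : L.LowerBound α μ₀) :
    ∃ C D : ℝ, 0 ≤ C ∧ 0 ≤ D ∧ (0 < μ₀ → D = 0) ∧ ∀ (τ : ℝ) (ξ : Sp n) (k : Fin d₂)
      (l : Fin d₂ ⊕ Fin d₂),
      bracket m ξ ^ r * ‖NormedSpace.exp ((τ : ℂ) • gen₂ L ξ) (Sum.inl k) l‖ ≤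
        (C + D * |τ|) * Sum.elim (fun _ => bracket m ξ ^ r) (fun _ => 1) l ∧
      ‖NormedSpace.exp ((τ : ℂ) • gen₂ L ξ) (Sum.inr k) l‖ ≤
        (C + D * |τ|) * Sum.elim (fun _ => bracket m ξ ^ r) (fun _ => 1) l := by
  -- The initial energy is P₂(iξ)_{ll}, of order ⟨ξ⟩^(2r), for a displacement and 1 for a velocity.
  -- With C ≥ 1 both are at most (C G)², where G is ⟨ξ⟩^r or 1.
  have hP : ∃ C : ℝ, 1 ≤ C ∧ ∀ (ξ : Sp n) (l : Fin d₂),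
      ‖symbolMat L.P₂ ξ l l‖ ≤ C ^ 2 * (bracket m ξ ^ r) ^ 2 := by
    choose C hC0 hC using fun l => exists_norm_symbol_le hm (L.P₂ l l) (L.degree_P₂ l l)
    refine ⟨∑ l, C l + 1, by have := Finset.sum_nonneg fun l (_ : l ∈ Finset.univ) => hC0 l; linarith,
      fun ξ l => ?_⟩
    have h0 := Finset.sum_nonneg fun l (_ : l ∈ Finset.univ) => hC0 l
    have h1 : C l ≤ ∑ l, C l := Finset.single_le_sum (fun l _ => hC0 l) (Finset.mem_univ l)
    have hb := bracket_pos hm ξ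
    refine (hC l ξ).trans ?_
    rw [pow_mul, ← pow_mul, mul_comm, pow_mul (bracket m ξ), mul_comm, ← pow_mul, ← pow_mul,
      mul_comm r 2]
    gcongr
    nlinarith
  obtain ⟨C, hC, hP⟩ := hP
  set G : Sp n → Fin d₂ ⊕ Fin d₂ → ℝ := fun ξ l =>
    Sum.elim (fun _ => bracket m ξ ^ r) (fun _ => 1) l with hG
  have hG0 : ∀ ξ l, 0 < G ξ l := by
    intro ξ l
    have := bracket_pos hm ξ
    rcases l with l | l
    · change 0 < bracket m ξ ^ r
      positivity
    · exact one_pos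
  have hE := fun (τ : ℝ) (ξ : Sp n) (l : Fin d₂ ⊕ Fin d₂) => energy_le L hα hμ hL τ ξ l
    (h := (C * G ξ l) ^ 2) (by
      rcases l with l | l
      · refine (hP ξ l).trans (le_of_eq ?_)
        simp only [hG, Sum.elim_inl]
        ring
      · simp only [hG, Sum.elim_inr, Matrix.fromBlocks_apply₂₂, Matrix.one_apply_eq, norm_one]
        nlinarith)
  have hb : ∀ (τ : ℝ) (ξ : Sp n) (k : Fin d₂) l,
      ‖NormedSpace.exp ((τ : ℂ) • gen₂ L ξ) (Sum.inr k) l‖ ≤ C * G ξ l := fun τ ξ k l =>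
    le_of_sq_le_sq (hE τ ξ l k).2 (by have := hG0 ξ l; positivity)
  have ha : ∀ (c : ℝ), 0 ≤ c → ∀ (τ : ℝ) (ξ : Sp n) (k : Fin d₂) l,
      (bracket m ξ ^ r) ^ 2 ≤ c ^ 2 * (α * (μ₀ + ‖ξ‖ ^ (2 * r))) →
      bracket m ξ ^ r * ‖NormedSpace.exp ((τ : ℂ) • gen₂ L ξ) (Sum.inl k) l‖ ≤ c * C * G ξ l := by
    intro c hc τ ξ k l h
    refine le_of_sq_le_sq ?_ (by have := hG0 ξ l; positivity)
    calc (bracket m ξ ^ r * ‖NormedSpace.exp ((τ : ℂ) • gen₂ L ξ) (Sum.inl k) l‖) ^ 2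
        = (bracket m ξ ^ r) ^ 2 * ‖NormedSpace.exp ((τ : ℂ) • gen₂ L ξ) (Sum.inl k) l‖ ^ 2 :=
          mul_pow _ _ _
      _ ≤ c ^ 2 * (α * (μ₀ + ‖ξ‖ ^ (2 * r))) *
            ‖NormedSpace.exp ((τ : ℂ) • gen₂ L ξ) (Sum.inl k) l‖ ^ 2 := by gcongr
      _ ≤ c ^ 2 * (C * G ξ l) ^ 2 := by
          rw [mul_assoc]
          gcongr
          exact (hE τ ξ l k).1
      _ = _ := by ring
  rcases hμ.eq_or_lt with hμ0 | hμ0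
  · subst hμ0
    -- For μ₀ = 0 the energy bounds the amplitude only where |ξ| ≥ m, with this c. For |ξ| ≤ m one
    -- has ⟨ξ⟩^r ≤ W, and integrating the velocity gives growth at the rate W C.
    set c := Real.sqrt (2 ^ r * 2 / α) with hc
    have hc2 : c ^ 2 = 2 ^ r * 2 / α := Real.sq_sqrt (by positivity)
    have hc0 : 0 ≤ c := Real.sqrt_nonneg _
    set W := Real.sqrt (2 ^ r * (2 * (m ^ r) ^ 2)) with hW
    have hW2 : W ^ 2 = 2 ^ r * (2 * (m ^ r) ^ 2) := Real.sq_sqrt (by positivity)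
    have hW0 : 0 ≤ W := Real.sqrt_nonneg _
    refine ⟨c * C + C + 1, W * C, by positivity, by positivity, fun h => absurd h (lt_irrefl _),
      fun τ ξ k l => ⟨?_, ?_⟩⟩
    · have hg := hG0 ξ l
      change _ ≤ _ * G ξ l
      have hτ := abs_nonneg τ
      rcases le_total ‖ξ‖ m with h | h
      · have h1 : ‖ξ‖ ^ (2 * r) ≤ (m ^ r) ^ 2 := by
          rw [← pow_mul, mul_comm r 2]
          gcongr
        have h2 : bracket m ξ ^ r ≤ W := by
          refine le_of_sq_le_sq ((bracket_pow_le m r ξ).trans ?_) hW0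
          rw [hW2]
          calc _ ≤ 2 ^ r * ((m ^ r) ^ 2 + (m ^ r) ^ 2) := by gcongr
            _ = _ := by ring
        have h3 := norm_exp_gen₂_inl_le (L := L) (τ := τ) (ξ := ξ) (l := l) (g := C * G ξ l)
          (fun τ k => hb τ ξ k l) k
        have hbr := pow_pos (bracket_pos hm ξ) r
        have h4 : bracket m ξ ^ r *
            ‖(1 : Matrix (Fin d₂ ⊕ Fin d₂) (Fin d₂ ⊕ Fin d₂) ℂ) (Sum.inl k) l‖ ≤ G ξ l := by
          rcases l with l | l
          · refine mul_le_of_le_one_right hbr.le ?_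
            rw [Matrix.one_apply]
            split_ifs <;> simp
          · simp [hG]
        calc _ ≤ bracket m ξ ^ r *
              (‖(1 : Matrix (Fin d₂ ⊕ Fin d₂) (Fin d₂ ⊕ Fin d₂) ℂ) (Sum.inl k) l‖ +
                |τ| * (C * G ξ l)) := by gcongr
          _ = bracket m ξ ^ r *
              ‖(1 : Matrix (Fin d₂ ⊕ Fin d₂) (Fin d₂ ⊕ Fin d₂) ℂ) (Sum.inl k) l‖ +
                bracket m ξ ^ r * (|τ| * (C * G ξ l)) := mul_add _ _ _
          _ ≤ G ξ l + W * (|τ| * (C * G ξ l)) := by gcongr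
          _ = (1 + W * C * |τ|) * G ξ l := by ring
          _ ≤ _ := by
            gcongr
            have : 0 ≤ c * C := by positivity
            linarith
      · refine (ha c hc0 τ ξ k l ?_).trans ?_
        · rw [hc2]
          refine (bracket_pow_le m r ξ).trans ?_
          have h1 : (m ^ r) ^ 2 ≤ ‖ξ‖ ^ (2 * r) := by
            rw [← pow_mul, mul_comm r 2]
            gcongr
          calc _ ≤ 2 ^ r * (‖ξ‖ ^ (2 * r) + ‖ξ‖ ^ (2 * r)) := by gcongr
            _ = _ := by field_simp; ring
        · gcongr
          have : 0 ≤ W * C * |τ| := by positivity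
          linarith
    · have hg := hG0 ξ l
      refine (hb τ ξ k l).trans ?_
      change _ ≤ _ * G ξ l
      gcongr
      have : 0 ≤ W * C * |τ| := by positivity
      have : 0 ≤ c * C := by positivity
      linarith
  -- For μ₀ > 0 the quantity α(μ₀ + |ξ|^(2r)) dominates ⟨ξ⟩^(2r) at all frequencies, with this c. No
  -- growth in time arises, so D = 0.
  · set c := Real.sqrt (2 ^ r * ((m ^ r) ^ 2 / μ₀ + 1) / α) with hc
    have hc2 : c ^ 2 = 2 ^ r * ((m ^ r) ^ 2 / μ₀ + 1) / α := Real.sq_sqrt (by positivity)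
    have hc0 : 0 ≤ c := Real.sqrt_nonneg _
    refine ⟨c * C + C, 0, by positivity, le_rfl, fun _ => rfl, fun τ ξ k l => ⟨?_, ?_⟩⟩
    · have hg := hG0 ξ l
      refine (ha c hc0 τ ξ k l ?_).trans ?_
      · rw [hc2]
        refine (bracket_pow_le m r ξ).trans ?_
        have e : 2 ^ r * ((m ^ r) ^ 2 / μ₀ + 1) / α * (α * (μ₀ + ‖ξ‖ ^ (2 * r))) =
            2 ^ r * ((m ^ r) ^ 2 + ‖ξ‖ ^ (2 * r) + (m ^ r) ^ 2 / μ₀ * ‖ξ‖ ^ (2 * r) + μ₀) := by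
          field_simp
          ring
        rw [e]
        refine mul_le_mul_of_nonneg_left ?_ (by positivity)
        have : 0 ≤ (m ^ r) ^ 2 / μ₀ * ‖ξ‖ ^ (2 * r) := by positivity
        linarith
      · change _ ≤ _ * G ξ l
        gcongr
        simp
        linarith
    · have hg := hG0 ξ l
      refine (hb τ ξ k l).trans ?_
      change _ ≤ _ * G ξ l
      gcongr
      have : 0 ≤ c * C := by positivity
      linarith

/-- The Sobolev exponents of the components of the Cauchy data. -/
def cauExp (r : ℕ) (s : ℝ) : CauIndex d₁ d₂ → ℝ
  | Sum.inl _ => s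
  | Sum.inr (Sum.inl _) => s
  | Sum.inr (Sum.inr _) => s - r

/-- The factors ⟨ξ⟩^r of the energy bounds are exactly the ratio of the weights of exponents s and s
- r. The added 1 in the constant covers the unitary block. -/
theorem exists_isMultiplier_propagator (s : ℝ) [hm : Fact (0 < m)] (L : LinOp n r d₁ d₂)
    {α μ₀ : ℝ} (hα : 0 < α) (hμ : 0 ≤ μ₀) (hL : L.LowerBound α μ₀) :
    ∃ C D : ℝ, 0 ≤ C ∧ 0 ≤ D ∧ (0 < μ₀ → D = 0) ∧ ∀ (τ : ℝ) (k l : CauIndex d₁ d₂),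
      IsMultiplier n m (cauExp r s l) (cauExp r s k)
        (fun η => propagator L τ ((2 * Real.pi) • η) k l) (C + D * |τ|) := by
  obtain ⟨C, D, hC, hD, hμD, h⟩ := exists_exp_gen₂_bound hm.out L hα hμ hL
  refine ⟨C + 1, D, by positivity, hD, hμD, fun τ k l => ⟨?_, fun η => ?_, fun η => ?_⟩⟩
  · have h1 : Continuous fun η : Sp n => propagator L τ ((2 * Real.pi) • η) :=
      (continuous_propagator L τ).comp (continuous_const_smul (2 * Real.pi))
    exact (h1.matrix_elem k l).aestronglyMeasurable
  · rw [smul_neg, propagator_neg]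
    rfl
  · have hw := weight_pos n hm.out (s - r) η
    have e := weight_add_natCast hm.out (s - r) r η
    rw [sub_add_cancel] at e
    have hw' := weight_pos n hm.out s η
    have hτ := abs_nonneg τ
    rcases k with k | k
    · rcases l with l | l
      · change weight n m s η * ‖NormedSpace.exp ((τ : ℂ) • gen₁ L _) k l‖ ≤ _ * weight n m s η
        rw [mul_comm]
        gcongr
        refine (norm_exp_gen₁_le L τ _ k l).trans ?_
        have : 0 ≤ D * |τ| := by positivity
        linarith
      · have e0 : propagator L τ ((2 * Real.pi) • η) (Sum.inl k) (Sum.inr l) = 0 := rfl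
        rw [e0, norm_zero, mul_zero]
        have := (weight_pos n hm.out (cauExp (d₁ := d₁) r s (Sum.inr l)) η).le
        positivity
    · rcases l with l | l
      · have e0 : propagator L τ ((2 * Real.pi) • η) (Sum.inr k) (Sum.inl l) = 0 := rfl
        rw [e0, norm_zero, mul_zero]
        have := (weight_pos n hm.out (cauExp (d₁ := d₁) (d₂ := d₂) r s (Sum.inl l)) η).le
        positivity
      · have e1 : weight n m (cauExp (d₁ := d₁) r s (Sum.inr l)) η = weight n m (s - r) η *
            Sum.elim (fun _ => bracket m ((2 * Real.pi) • η) ^ r) (fun _ => 1) l := by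
          rcases l with l | l
          · exact e
          · exact (mul_one _).symm
        have e2 : (C + D * |τ|) * weight n m (cauExp (d₁ := d₁) r s (Sum.inr l)) η ≤
            (C + 1 + D * |τ|) * weight n m (cauExp (d₁ := d₁) r s (Sum.inr l)) η := by
          have := (weight_pos n hm.out (cauExp (d₁ := d₁) r s (Sum.inr l)) η).le
          gcongr
          linarith
        refine le_trans ?_ e2
        rw [e1]
        rcases k with k | k
        · have h1 := (h τ ((2 * Real.pi) • η) k l).1
          change weight n m s η * ‖NormedSpace.exp ((τ : ℂ) • gen₂ L _) (Sum.inl k) l‖ ≤ _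
          rw [e, mul_assoc, mul_left_comm (C + D * |τ|)]
          gcongr
        · have h1 := (h τ ((2 * Real.pi) • η) k l).2
          change weight n m (s - r) η * ‖NormedSpace.exp ((τ : ℂ) • gen₂ L _) (Sum.inr k) l‖ ≤ _
          rw [mul_left_comm (C + D * |τ|)]
          gcongr

end Bounds

end

/-! ### Calculus of multipliers. -/

section

namespace IsMultiplier

variable {n : ℕ} {m s s' s'' : ℝ} [hm : Fact (0 < m)] {μ ν : Sp n → ℂ} {B B' : ℝ}

theorem zero : IsMultiplier n m s s' (fun _ => 0) 0 where
  meas := aestronglyMeasurable_const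
  symm _ := by simp
  bound η := by simp

theorem add (h : IsMultiplier n m s s' μ B) (h' : IsMultiplier n m s s' ν B') :
    IsMultiplier n m s s' (fun η => μ η + ν η) (B + B') where
  meas := h.meas.add h'.meas
  symm η := by rw [h.symm, h'.symm, map_add]
  bound η := by
    have := (weight_pos n hm.out s' η).le
    calc _ ≤ weight n m s' η * (‖μ η‖ + ‖ν η‖) := by gcongr; exact norm_add_le _ _
      _ ≤ _ := by linarith [h.bound η, h'.bound η]

theorem const_mul (c : ℝ) (h : IsMultiplier n m s s' μ B) :
    IsMultiplier n m s s' (fun η => (c : ℂ) * μ η) (|c| * B) where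
  meas := h.meas.const_mul _
  symm η := by rw [h.symm, map_mul, Complex.conj_ofReal]
  bound η := by
    rw [norm_mul, Complex.norm_real, Real.norm_eq_abs, mul_left_comm, mul_assoc]
    exact mul_le_mul_of_nonneg_left (h.bound η) (abs_nonneg c)

theorem sum {ι : Type*} (t : Finset ι) {μ : ι → Sp n → ℂ} {B : ι → ℝ}
    (h : ∀ i, IsMultiplier n m s s' (μ i) (B i)) :
    IsMultiplier n m s s' (fun η => ∑ i ∈ t, μ i η) (∑ i ∈ t, B i) := by
  classical
  induction t using Finset.induction_on with
  | empty => simpa using zero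
  | insert i t hi ih =>
    simp only [Finset.sum_insert hi]
    exact (h i).add ih

theorem comp (h' : IsMultiplier n m s' s'' ν B') (h : IsMultiplier n m s s' μ B) :
    IsMultiplier n m s s'' (fun η => ν η * μ η) (B' * B) where
  meas := h'.meas.mul h.meas
  symm η := by rw [h.symm, h'.symm, map_mul]
  bound η := by
    rw [norm_mul, ← mul_assoc]
    calc _ ≤ B' * weight n m s' η * ‖μ η‖ :=
          mul_le_mul_of_nonneg_right (h'.bound η) (norm_nonneg _)
      _ = B' * (weight n m s' η * ‖μ η‖) := mul_assoc _ _ _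
      _ ≤ B' * (B * weight n m s η) := mul_le_mul_of_nonneg_left (h.bound η) h'.nonneg
      _ = _ := by ring

theorem congr (h : IsMultiplier n m s s' μ B) (e : ∀ η, μ η = ν η) :
    IsMultiplier n m s s' ν B := by
  rwa [← funext e]

end IsMultiplier

/-! ### Differential operators on the Fourier side. -/

section PolyDiff

variable {n : ℕ} {m s s' : ℝ}

/-- The Fourier transform of `T` is the function `h`, which is integrable against test
functions. -/
def HasTemperateHat (T : 𝓢'(Sp n, ℂ)) (h : Sp n → ℂ) : Prop :=
  HasHat T h ∧ ∀ f : 𝓢(Sp n, ℂ), Integrable fun η => f η * h η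

theorem sum_schwartz_apply {ι : Type*} (t : Finset ι) (g : ι → 𝓢'(Sp n, ℂ)) (f : 𝓢(Sp n, ℂ)) :
    (∑ a ∈ t, g a) f = ∑ a ∈ t, g a f := by
  classical
  induction t using Finset.induction_on with
  | empty => rfl
  | insert a t ha ih => rw [Finset.sum_insert ha, Finset.sum_insert ha, ← ih]; rfl

theorem HasTemperateHat.lineDeriv {T : 𝓢'(Sp n, ℂ)} {h : Sp n → ℂ} (H : HasTemperateHat T h)
    (l : Fin n) : HasTemperateHat (∂_{EuclideanSpace.single l (1 : ℝ)} T)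
      (fun η => Complex.I * (((2 * Real.pi) • η) l : ℂ) * h η) := by
  refine ⟨H.1.lineDeriv l, fun f => ?_⟩
  have hg : (fun η : Sp n =>
      (((EuclideanSpace.proj l : Sp n →L[ℝ] ℝ) η : ℝ) : ℂ)).HasTemperateGrowth :=
    Function.HasTemperateGrowth.comp Function.Complex.hasTemperateGrowth_ofReal
      (EuclideanSpace.proj l : Sp n →L[ℝ] ℝ).hasTemperateGrowth
  refine ((H.2 (SchwartzMap.smulLeftCLM ℂ
    (fun η : Sp n => (((EuclideanSpace.proj l : Sp n →L[ℝ] ℝ) η : ℝ) : ℂ)) f)).const_mul (Complex.I * (2 * Real.pi))).congr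
    (ae_of_all _ fun η => ?_)
  simp only
  rw [SchwartzMap.smulLeftCLM_apply_apply hg]
  simp
  ring

theorem HasTemperateHat.lineDeriv_pow {T : 𝓢'(Sp n, ℂ)} {h : Sp n → ℂ}
    (H : HasTemperateHat T h) (l : Fin n) (k : ℕ) :
    HasTemperateHat (((LineDeriv.lineDerivOpCLM ℂ 𝓢'(Sp n, ℂ)
      (EuclideanSpace.single l (1 : ℝ))) ^ k) T)
      (fun η => (Complex.I * (((2 * Real.pi) • η) l : ℂ)) ^ k * h η) := by
  induction k with
  | zero => simpa using H
  | succ k ih =>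
    rw [pow_succ']
    have h1 := ih.lineDeriv l
    have e : (fun η : Sp n => Complex.I * (((2 * Real.pi) • η) l : ℂ) *
        ((Complex.I * (((2 * Real.pi) • η) l : ℂ)) ^ k * h η)) =
        fun η => (Complex.I * (((2 * Real.pi) • η) l : ℂ)) ^ (k + 1) * h η := by
      funext η
      ring
    rw [e] at h1
    exact h1

theorem HasTemperateHat.lineDeriv_prod {T : 𝓢'(Sp n, ℂ)} {h : Sp n → ℂ}
    (H : HasTemperateHat T h) (a : Fin n → ℕ) (ls : List (Fin n)) :
    HasTemperateHat ((ls.map fun j => (LineDeriv.lineDerivOpCLM ℂ 𝓢'(Sp n, ℂ)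
      (EuclideanSpace.single j (1 : ℝ))) ^ (a j)).prod T)
      (fun η => (ls.map fun j => (Complex.I * (((2 * Real.pi) • η) j : ℂ)) ^ (a j)).prod * h η) := by
  induction ls with
  | nil => simpa using H
  | cons l ls ih =>
    simp only [List.map_cons, List.prod_cons, mul_assoc]
    exact ih.lineDeriv_pow l (a l)

/-- The integrability part of `HasTemperateHat` is what permits summing over the monomials under the
integral. -/
theorem HasTemperateHat.polyDiff {T : 𝓢'(Sp n, ℂ)} {h : Sp n → ℂ}
    (H : HasTemperateHat T h) (p : MvPolynomial (Fin n) ℝ) :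
    HasTemperateHat (polyDiff p T) (fun η => symbol p ((2 * Real.pi) • η) * h η) := by
  rw [HasTemperateHat, HasHat, ← forall_and]
  intro f
  have e : ∀ η : Sp n, f η * (symbol p ((2 * Real.pi) • η) * h η) = ∑ a ∈ p.support,
      ((p.coeff a : ℝ) : ℂ) * (f η * (((List.finRange n).map fun j =>
        (Complex.I * (((2 * Real.pi) • η) j : ℂ)) ^ (a j)).prod * h η)) := by
    intro η
    rw [symbol, MvPolynomial.aeval_eq_eval₂Hom, MvPolynomial.coe_eval₂Hom,
      MvPolynomial.eval₂_eq', Finset.sum_mul, Finset.mul_sum]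
    refine Finset.sum_congr rfl fun a _ => ?_
    rw [Fin.prod_univ_def]
    simp only [Complex.coe_algebraMap]
    ring
  simp only [e]
  have hi : ∀ a ∈ p.support, Integrable fun η : Sp n => ((p.coeff a : ℝ) : ℂ) *
      (f η * (((List.finRange n).map fun j =>
        (Complex.I * (((2 * Real.pi) • η) j : ℂ)) ^ (a j)).prod * h η)) :=
    fun a _ => ((H.lineDeriv_prod a (List.finRange n)).2 f).const_mul _
  refine ⟨?_, integrable_finsetSum _ hi⟩
  rw [integral_finsetSum _ hi]
  simp only [integral_const_mul, ← (H.lineDeriv_prod _ (List.finRange n)).1 f]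
  rw [TemperedDistribution.fourier_apply]
  simp only [TemperedDistribution.fourier_apply, LagrangeDuhamel.polyDiff]
  rw [sum_apply]
  rw [sum_schwartz_apply]
  rfl

theorem HasTemperateHat.congr {T : 𝓢'(Sp n, ℂ)} {h h' : Sp n → ℂ} (H : HasTemperateHat T h)
    (e : h =ᵐ[volume] h') : HasTemperateHat T h' :=
  ⟨H.1.congr e, fun f => (H.2 f).congr (by filter_upwards [e] with η hη; rw [hη])⟩

theorem HasTemperateHat.add {T T' : 𝓢'(Sp n, ℂ)} {h h' : Sp n → ℂ} (H : HasTemperateHat T h)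
    (H' : HasTemperateHat T' h') : HasTemperateHat (T + T') (fun η => h η + h' η) := by
  rw [HasTemperateHat, HasHat, ← forall_and]
  intro f
  simp only [mul_add]
  refine ⟨?_, (H.2 f).add (H'.2 f)⟩
  rw [integral_add (H.2 f) (H'.2 f), FourierTransform.fourier_add, ← H.1, ← H'.1]
  rfl

theorem HasTemperateHat.const_smul {T : 𝓢'(Sp n, ℂ)} {h : Sp n → ℂ} (c : ℂ)
    (H : HasTemperateHat T h) : HasTemperateHat (c • T) (fun η => c * h η) := by
  rw [HasTemperateHat, HasHat, ← forall_and]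
  intro f
  simp only [mul_left_comm _ c]
  refine ⟨?_, (H.2 f).const_mul c⟩
  rw [integral_const_mul, FourierTransform.fourier_smul, ← H.1]
  rfl

theorem hasTemperateHat_zero : HasTemperateHat (0 : 𝓢'(Sp n, ℂ)) (fun _ => 0) := by
  refine ⟨fun f => ?_, fun f => by simp⟩
  rw [FourierTransform.fourier_zero]
  simp

theorem HasTemperateHat.sum {ι : Type*} (t : Finset ι) {T : ι → 𝓢'(Sp n, ℂ)} {h : ι → Sp n → ℂ}
    (H : ∀ i, HasTemperateHat (T i) (h i)) :
    HasTemperateHat (∑ i ∈ t, T i) (fun η => ∑ i ∈ t, h i η) := by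
  classical
  induction t using Finset.induction_on with
  | empty => simpa using hasTemperateHat_zero
  | insert i t hi ih =>
    simp only [Finset.sum_insert hi]
    exact (H i).add ih

theorem Sobolev.hasTemperateHat [hm : Fact (0 < m)] (T : Sobolev n m s) :
    HasTemperateHat T.toDist T.hat :=
  ⟨T.hasHat, fun f => integrable_schwartz_mul hm.out T.memLp_hat f⟩

end PolyDiff

/-! ### The evolution group on the Cauchy data. -/

section Evolution

variable {n r d₁ d₂ : ℕ} {m s : ℝ} [hm : Fact (0 < m)]

/-- The components of Cauchy data. -/
def cauCoord : (k : CauIndex d₁ d₂) → Cau n r d₁ d₂ m s →L[ℝ] Sobolev n m (cauExp r s k)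
  | Sum.inl i => (PiLp.proj 1 (fun _ : Fin d₁ ⊕ Fin d₂ => Sobolev n m s) (Sum.inl i)).comp
      (WithLp.fstL 1 ℝ _ _)
  | Sum.inr (Sum.inl j) =>
      (PiLp.proj 1 (fun _ : Fin d₁ ⊕ Fin d₂ => Sobolev n m s) (Sum.inr j)).comp
        (WithLp.fstL 1 ℝ _ _)
  | Sum.inr (Sum.inr j) => (PiLp.proj 1 (fun _ : Fin d₂ => Sobolev n m (s - r)) j).comp
      (WithLp.sndL 1 ℝ _ _)

/-- The Cauchy data with given components. -/
def cauMk (f : (k : CauIndex d₁ d₂) → Sobolev n m (cauExp r s k)) : Cau n r d₁ d₂ m s :=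
  WithLp.toLp 1 (WithLp.toLp 1 fun i : Fin d₁ ⊕ Fin d₂ => match i with
    | Sum.inl i => f (Sum.inl i)
    | Sum.inr j => f (Sum.inr (Sum.inl j)), WithLp.toLp 1 fun j => f (Sum.inr (Sum.inr j)))

theorem cauCoord_cauMk (f : (k : CauIndex d₁ d₂) → Sobolev n m (cauExp r s k))
    (k : CauIndex d₁ d₂) : cauCoord k (cauMk f) = f k := by
  rcases k with i | j | j <;> rfl

theorem cau_ext {c c' : Cau n r d₁ d₂ m s} (h : ∀ k, cauCoord k c = cauCoord k c') : c = c' := by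
  refine WithLp.ofLp_injective 1 (Prod.ext ?_ ?_)
  · refine WithLp.ofLp_injective 1 (funext fun i => ?_)
    rcases i with i | j
    · exact h (Sum.inl i)
    · exact h (Sum.inr (Sum.inl j))
  · refine WithLp.ofLp_injective 1 (funext fun j => ?_)
    exact h (Sum.inr (Sum.inr j))

theorem norm_cau_eq (c : Cau n r d₁ d₂ m s) : ‖c‖ = ∑ k, ‖cauCoord k c‖ := by
  rw [WithLp.prod_norm_eq_of_L1, PiLp.norm_eq_of_L1, PiLp.norm_eq_of_L1, Fintype.sum_sum_type,
    Fintype.sum_sum_type, Fintype.sum_sum_type, add_assoc]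
  rfl

theorem continuous_cauMk {X : Type*} [TopologicalSpace X]
    {f : X → (k : CauIndex d₁ d₂) → Sobolev n m (cauExp r s k)}
    (hf : ∀ k, Continuous fun x => f x k) :
    Continuous fun x => (cauMk (f x) : Cau n r d₁ d₂ m s) := by
  refine (WithLp.prod_continuous_toLp 1 _ _).comp (Continuous.prodMk ?_ ?_)
  · refine (PiLp.continuous_toLp 1 _).comp (continuous_pi fun i => ?_)
    rcases i with i | j
    · exact hf (Sum.inl i)
    · exact hf (Sum.inr (Sum.inl j))
  · exact (PiLp.continuous_toLp 1 _).comp (continuous_pi fun j => hf (Sum.inr (Sum.inr j)))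

/-- The entries of the evolution are Fourier multipliers. -/
def IsPropagatorBound (L : LinOp n r d₁ d₂) (m s : ℝ) (C D : ℝ) : Prop :=
  ∀ (τ : ℝ) (k l : CauIndex d₁ d₂), IsMultiplier n m (cauExp r s l) (cauExp r s k)
    (fun η => propagator L τ ((2 * Real.pi) • η) k l) (C + D * |τ|)

variable {L : LinOp n r d₁ d₂} {C D : ℝ}

/-- The evolution of Cauchy data. -/
def evolution (H : IsPropagatorBound L m s C D) (τ : ℝ) :
    Cau n r d₁ d₂ m s →L[ℝ] Cau n r d₁ d₂ m s :=
  LinearMap.mkContinuous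
    { toFun := fun c => cauMk fun k => ∑ l, (H τ k l).clm (cauCoord l c)
      map_add' := fun c c' => cau_ext fun k => by
        simp only [map_add, cauCoord_cauMk, Finset.sum_add_distrib]
      map_smul' := fun a c => cau_ext fun k => by
        simp only [map_smul, cauCoord_cauMk, Finset.smul_sum, RingHom.id_apply] }
    (Fintype.card (CauIndex d₁ d₂) * (C + D * |τ|)) fun c => by
      rw [norm_cau_eq, norm_cau_eq c]
      simp only [LinearMap.coe_mk, AddHom.coe_mk, cauCoord_cauMk]
      calc ∑ k, ‖∑ l, (H τ k l).clm (cauCoord l c)‖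
          ≤ ∑ k : CauIndex d₁ d₂, ∑ l, (C + D * |τ|) * ‖cauCoord l c‖ := by
            refine Finset.sum_le_sum fun k _ => (norm_sum_le _ _).trans ?_
            exact Finset.sum_le_sum fun l _ => (H τ k l).clm.le_of_opNorm_le
              (H τ k l).norm_clm_le _
        _ = _ := by
            rw [Finset.sum_const, ← Finset.mul_sum, Finset.card_univ, nsmul_eq_mul, mul_assoc]

theorem norm_evolution_le (H : IsPropagatorBound L m s C D) {τ : ℝ} (h0 : 0 ≤ C + D * |τ|) :
    ‖evolution H τ‖ ≤ Fintype.card (CauIndex d₁ d₂) * (C + D * |τ|) :=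
  LinearMap.mkContinuous_norm_le _ (by positivity) _

theorem cauCoord_evolution (H : IsPropagatorBound L m s C D) (τ : ℝ) (c : Cau n r d₁ d₂ m s)
    (k : CauIndex d₁ d₂) :
    cauCoord k (evolution H τ c) = ∑ l, (H τ k l).clm (cauCoord l c) := by
  exact cauCoord_cauMk (fun k => ∑ l, (H τ k l).clm (cauCoord l c)) k

theorem hat_evolution (H : IsPropagatorBound L m s C D) (τ : ℝ) (c : Cau n r d₁ d₂ m s)
    (k : CauIndex d₁ d₂) : (cauCoord k (evolution H τ c)).hat =ᵐ[volume]
      fun η => ∑ l, propagator L τ ((2 * Real.pi) • η) k l * (cauCoord l c).hat η := by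
  rw [cauCoord_evolution]
  filter_upwards [Sobolev.hat_sum Finset.univ fun l => (H τ k l).clm (cauCoord l c),
    ae_all_iff.2 fun l => (H τ k l).hat_clm (cauCoord l c)] with η h1 h2
  rw [h1]
  exact Finset.sum_congr rfl fun l _ => h2 l

/-- The group law lets data at time t be transported to time 0 and then to τ, which separates the
dependence on t from that on τ. -/
theorem evolution_add (H : IsPropagatorBound L m s C D) (τ τ' : ℝ) (c : Cau n r d₁ d₂ m s) :
    evolution H (τ + τ') c = evolution H τ (evolution H τ' c) := by
  refine cau_ext fun k => ?_
  apply Sobolev.ext_hat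
  filter_upwards [hat_evolution H (τ + τ') c k, hat_evolution H τ (evolution H τ' c) k,
    ae_all_iff.2 fun l => hat_evolution H τ' c l] with η h1 h2 h3
  rw [h1, h2]
  simp only [h3, propagator_add, Matrix.mul_apply, Finset.sum_mul, Finset.mul_sum, mul_assoc]
  exact Finset.sum_comm

/-- Only strong continuity is claimed: it follows from pointwise continuity of the symbols and local
boundedness of the multiplier constants. -/
theorem continuous_evolution (H : IsPropagatorBound L m s C D) (hD : 0 ≤ D)
    (c : Cau n r d₁ d₂ m s) : Continuous fun τ => evolution H τ c := by
  have e : (fun τ => evolution H τ c) =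
      fun τ => cauMk fun k => ∑ l, (H τ k l).clm (cauCoord l c) := rfl
  rw [e]
  refine continuous_cauMk fun k => continuous_finsetSum _ fun l _ => ?_
  rw [continuous_iff_continuousAt]
  intro τ
  refine IsMultiplier.tendsto (C := C + D * (|τ| + 1)) (fun τ => H τ k l) (H τ k l) ?_
    (fun η => ?_) _
  · have h1 : ∀ᶠ τ' in 𝓝 τ, |τ'| < |τ| + 1 :=
      continuous_abs.continuousAt.eventually_lt continuousAt_const (by simp)
    filter_upwards [h1] with τ' h
    gcongr
  · exact (hasDerivAt_propagator L τ _ k l).continuousAt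

end Evolution

end

/-! ### The generator and the differential equation. -/

section

section Generator

variable {n r d₁ d₂ : ℕ} {m s : ℝ} [hm : Fact (0 < m)]

/-- Every row loses r derivatives: P₁ has order r, the identity block maps the velocity in H^(s-r)
to itself, and P₂ of order 2r maps H^s to H^(s-2r). -/
theorem exists_isMultiplier_gen (m s : ℝ) [hm : Fact (0 < m)] (L : LinOp n r d₁ d₂)
    (k l : CauIndex d₁ d₂) : ∃ B, IsMultiplier n m (cauExp r s l) (cauExp r s k - r)
      (fun η => gen L ((2 * Real.pi) • η) k l) B := by
  rcases k with k | k | k <;> rcases l with l | l | l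
  · choose B hB using fun j => exists_isMultiplier_symbol (m := m) s (L.P₁ j l) (L.degree_P₁ j l)
    refine ⟨_, (IsMultiplier.sum Finset.univ fun j => (hB j).const_mul (-L.γ⁻¹ k j)).congr
      fun η => ?_⟩
    change _ = (-((L.γ.map Complex.ofReal)⁻¹ * symbolMat L.P₁ ((2 * Real.pi) • η))) k l
    rw [map_ofReal_inv L.isUnit_γ, Matrix.neg_apply, Matrix.mul_apply, ← Finset.sum_neg_distrib]
    refine Finset.sum_congr rfl fun j _ => ?_
    simp [symbolMat]
  · exact ⟨0, IsMultiplier.zero⟩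
  · exact ⟨0, IsMultiplier.zero⟩
  · exact ⟨0, IsMultiplier.zero⟩
  · exact ⟨0, IsMultiplier.zero⟩
  · refine ⟨_, ((IsMultiplier.one (n := n) (m := m) (le_refl (s - r))).const_mul
      (if k = l then 1 else 0)).congr fun η => ?_⟩
    change _ = (1 : Matrix (Fin d₂) (Fin d₂) ℂ) k l
    rw [Matrix.one_apply]
    split_ifs <;> simp
  · exact ⟨0, IsMultiplier.zero⟩
  · obtain ⟨B, hB⟩ := exists_isMultiplier_symbol (m := m) s (L.P₂ k l) (L.degree_P₂ k l)
    have e : s - ((2 * r : ℕ) : ℝ) = s - r - r := by push_cast; ring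
    rw [e] at hB
    refine ⟨_, (hB.const_mul (-1)).congr fun η => ?_⟩
    change _ = (-symbolMat L.P₂ ((2 * Real.pi) • η)) k l
    simp [symbolMat]
  · exact ⟨0, IsMultiplier.zero⟩

/-- The generator, applied to Cauchy data. -/
def genApply (L : LinOp n r d₁ d₂) (k : CauIndex d₁ d₂) :
    Cau n r d₁ d₂ m s →L[ℝ] Sobolev n m (cauExp r s k - r) :=
  ∑ l, (exists_isMultiplier_gen m s L k l).choose_spec.clm.comp (cauCoord l)

theorem hat_genApply (L : LinOp n r d₁ d₂) (k : CauIndex d₁ d₂) (c : Cau n r d₁ d₂ m s) :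
    (genApply L k c).hat =ᵐ[volume]
      fun η => ∑ l, gen L ((2 * Real.pi) • η) k l * (cauCoord l c).hat η := by
  have e : genApply L k c = ∑ l, (exists_isMultiplier_gen m s L k l).choose_spec.clm
      (cauCoord l c) := by
    rw [genApply, sum_apply]
    rfl
  rw [e]
  filter_upwards [Sobolev.hat_sum Finset.univ fun l =>
      (exists_isMultiplier_gen m s L k l).choose_spec.clm (cauCoord l c),
    ae_all_iff.2 fun l => (exists_isMultiplier_gen m s L k l).choose_spec.hat_clm
      (cauCoord l c)] with η h1 h2
  rw [h1]
  exact Finset.sum_congr rfl fun l _ => h2 l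

theorem genApply_inr_inl (L : LinOp n r d₁ d₂) (j : Fin d₂) (c : Cau n r d₁ d₂ m s) :
    (genApply L (Sum.inr (Sum.inl j)) c : Sobolev n m (s - r)) =
      cauCoord (Sum.inr (Sum.inr j)) c := by
  apply Sobolev.ext_hat
  filter_upwards [hat_genApply L (Sum.inr (Sum.inl j)) c] with η h
  refine h.trans ?_
  rw [Fintype.sum_sum_type, Fintype.sum_sum_type]
  simp [gen, gen₂, Matrix.one_apply]
  rfl

theorem hasTemperateHat_genApply (L : LinOp n r d₁ d₂) (k : CauIndex d₁ d₂)
    (c : Cau n r d₁ d₂ m s) : HasTemperateHat (genApply L k c).toDist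
      fun η => ∑ l, gen L ((2 * Real.pi) • η) k l * (cauCoord l c).hat η :=
  (genApply L k c).hasTemperateHat.congr (hat_genApply L k c)

/-- The equation `γ⁰∂₀u₁ + P₁(∂)u₁ = 0`. -/
theorem genApply_inl (L : LinOp n r d₁ d₂) (i : Fin d₁) (c : Cau n r d₁ d₂ m s)
    (f : 𝓢(Sp n, ℂ)) :
    ∑ j, (L.γ i j : ℂ) * (genApply L (Sum.inl j) c).toDist f +
      ∑ j, polyDiff (L.P₁ i j) ((cauCoord (Sum.inl j) c).toDist) f = 0 := by
  have h1 := (HasTemperateHat.sum Finset.univ fun j =>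
    (hasTemperateHat_genApply L (Sum.inl j) c).const_smul (L.γ i j : ℂ)).add
    (HasTemperateHat.sum Finset.univ fun j =>
      ((cauCoord (Sum.inl j) c).hasTemperateHat.polyDiff (L.P₁ i j)))
  have h2 := h1.1.congr (h' := fun _ => 0) (ae_of_all _ fun η => by
    have e1 : ∀ j, ∑ l, gen L ((2 * Real.pi) • η) (Sum.inl j) l * (cauCoord l c).hat η =
        ∑ l, gen₁ L ((2 * Real.pi) • η) j l * (cauCoord (Sum.inl l) c).hat η := by
      intro j
      rw [Fintype.sum_sum_type]
      simp [gen]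
    have e2 : (L.γ.map Complex.ofReal) * gen₁ L ((2 * Real.pi) • η) =
        -symbolMat L.P₁ ((2 * Real.pi) • η) := by
      have hu : IsUnit (L.γ.map Complex.ofReal) := L.isUnit_γ.map Complex.ofRealHom.mapMatrix
      rw [gen₁, Matrix.mul_neg, ← Matrix.mul_assoc, Matrix.mul_nonsing_inv _
        ((Matrix.isUnit_iff_isUnit_det _).1 hu), Matrix.one_mul]
    have e3 : ∑ j, (L.γ i j : ℂ) *
          ∑ l, gen₁ L ((2 * Real.pi) • η) j l * (cauCoord (Sum.inl l) c).hat η =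
        ∑ l, ((L.γ.map Complex.ofReal) * gen₁ L ((2 * Real.pi) • η)) i l *
          (cauCoord (Sum.inl l) c).hat η := by
      simp only [Matrix.mul_apply, Finset.mul_sum, Finset.sum_mul, Matrix.map_apply]
      rw [Finset.sum_comm]
      simp only [mul_assoc]
    simp only [e1]
    rw [e3, e2, ← Finset.sum_add_distrib]
    simp [symbolMat])
  have h3 := congrArg (fun T : 𝓢'(Sp n, ℂ) => T f) (h2.eq_dist hasTemperateHat_zero.1)
  rw [← sum_schwartz_apply]
  refine Eq.trans ?_ h3
  congr 1
  exact (sum_schwartz_apply Finset.univ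
    (fun j => (L.γ i j : ℂ) • (genApply L (Sum.inl j) c).toDist) f).symm

/-- The equation `∂₀²u₂ + P₂(∂)u₂ = 0`. -/
theorem genApply_inr_inr (L : LinOp n r d₁ d₂) (i : Fin d₂) (c : Cau n r d₁ d₂ m s)
    (f : 𝓢(Sp n, ℂ)) :
    (genApply L (Sum.inr (Sum.inr i)) c).toDist f +
      ∑ j, polyDiff (L.P₂ i j) ((cauCoord (Sum.inr (Sum.inl j)) c).toDist) f = 0 := by
  have h1 := (hasTemperateHat_genApply L (Sum.inr (Sum.inr i)) c).add
    (HasTemperateHat.sum Finset.univ fun j =>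
      ((cauCoord (Sum.inr (Sum.inl j)) c).hasTemperateHat.polyDiff (L.P₂ i j)))
  have h2 := h1.1.congr (h' := fun _ => 0) (ae_of_all _ fun η => by
    simp only
    rw [Fintype.sum_sum_type, Fintype.sum_sum_type]
    simp [gen, gen₂, symbolMat])
  have h3 := congrArg (fun T : 𝓢'(Sp n, ℂ) => T f) (h2.eq_dist hasTemperateHat_zero.1)
  rw [← sum_schwartz_apply]
  exact h3

variable {L : LinOp n r d₁ d₂} {C D : ℝ}

theorem cauExp_sub_le (r : ℕ) (s : ℝ) (k : CauIndex d₁ d₂) : cauExp r s k - r ≤ cauExp r s k := by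
  have : (0 : ℝ) ≤ r := Nat.cast_nonneg r
  linarith

/-- The derivative exists only after the loss of r derivatives, so the curve is first included in
the larger space. The derivative symbols gen · propagator have multiplier bounds that are uniform
for |τ| ≤ R. -/
theorem hasDerivAt_evolution (H : IsPropagatorBound L m s C D) (hD : 0 ≤ D)
    (c : Cau n r d₁ d₂ m s) (k : CauIndex d₁ d₂) (τ : ℝ) :
    HasDerivAt (fun τ => (IsMultiplier.one (n := n) (m := m) (cauExp_sub_le r s k)).clm
      (cauCoord k (evolution H τ c))) (genApply L k (evolution H τ c)) τ := by
  choose B hB using exists_isMultiplier_gen (n := n) m s L k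
  have h' : ∀ (l : CauIndex d₁ d₂) (τ : ℝ), IsMultiplier n m (cauExp r s l) (cauExp r s k - r)
      (fun η => (gen L ((2 * Real.pi) • η) * propagator L τ ((2 * Real.pi) • η)) k l)
      (∑ j, B j * (C + D * |τ|)) := fun l τ =>
    (IsMultiplier.sum Finset.univ fun j => (hB j).comp (H τ j l)).congr fun η => by
      rw [Matrix.mul_apply]
  have h1 : ∀ l, HasDerivAt (fun τ => (IsMultiplier.one (n := n) (m := m)
      (cauExp_sub_le r s k)).clm ((H τ k l).clm (cauCoord l c)))
      ((h' l τ).clm (cauCoord l c)) τ := by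
    intro l
    refine IsMultiplier.hasDerivAt (fun τ => H τ k l) (h' l) (cauExp_sub_le r s k) (fun R => ?_)
      (fun τ η => hasDerivAt_propagator L τ _ k l) _ τ
    refine ⟨∑ j, B j * (C + D * R), fun τ hτ => Finset.sum_le_sum fun j _ => ?_⟩
    have := (hB j).nonneg
    gcongr
  have h2 := HasDerivAt.fun_sum (u := Finset.univ) fun l _ => h1 l
  simp only [← map_sum, ← cauCoord_evolution] at h2
  have e : ∑ l, (h' l τ).clm (cauCoord l c) = genApply L k (evolution H τ c) := by
    apply Sobolev.ext_hat
    filter_upwards [Sobolev.hat_sum Finset.univ fun l => (h' l τ).clm (cauCoord l c),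
      ae_all_iff.2 fun l => (h' l τ).hat_clm (cauCoord l c), hat_genApply L k (evolution H τ c),
      ae_all_iff.2 fun l => hat_evolution H τ c l] with η h3 h4 h5 h6
    rw [h3, h5, Finset.sum_congr rfl fun l _ => h4 l]
    simp only [h6, Matrix.mul_apply, Finset.sum_mul, Finset.mul_sum, mul_assoc]
    exact Finset.sum_comm
  rw [← e]
  exact h2

theorem toDist_one_clm {a b : ℝ} (h : b ≤ a) (T : Sobolev n m a) :
    ((IsMultiplier.one (n := n) (m := m) h).clm T).toDist = T.toDist := by
  rw [Sobolev.toDist_eq_iff]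
  filter_upwards [(IsMultiplier.one h).hat_clm T] with η hη
  rw [hη, one_mul]

/-- The pairing of an element of `H^a` with a test function. -/
def Sobolev.evalDist {a : ℝ} (f : 𝓢(Sp n, ℂ)) : Sobolev n m a →L[ℝ] ℂ where
  toFun T := T.toDist f
  map_add' T T' := by rw [map_add]; rfl
  map_smul' c T := by
    rw [map_smul, real_smul_dist]
    simp
  cont := (ContinuousEvalConst.continuous_eval_const f).comp Sobolev.continuous_toDist

theorem hasDerivAt_evolution_apply (H : IsPropagatorBound L m s C D) (hD : 0 ≤ D)
    (c : Cau n r d₁ d₂ m s) (k : CauIndex d₁ d₂) (f : 𝓢(Sp n, ℂ)) (τ : ℝ) :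
    HasDerivAt (fun τ => (cauCoord k (evolution H τ c)).toDist f)
      ((genApply L k (evolution H τ c)).toDist f) τ := by
  have h := (Sobolev.evalDist f).hasFDerivAt.comp_hasDerivAt τ (hasDerivAt_evolution H hD c k τ)
  have e : (fun τ => (cauCoord k (evolution H τ c)).toDist f) =
      (Sobolev.evalDist f) ∘ fun τ => (IsMultiplier.one (n := n) (m := m)
        (cauExp_sub_le r s k)).clm (cauCoord k (evolution H τ c)) := by
    funext τ
    change _ = ((IsMultiplier.one (n := n) (m := m)
        (cauExp_sub_le r s k)).clm (cauCoord k (evolution H τ c))).toDist f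
    rw [toDist_one_clm (cauExp_sub_le r s k)]
  rw [e]
  exact h

theorem continuous_genApply_evolution_apply (H : IsPropagatorBound L m s C D) (hD : 0 ≤ D)
    (c : Cau n r d₁ d₂ m s) (k : CauIndex d₁ d₂) (f : 𝓢(Sp n, ℂ)) :
    Continuous fun τ => (genApply L k (evolution H τ c)).toDist f :=
  (Sobolev.evalDist f).continuous.comp
    ((genApply L k).continuous.comp (continuous_evolution H hD c))

end Generator

end

/-! ### Weak solutions and the solution operator. -/

section

section Solve

/-- Integration by parts on an interval, against a test function. -/
theorem integral_deriv_mul_of_test {I : Set ℝ} (hI : MeasurableSet I) {θ : ℝ → ℝ}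
    (hθ : ContDiff ℝ 1 θ) (hc : HasCompactSupport θ) (hs : tsupport θ ⊆ I) {g g' : ℝ → ℂ}
    (hg : ∀ t, HasDerivAt g (g' t) t) (hg' : Continuous g') :
    ∫ t : I, ((deriv θ (t : ℝ) : ℝ) : ℂ) * g t ∂vol I =
      -∫ t : I, ((θ (t : ℝ) : ℝ) : ℂ) * g' t ∂vol I := by
  have hgc : Continuous g := continuous_iff_continuousAt.2 fun t => (hg t).continuousAt
  have key : ∀ {u : ℝ → ℝ} (h : ℝ → ℂ), tsupport u ⊆ I →
      ∫ t : I, ((u (t : ℝ) : ℝ) : ℂ) * h t ∂vol I = ∫ t, ((u t : ℝ) : ℂ) * h t := by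
    intro u h hu
    rw [integral_subtype_comap hI fun t => ((u t : ℝ) : ℂ) * h t]
    refine setIntegral_eq_integral_of_forall_compl_eq_zero fun t ht => ?_
    rw [image_eq_zero_of_notMem_tsupport fun h => ht (hu h)]
    simp
  have hc' : ∀ {u : ℝ → ℝ} {h : ℝ → ℂ}, HasCompactSupport u → Continuous u → Continuous h →
      Integrable fun t => ((u t : ℝ) : ℂ) * h t := by
    intro u h hu huc hh
    refine Continuous.integrable_of_hasCompactSupport (by fun_prop) ?_
    exact HasCompactSupport.mul_right (hu.comp_left (g := Complex.ofReal) rfl)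
  have hd : Continuous (deriv θ) := hθ.continuous_deriv le_rfl
  rw [key g ((tsupport_deriv_subset).trans hs), key g' hs]
  have h := integral_mul_deriv_eq_deriv_mul_of_integrable
    (u := fun t => (θ t : ℂ)) (u' := fun t => ((deriv θ t : ℝ) : ℂ)) (v := g) (v' := g')
    (fun t _ => ((hθ.differentiable (by simp)) t).hasDerivAt.ofReal_comp) (fun t _ => hg t)
    (hc' hc hθ.continuous hg') (hc' hc.deriv hd hgc) (hc' hc hθ.continuous hgc)
  rw [h, neg_neg]

variable {n r d₁ d₂ : ℕ} {m s : ℝ} [hm : Fact (0 < m)] {L : LinOp n r d₁ d₂} {C D : ℝ}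
  {I : Set ℝ}

/-- The solution of the linear equation with given Cauchy data at time `0`. -/
def solution (H : IsPropagatorBound L m s C D) (hD : 0 ≤ D) {B : ℝ}
    (hB : ∀ t ∈ I, ‖(evolution H t : Cau n r d₁ d₂ m s →L[ℝ] Cau n r d₁ d₂ m s)‖ ≤ B)
    (c : Cau n r d₁ d₂ m s) : I →ᵇ Cau n r d₁ d₂ m s :=
  BoundedContinuousFunction.ofNormedAddCommGroup (fun t : I => evolution H t c)
    ((continuous_evolution H hD c).comp continuous_subtype_val) (B * ‖c‖)
    fun t => (evolution H t).le_of_opNorm_le (hB t t.2) c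

theorem comp_solution_inl (H : IsPropagatorBound L m s C D) (hD : 0 ≤ D) {B : ℝ}
    (hB : ∀ t ∈ I, ‖(evolution H t : Cau n r d₁ d₂ m s →L[ℝ] Cau n r d₁ d₂ m s)‖ ≤ B)
    (c : Cau n r d₁ d₂ m s) (t : I) (j : Fin d₁) : comp (solution H hD hB c) t (Sum.inl j) =
      (cauCoord (Sum.inl j) (evolution H t c)).toDist := rfl

theorem comp_solution_inr (H : IsPropagatorBound L m s C D) (hD : 0 ≤ D) {B : ℝ}
    (hB : ∀ t ∈ I, ‖(evolution H t : Cau n r d₁ d₂ m s →L[ℝ] Cau n r d₁ d₂ m s)‖ ≤ B)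
    (c : Cau n r d₁ d₂ m s) (t : I) (j : Fin d₂) : comp (solution H hD hB c) t (Sum.inr j) =
      (cauCoord (Sum.inr (Sum.inl j)) (evolution H t c)).toDist := rfl

/-- The time derivative is the generator applied to the evolved data; its E₂-part is the velocity
component, as the encoding requires. -/
theorem solution_mem_FSpace (H : IsPropagatorBound L m s C D) (hD : 0 ≤ D) {B : ℝ}
    (hB : ∀ t ∈ I, ‖(evolution H t : Cau n r d₁ d₂ m s →L[ℝ] Cau n r d₁ d₂ m s)‖ ≤ B)
    (c : Cau n r d₁ d₂ m s) : solution H hD hB c ∈ FSpace n r d₁ d₂ m s I := by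
  let u : ℝ → Fin d₁ ⊕ Fin d₂ → Sobolev n m (s - r) := fun t i => match i with
    | Sum.inl i => (IsMultiplier.one (n := n) (m := m)
        (cauExp_sub_le (d₁ := d₁) (d₂ := d₂) r s (Sum.inl i))).clm
        (cauCoord (Sum.inl i) (evolution H t c))
    | Sum.inr i => (IsMultiplier.one (n := n) (m := m)
        (cauExp_sub_le (d₁ := d₁) (d₂ := d₂) r s (Sum.inr (Sum.inl i)))).clm
        (cauCoord (Sum.inr (Sum.inl i)) (evolution H t c))
  let v : ℝ → Fin d₁ ⊕ Fin d₂ → Sobolev n m (s - r) := fun t i => match i with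
    | Sum.inl i => genApply L (Sum.inl i) (evolution H t c)
    | Sum.inr i => genApply L (Sum.inr (Sum.inl i)) (evolution H t c)
  have huv : ∀ t, HasDerivAt u (v t) t := by
    intro t
    rw [hasDerivAt_pi]
    rintro (i | i)
    · exact hasDerivAt_evolution H hD c (Sum.inl i) t
    · exact hasDerivAt_evolution H hD c (Sum.inr (Sum.inl i)) t
  have hv : Continuous v := by
    refine continuous_pi ?_
    rintro (i | i)
    · exact (genApply L (Sum.inl i)).continuous.comp (continuous_evolution H hD c)
    · exact (genApply L (Sum.inr (Sum.inl i))).continuous.comp (continuous_evolution H hD c)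
  let e := (PiLp.continuousLinearEquiv 1 ℝ fun _ : Fin d₁ ⊕ Fin d₂ =>
    Sobolev n m (s - r)).symm.toContinuousLinearMap
  refine ⟨fun t => e (u t), fun t => e (v t), fun t i => ?_, fun t _ => ?_, ?_, fun t j => ?_⟩
  · rcases i with i | i
    · exact toDist_one_clm (cauExp_sub_le (d₁ := d₁) (d₂ := d₂) r s (Sum.inl i)) _
    · exact toDist_one_clm (cauExp_sub_le (d₁ := d₁) (d₂ := d₂) r s (Sum.inr (Sum.inl i))) _
  · exact (e.hasFDerivAt.comp_hasDerivAt t (huv t)).hasDerivWithinAt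
  · exact (e.continuous.comp hv).continuousOn
  · exact genApply_inr_inl L j (evolution H t c)

variable [I.OrdConnected]

theorem weakEq₁_solution (H : IsPropagatorBound L m s C D) (hD : 0 ≤ D) {B : ℝ}
    (hB : ∀ t ∈ I, ‖(evolution H t : Cau n r d₁ d₂ m s →L[ℝ] Cau n r d₁ d₂ m s)‖ ≤ B)
    (c : Cau n r d₁ d₂ m s) : WeakEq₁ L (solution H hD hB c) := by
  intro θ hθ hc hs f i
  have hI : MeasurableSet I := ‹I.OrdConnected›.measurableSet
  simp only [comp_solution_inl]
  have h := integral_deriv_mul_of_test hI (hθ.of_le (by simp)) hc (hs.trans interior_subset)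
    (g := fun t => ∑ j, (L.γ i j : ℂ) * (cauCoord (Sum.inl j) (evolution H t c)).toDist f)
    (g' := fun t => ∑ j, (L.γ i j : ℂ) * (genApply L (Sum.inl j) (evolution H t c)).toDist f)
    (fun t => HasDerivAt.fun_sum fun j _ =>
      (hasDerivAt_evolution_apply H hD c (Sum.inl j) f t).const_mul _)
    (continuous_finsetSum _ fun j _ => continuous_const.mul
      (continuous_genApply_evolution_apply H hD c (Sum.inl j) f))
  have e : ∀ t : I, ∑ j, polyDiff (L.P₁ i j) ((cauCoord (Sum.inl j) (evolution H t c)).toDist) f =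
      -∑ j, (L.γ i j : ℂ) * (genApply L (Sum.inl j) (evolution H t c)).toDist f := fun t =>
    eq_neg_of_add_eq_zero_right (genApply_inl L i (evolution H t c) f)
  simp only [e, Complex.ofReal_neg, neg_mul, mul_neg, integral_neg]
  rw [h]
  ring

/-- Two integrations by parts move both derivatives from θ to the solution: the first gives the
velocity, the second the generator, and the latter cancels P₂(∂)u₂. -/
theorem weakEq₂_solution (H : IsPropagatorBound L m s C D) (hD : 0 ≤ D) {B : ℝ}
    (hB : ∀ t ∈ I, ‖(evolution H t : Cau n r d₁ d₂ m s →L[ℝ] Cau n r d₁ d₂ m s)‖ ≤ B)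
    (c : Cau n r d₁ d₂ m s) : WeakEq₂ L (solution H hD hB c) := by
  intro θ hθ hc hs f i
  have hI : MeasurableSet I := ‹I.OrdConnected›.measurableSet
  simp only [comp_solution_inr]
  have hθ' : ContDiff ℝ 1 (deriv θ) := (contDiff_infty_iff_deriv.1 hθ).2.of_le (by simp)
  have hsI := hs.trans interior_subset
  have e0 : ∀ t, (genApply L (Sum.inr (Sum.inl i)) (evolution H t c)).toDist f =
      (cauCoord (Sum.inr (Sum.inr i)) (evolution H t c)).toDist f := fun t =>
    congrArg (fun T : Sobolev n m (s - r) => T.toDist f) (genApply_inr_inl L i (evolution H t c))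
  have h1 := integral_deriv_mul_of_test hI hθ' hc.deriv (tsupport_deriv_subset.trans hsI)
    (fun t => hasDerivAt_evolution_apply H hD c (Sum.inr (Sum.inl i)) f t)
    (continuous_genApply_evolution_apply H hD c (Sum.inr (Sum.inl i)) f)
  have h2 := integral_deriv_mul_of_test hI (hθ.of_le (by simp)) hc hsI
    (fun t => hasDerivAt_evolution_apply H hD c (Sum.inr (Sum.inr i)) f t)
    (continuous_genApply_evolution_apply H hD c (Sum.inr (Sum.inr i)) f)
  have e : ∀ t : I, ∑ j, polyDiff (L.P₂ i j)
        ((cauCoord (Sum.inr (Sum.inl j)) (evolution H t c)).toDist) f =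
      -(genApply L (Sum.inr (Sum.inr i)) (evolution H t c)).toDist f := fun t =>
    eq_neg_of_add_eq_zero_right (genApply_inr_inr L i (evolution H t c) f)
  simp only [e, mul_neg, integral_neg]
  rw [h1]
  simp only [e0]
  rw [h2]
  ring

/-- The solution operator. -/
def solve (I : Set ℝ) [I.OrdConnected] (H : IsPropagatorBound L m s C D) (hD : 0 ≤ D) {B : ℝ}
    (hB : ∀ t ∈ I, ‖(evolution H t : Cau n r d₁ d₂ m s →L[ℝ] Cau n r d₁ d₂ m s)‖ ≤ B) :
    Cau n r d₁ d₂ m s →ₗ[ℝ] E0 L m s I where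
  toFun := fun c => (⟨solution H hD hB c, solution_mem_FSpace H hD hB c,
        weakEq₁_solution H hD hB c, weakEq₂_solution H hD hB c⟩ : E0 L m s I)
  map_add' := fun c c' => Subtype.ext (BoundedContinuousFunction.ext fun t =>
    map_add (evolution H t) c c')
  map_smul' := fun a c => Subtype.ext (BoundedContinuousFunction.ext fun t =>
    map_smul (evolution H t) a c)

theorem norm_solve_le (H : IsPropagatorBound L m s C D) (hD : 0 ≤ D) {B : ℝ} (hB0 : 0 ≤ B)
    (hB : ∀ t ∈ I, ‖(evolution H t : Cau n r d₁ d₂ m s →L[ℝ] Cau n r d₁ d₂ m s)‖ ≤ B)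
    (c : Cau n r d₁ d₂ m s) : ‖solve I H hD hB c‖ ≤ B * ‖c‖ :=
  (BoundedContinuousFunction.norm_le (by positivity)).2 fun t =>
    (evolution H t).le_of_opNorm_le (hB t t.2) c

/-- The Cauchy data at time `t`. -/
def cauchyData (L : LinOp n r d₁ d₂) (m s : ℝ) [Fact (0 < m)] (I : Set ℝ) [I.OrdConnected]
    (t : I) : E0 L m s I →ₗ[ℝ] Cau n r d₁ d₂ m s where
  toFun φ := φ.1 t
  map_add' _ _ := rfl
  map_smul' _ _ := rfl

theorem norm_cauchyData_le (t : I) (φ : E0 L m s I) : ‖cauchyData L m s I t φ‖ ≤ ‖φ‖ :=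
  φ.1.norm_coe_le_norm t

theorem continuous_cauchyData :
    Continuous fun x : I × E0 L m s I => cauchyData L m s I x.1 x.2 :=
  continuous_eval.comp ((continuous_subtype_val.comp continuous_snd).prodMk continuous_fst)

end Solve

end

/-! ### Normal families and radii of convergence. -/

section

section NormalFamily

variable {T C X Y : Type*} [TopologicalSpace T] [NormedAddCommGroup C] [NormedSpace ℝ C]
  [NormedAddCommGroup X] [NormedSpace ℝ X] [NormedAddCommGroup Y] [NormedSpace ℝ Y]

theorem summable_of_lt_radius_ofScalars {c : ℕ → ℝ} {t : ℝ≥0}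
    (h : (t : ℝ≥0∞) < (FormalMultilinearSeries.ofScalars ℝ c).radius) :
    Summable fun k => |c k| * (t : ℝ) ^ k := by
  have h1 := (FormalMultilinearSeries.ofScalars ℝ c).summable_norm_mul_pow h
  simpa [FormalMultilinearSeries.ofScalars_norm] using h1

/-- Strongly continuous and uniformly bounded families of operators are jointly continuous. -/
theorem continuous_apply_of_strong {A : T → Y →L[ℝ] C} {B : ℝ} (hA : ∀ t, ‖A t‖ ≤ B)
    (hAc : ∀ y, Continuous fun t => A t y) : Continuous fun x : T × Y => A x.1 x.2 := by
  rw [continuous_iff_continuousAt]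
  rintro ⟨t, y⟩
  rw [ContinuousAt, tendsto_iff_norm_sub_tendsto_zero]
  have h1 : Tendsto (fun x : T × Y => B * ‖x.2 - y‖ + ‖A x.1 y - A t y‖) (𝓝 (t, y)) (𝓝 0) := by
    have : Continuous fun x : T × Y => B * ‖x.2 - y‖ + ‖A x.1 y - A t y‖ := by
      have := (hAc y).comp (continuous_fst : Continuous (Prod.fst : T × Y → T))
      simp only [Function.comp_def] at this
      fun_prop
    simpa using this.tendsto (t, y)
  refine squeeze_zero (fun _ => norm_nonneg _) (fun x => ?_) h1
  have e : A x.1 x.2 - A t y = A x.1 (x.2 - y) + (A x.1 y - A t y) := by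
    rw [map_sub]
    abel
  rw [e]
  exact (norm_add_le _ _).trans (by gcongr; exact (A x.1).le_of_opNorm_le (hA x.1) _)

/-- A formal series between spaces of Cauchy data gives a normal family of analytic maps, by
evaluation and propagation. -/
theorem exists_isNormalFamily [CompleteSpace Y] {Φ : FormalMultilinearSeries ℝ C Y}
    (hΦ : IsSymmetricSeries Φ) {ν : ℕ → ℝ} (hν : ∀ k, ‖Φ k‖ ≤ ν k)
    {ev : T → X →ₗ[ℝ] C} (hev : ∀ t x, ‖ev t x‖ ≤ ‖x‖)
    (hevc : Continuous fun x : T × X => ev x.1 x.2) {A : T → Y →L[ℝ] C} {B : ℝ} (hB : 0 < B)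
    (hA : ∀ t, ‖A t‖ ≤ B) (hAc : ∀ y, Continuous fun t => A t y) {S : C →ₗ[ℝ] X} {B' : ℝ}
    (hB' : 0 < B') (hS : ∀ c, ‖S c‖ ≤ B' * ‖c‖) :
    ∃ V : T → X → X,
      (∀ t, ∀ x ∈ oball X (FormalMultilinearSeries.ofScalars ℝ fun k => B' * B * ν k).radius,
        ∃ F, HasSum (fun k => Φ k fun _ => ev t x) F ∧ V t x = S (A t F)) ∧
      ContinuousOn (fun x : T × X => V x.1 x.2)
        {x | x.2 ∈ oball X (FormalMultilinearSeries.ofScalars ℝ fun k => B' * B * ν k).radius} ∧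
      IsNormalFamily V (FormalMultilinearSeries.ofScalars ℝ fun k => B' * B * ν k).radius := by
  set ρ := (FormalMultilinearSeries.ofScalars ℝ fun k => B' * B * ν k).radius with hρ
  have hν0 : ∀ k, 0 ≤ ν k := fun k => (norm_nonneg _).trans (hν k)
  -- The factor B'B is positive, so summability of the majorant implies that of ‖Φ k‖ t^k.
  have hrad : ρ ≤ Φ.radius := by
    refine ENNReal.le_of_forall_nnreal_lt fun t ht => ?_
    have h1 := summable_of_lt_radius_ofScalars ht
    refine Φ.le_radius_of_summable_norm ?_
    refine Summable.of_nonneg_of_le (fun k => by positivity) (fun k => ?_)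
      (h1.mul_left (B' * B)⁻¹)
    rw [abs_of_nonneg (mul_nonneg (by positivity) (hν0 k)), ← mul_assoc,
      inv_mul_cancel_left₀ (by positivity)]
    gcongr
    exact hν k
  have hmem : ∀ t, ∀ x ∈ oball X ρ, ev t x ∈ Metric.eball (0 : C) Φ.radius := by
    intro t x hx
    rw [mem_eball_zero_iff]
    refine lt_of_le_of_lt ?_ (lt_of_lt_of_le hx hrad)
    rw [enorm_eq_nnnorm]
    exact_mod_cast hev t x
  have hsum : ∀ t, ∀ x ∈ oball X ρ, HasSum (fun k => Φ k fun _ => ev t x) (Φ.sum (ev t x)) :=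
    fun t x hx => Φ.hasSum (hmem t x hx)
  let S' : C →L[ℝ] X := S.mkContinuous B' hS
  let ev' : T → X →L[ℝ] C := fun t => (ev t).mkContinuous 1 fun x => by
    rw [one_mul]
    exact hev t x
  have hev' : ∀ t, ‖ev' t‖ ≤ 1 := fun t => LinearMap.mkContinuous_norm_le _ zero_le_one _
  have hS' : ‖S'‖ ≤ B' := LinearMap.mkContinuous_norm_le _ hB'.le _
  -- Evaluation at t, which does not increase norms, then the analytic map, then bounded linear
  -- maps. Only B'B appears in the majorant, for all t at once.
  refine ⟨fun t x => S (A t (Φ.sum (ev t x))), fun t x hx => ⟨_, hsum t x hx, rfl⟩, ?_, ?_⟩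
  · have h1 : ContinuousOn (fun x : T × X => (x.1, Φ.sum (ev x.1 x.2)))
        {x | x.2 ∈ oball X ρ} := by
      refine continuousOn_fst.prodMk ?_
      exact Φ.continuousOn.comp hevc.continuousOn fun x hx => hmem x.1 x.2 hx
    exact S'.continuous.comp_continuousOn ((continuous_apply_of_strong hA hAc).comp_continuousOn h1)
  · refine ⟨fun t k => ((S'.comp (A t)).compContinuousMultilinearMap (Φ k)).compContinuousLinearMap
      fun _ => ev' t, fun t k σ x => ?_, fun t x hx => ?_, fun k => B' * B * ν k, rfl,
      fun t k => ?_⟩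
    · change S' (A t (Φ k fun i => ev' t (x (σ i)))) = S' (A t (Φ k fun i => ev' t (x i)))
      rw [hΦ k σ fun i => ev' t (x i)]
    · exact ((S'.comp (A t)).hasSum (hsum t x hx))
    · refine (ContinuousMultilinearMap.norm_compContinuousLinearMap_le _ _).trans ?_
      have h1 : ∏ _i : Fin k, ‖ev' t‖ ≤ 1 :=
        Finset.prod_le_one (fun _ _ => norm_nonneg _) fun _ _ => hev' t
      refine (mul_le_of_le_one_right (norm_nonneg _) h1).trans ?_
      refine (ContinuousLinearMap.norm_compContinuousMultilinearMap_le _ _).trans ?_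
      have h2 : ‖S'.comp (A t)‖ ≤ B' * B :=
        (ContinuousLinearMap.opNorm_comp_le _ _).trans (by gcongr; exact hA t)
      exact mul_le_mul h2 (hν k) (norm_nonneg _) (by positivity)

/-- At t/Q the factor Q^k is cancelled, and the constant B does not affect convergence. This is why
Q is independent of L and of the interval. -/
theorem radius_le_mul_radius_ofScalars (p : FormalMultilinearSeries ℝ C Y) {Q : ℝ≥0} (hQ : 0 < Q)
    {B : ℝ} (hB : 0 ≤ B) : p.radius ≤
      Q * (FormalMultilinearSeries.ofScalars ℝ fun k => B * ((Q : ℝ) ^ k * ‖p k‖)).radius := by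
  refine ENNReal.le_of_forall_nnreal_lt fun t ht => ?_
  have h1 : ((t / Q : ℝ≥0) : ℝ≥0∞) ≤
      (FormalMultilinearSeries.ofScalars ℝ fun k => B * ((Q : ℝ) ^ k * ‖p k‖)).radius := by
    refine FormalMultilinearSeries.le_radius_of_summable_norm _ ?_
    have h2 := (p.summable_norm_mul_pow ht).mul_left B
    refine h2.congr fun k => ?_
    have hQ' : (Q : ℝ) ≠ 0 := by exact_mod_cast hQ.ne'
    rw [FormalMultilinearSeries.ofScalars_norm, Real.norm_of_nonneg (by positivity)]
    push_cast
    rw [div_pow]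
    field_simp
  calc (t : ℝ≥0∞) = Q * ((t / Q : ℝ≥0) : ℝ≥0∞) := by
        rw [← ENNReal.coe_mul, mul_div_cancel₀ _ hQ.ne']
    _ ≤ _ := by gcongr

end NormalFamily

end

/-! ### From the nonlinearity to Cauchy data and the Duhamel integral. -/

section

section Forcing

open Sobolev

variable {n r d₁ d₂ : ℕ} {m s b : ℝ} [hm : Fact (0 < m)] {L : LinOp n r d₁ d₂}

/-- The values of the nonlinearity. -/
abbrev Force (n d₁ d₂ : ℕ) (m s b : ℝ) [Fact (0 < m)] : Type :=
  (Fin d₁ → Sobolev n m s) × (Fin d₂ → Sobolev n m b)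

/-- The components of the Cauchy data `((γ⁰)⁻¹F₁, 0, F₂)`. -/
def forceCoord (L : LinOp n r d₁ d₂) (hb : s - r ≤ b) (F : Force n d₁ d₂ m s b) :
    (k : CauIndex d₁ d₂) → Sobolev n m (cauExp r s k)
  | Sum.inl i => ∑ j, L.γ⁻¹ i j • F.1 j
  | Sum.inr (Sum.inl _) => (0 : Sobolev n m s)
  | Sum.inr (Sum.inr j) => (IsMultiplier.one (n := n) (m := m) hb).clm (F.2 j)

/-- The Cauchy data `((γ⁰)⁻¹F₁, 0, F₂)`. -/
def forceData (L : LinOp n r d₁ d₂) (hb : s - r ≤ b) :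
    Force n d₁ d₂ m s b →L[ℝ] Cau n r d₁ d₂ m s where
  toFun F := cauMk (forceCoord L hb F)
  map_add' F F' := cau_ext fun k => by
    rw [map_add, cauCoord_cauMk, cauCoord_cauMk, cauCoord_cauMk]
    rcases k with i | j | j
    · change ∑ j, L.γ⁻¹ i j • (F.1 j + F'.1 j) =
        (∑ j, L.γ⁻¹ i j • F.1 j : Sobolev n m s) + ∑ j, L.γ⁻¹ i j • F'.1 j
      simp only [smul_add, Finset.sum_add_distrib]
    · exact (add_zero (0 : Sobolev n m s)).symm
    · exact map_add (IsMultiplier.one (n := n) (m := m) hb).clm (F.2 j) (F'.2 j)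
  map_smul' a F := cau_ext fun k => by
    rw [map_smul, cauCoord_cauMk, cauCoord_cauMk]
    rcases k with i | j | j
    · change ∑ j, L.γ⁻¹ i j • a • F.1 j = a • (∑ j, L.γ⁻¹ i j • F.1 j : Sobolev n m s)
      rw [Finset.smul_sum]
      exact Finset.sum_congr rfl fun j _ => smul_comm _ _ _
    · exact (smul_zero a : a • (0 : Sobolev n m s) = 0).symm
    · exact map_smul (IsMultiplier.one (n := n) (m := m) hb).clm a (F.2 j)
  cont := by
    refine continuous_cauMk fun k => ?_
    rcases k with i | j | j
    · change Continuous fun F : Force n d₁ d₂ m s b => ∑ j, L.γ⁻¹ i j • F.1 j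
      fun_prop
    · exact (continuous_const : Continuous fun _ : Force n d₁ d₂ m s b => (0 : Sobolev n m s))
    · change Continuous fun F : Force n d₁ d₂ m s b => _
      exact (IsMultiplier.one (n := n) (m := m) hb).clm.continuous.comp (by fun_prop)

theorem cauCoord_forceData (hb : s - r ≤ b) (F : Force n d₁ d₂ m s b) (k : CauIndex d₁ d₂) :
    cauCoord k (forceData L hb F) = forceCoord L hb F k := cauCoord_cauMk _ _

/-- The Fourier transforms of the components of `F`. -/
def forceHat (F : Force n d₁ d₂ m s b) (η : Sp n) : Fin d₁ ⊕ Fin d₂ → ℂ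
  | Sum.inl j => (F.1 j).hat η
  | Sum.inr j => (F.2 j).hat η

/-- The index of the component `uⁱ` in the Cauchy data. -/
def cauIndex : Fin d₁ ⊕ Fin d₂ → CauIndex d₁ d₂
  | Sum.inl i => Sum.inl i
  | Sum.inr j => Sum.inr (Sum.inl j)

/-- The E₁-part of the Green function is the propagator times (γ⁰)⁻¹, and its E₂-part is the block
that sends velocity to displacement. One null set works for all τ. -/
theorem hat_forceData (hb : s - r ≤ b) (F : Force n d₁ d₂ m s b) :
    ∀ᵐ η, ∀ (τ : ℝ) (i : Fin d₁ ⊕ Fin d₂),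
      ∑ l, propagator L τ ((2 * Real.pi) • η) (cauIndex i) l *
        (cauCoord l (forceData L hb F)).hat η =
      ∑ j, greenHat L τ ((2 * Real.pi) • η) i j * forceHat F η j := by
  have h1 : ∀ i, ∀ᵐ η, (cauCoord (Sum.inl i) (forceData L hb F)).hat η =
      ∑ j, ((L.γ⁻¹ i j : ℝ) : ℂ) * (F.1 j).hat η := by
    intro i
    rw [cauCoord_forceData]
    change ∀ᵐ η, (∑ j, L.γ⁻¹ i j • F.1 j).hat η = _
    filter_upwards [Sobolev.hat_sum Finset.univ fun j => L.γ⁻¹ i j • F.1 j,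
      ae_all_iff.2 fun j => Sobolev.hat_smul (L.γ⁻¹ i j) (F.1 j)] with η h1 h2
    rw [h1]
    exact Finset.sum_congr rfl fun j _ => h2 j
  have h2 : ∀ j, ∀ᵐ η, (cauCoord (Sum.inr (Sum.inl j)) (forceData L hb F)).hat η = 0 := by
    intro j
    rw [cauCoord_forceData]
    exact (Sobolev.hat_zero : (0 : Sobolev n m s).hat =ᵐ[volume] fun _ => 0)
  have h3 : ∀ j, ∀ᵐ η, (cauCoord (Sum.inr (Sum.inr j)) (forceData L hb F)).hat η =
      (F.2 j).hat η := by
    intro j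
    rw [cauCoord_forceData]
    filter_upwards [(IsMultiplier.one (n := n) (m := m) hb).hat_clm (F.2 j)] with η h
    rw [one_mul] at h
    exact h
  filter_upwards [ae_all_iff.2 h1, ae_all_iff.2 h2, ae_all_iff.2 h3] with η h1 h2 h3 τ i
  rw [Fintype.sum_sum_type, Fintype.sum_sum_type, Fintype.sum_sum_type]
  simp only [h1, h2, h3, mul_zero, Finset.sum_const_zero, zero_add]
  rcases i with i | i
  · simp only [greenHat, propagator, cauIndex, Matrix.fromBlocks_apply₁₁,
      Matrix.fromBlocks_apply₁₂, Matrix.zero_apply, zero_mul, Finset.sum_const_zero, add_zero,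
      greenHat₁_eq, map_ofReal_inv L.isUnit_γ, Matrix.mul_apply, Finset.mul_sum, Finset.sum_mul,
      forceHat, Matrix.map_apply]
    rw [Finset.sum_comm]
    simp only [mul_assoc]
  · simp only [greenHat, propagator, cauIndex, Matrix.fromBlocks_apply₂₁,
      Matrix.fromBlocks_apply₂₂, Matrix.zero_apply, zero_mul, Finset.sum_const_zero, zero_add,
      greenHat₂_eq, forceHat]
    rfl

theorem fourier_toL2_ae_eq (hs : 0 ≤ s) (T : Sobolev n m s) :
    (𝓕 (toL2 hs T) : Lp ℂ 2 (volume : Measure (Sp n))) =ᵐ[volume] T.hat := by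
  refine (T.hat_eq_of_hasHat (s' := 0) ?_ ?_).symm
  · rw [toDist_eq_toL2 hs]
    exact hasHat_toTemperedDistribution _
  · have e : ∀ η : Sp n, weight n m 0 η = (2 * Real.pi) ^ ((n : ℝ) / 2) := fun η => by
      simp [weight]
    simp only [e]
    exact (Lp.memLp _).const_mul _

variable {C D : ℝ} {I : Set ℝ} [I.OrdConnected]

theorem toDist_comp_eq (φ : I →ᵇ Cau n r d₁ d₂ m s) (t : I) (i : Fin d₁ ⊕ Fin d₂) :
    comp φ t i = (cauCoord (cauIndex i) (φ t)).toDist := by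
  rcases i with i | i <;> rfl

theorem cauExp_cauIndex_nonneg (r : ℕ) (hs : 0 ≤ s) (i : Fin d₁ ⊕ Fin d₂) :
    0 ≤ cauExp r s (cauIndex i) := by
  rcases i with i | i <;> exact hs

/-- The solution with Cauchy data `((γ⁰)⁻¹F₁, 0, F₂)` at time `t` is the Duhamel integral. -/
theorem isDuhamelIntegral_of_evolution (H : IsPropagatorBound L m s C D) (hs : 0 ≤ s) (hb0 : 0 ≤ b)
    (hb : s - r ≤ b) {N : FormalMultilinearSeries ℝ (JetSpace n d₁ d₂) (Target d₁ d₂)} {t : I}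
    {φ ψ : I →ᵇ Cau n r d₁ d₂ m s} {F : Force n d₁ d₂ m s b}
    (h₁ : ∀ i, ∀ᵐ y, HasSum (fun k => N k (fun _ => jetFun (φ t) y) (Sum.inl i))
      (rep hs (F.1 i) y))
    (h₂ : ∀ j, ∀ᵐ y, HasSum (fun k => N k (fun _ => jetFun (φ t) y) (Sum.inr j))
      (rep hb0 (F.2 j) y))
    (hψ : ∀ τ : I, ψ τ = evolution H ((τ : ℝ) - t) (forceData L hb F)) :
    IsDuhamelIntegral L N t φ ψ := by
  let G : Fin d₁ ⊕ Fin d₂ → Lp ℂ 2 (volume : Measure (Sp n)) :=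
    Sum.elim (fun i => toL2 hs (F.1 i)) (fun j => toL2 hb0 (F.2 j))
  have hsum : ∀ᵐ y, HasSum (fun k => N k fun _ => jetFun (φ t) y)
      (Sum.elim (fun i => rep hs (F.1 i) y) (fun j => rep hb0 (F.2 j) y)) := by
    filter_upwards [ae_all_iff.2 h₁, ae_all_iff.2 h₂] with y h1 h2
    rw [Pi.hasSum]
    rintro (i | j)
    · exact h1 i
    · exact h2 j
  have hG : ∀ᵐ η, ∀ j, (𝓕 (G j) : Lp ℂ 2 (volume : Measure (Sp n))) η = forceHat F η j := by
    rw [ae_all_iff]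
    rintro (j | j)
    · exact fourier_toL2_ae_eq hs (F.1 j)
    · exact fourier_toL2_ae_eq hb0 (F.2 j)
  refine ⟨?_, G, fun j => ?_, fun τ i => ?_⟩
  · filter_upwards [hsum] with y h
    exact h.summable
  · rcases j with i | j
    · filter_upwards [hsum, toL2_ae_eq hs (F.1 i)] with y h1 h2
      -- `N.sum` is the sum of the series, and the jet of φ at time t unfolds to `jetFun (φ t)`.
      have h3 : N.sum (jet φ t y) = _ := h1.tsum_eq
      rw [h3]
      exact h2
    · filter_upwards [hsum, toL2_ae_eq hb0 (F.2 j)] with y h1 h2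
      have h3 : N.sum (jet φ t y) = _ := h1.tsum_eq
      rw [h3]
      exact h2
  · have hsi := cauExp_cauIndex_nonneg r hs i
    refine ⟨𝓕 (toL2 hsi (cauCoord (cauIndex i) (ψ τ))), ?_, ?_⟩
    · refine (fourier_toL2_ae_eq hsi _).trans ?_
      rw [hψ]
      filter_upwards [hat_evolution H ((τ : ℝ) - t) (forceData L hb F) (cauIndex i), hG,
        hat_forceData hb F (L := L)] with η h1 h2 h3
      rw [h1, h3]
      exact Finset.sum_congr rfl fun j _ => by rw [h2]
    · rw [toDist_comp_eq, toDist_eq_toL2 hsi, Lp.fourier_toTemperedDistribution_eq]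

/-- The evolution is bounded on `I`, forward and backward in time. -/
theorem exists_norm_evolution_le {I : Set ℝ} (H : IsPropagatorBound L m s C D) (hC : 0 ≤ C)
    (hD : 0 ≤ D) (hI : D = 0 ∨ Bornology.IsBounded I) : ∃ B : ℝ, 0 < B ∧ ∀ t ∈ I,
      ‖(evolution H t : Cau n r d₁ d₂ m s →L[ℝ] Cau n r d₁ d₂ m s)‖ ≤ B ∧
      ‖(evolution H (-t) : Cau n r d₁ d₂ m s →L[ℝ] Cau n r d₁ d₂ m s)‖ ≤ B := by
  -- The growth term D|t| is either absent or bounded on a bounded interval. The bound is even in t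
  -- and so covers both directions of time.
  have hR : ∃ R : ℝ, 0 ≤ R ∧ ∀ t ∈ I, D * |t| ≤ R := by
    rcases hI with h | h
    · exact ⟨0, le_rfl, fun t _ => by rw [h, zero_mul]⟩
    · obtain ⟨R, hR⟩ := h.exists_norm_le
      refine ⟨D * |R|, by positivity, fun t ht => ?_⟩
      have := (hR t ht).trans (le_abs_self R)
      rw [Real.norm_eq_abs] at this
      gcongr
  obtain ⟨R, hR0, hR⟩ := hR
  have h : ∀ t, D * |t| ≤ R →
      ‖(evolution H t : Cau n r d₁ d₂ m s →L[ℝ] Cau n r d₁ d₂ m s)‖ ≤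
        Fintype.card (CauIndex d₁ d₂) * (C + R) + 1 := by
    intro t ht
    have h1 := norm_evolution_le H (τ := t) (by positivity)
    have h2 : (Fintype.card (CauIndex d₁ d₂) : ℝ) * (C + D * |t|) ≤
        Fintype.card (CauIndex d₁ d₂) * (C + R) := by gcongr
    linarith
  exact ⟨Fintype.card (CauIndex d₁ d₂) * (C + R) + 1, by positivity, fun t ht =>
    ⟨h t (hR t ht), h (-t) (by rw [abs_neg]; exact hR t ht)⟩⟩

/-- The components of an analytic map combine to an analytic map. -/
theorem exists_forceSeries {X : Type*} [NormedAddCommGroup X] [NormedSpace ℝ X] {ν : ℕ → ℝ}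
    (Φ₁ : Fin d₁ → FormalMultilinearSeries ℝ X (Sobolev n m s))
    (Φ₂ : Fin d₂ → FormalMultilinearSeries ℝ X (Sobolev n m b))
    (hs₁ : ∀ i, IsSymmetricSeries (Φ₁ i)) (hs₂ : ∀ j, IsSymmetricSeries (Φ₂ j))
    (hb₁ : ∀ i k, ‖Φ₁ i k‖ ≤ ν k) (hb₂ : ∀ j k, ‖Φ₂ j k‖ ≤ ν k) (hν : ∀ k, 0 ≤ ν k) :
    ∃ Φ : FormalMultilinearSeries ℝ X (Force n d₁ d₂ m s b), IsSymmetricSeries Φ ∧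
      (∀ k, ‖Φ k‖ ≤ ν k) ∧ ∀ x F, HasSum (fun k => Φ k fun _ => x) F →
        (∀ i, HasSum (fun k => Φ₁ i k fun _ => x) (F.1 i)) ∧
        ∀ j, HasSum (fun k => Φ₂ j k fun _ => x) (F.2 j) := by
  refine ⟨fun k => (ContinuousMultilinearMap.pi fun i => Φ₁ i k).prod
    (ContinuousMultilinearMap.pi fun j => Φ₂ j k), fun k σ x => ?_, fun k => ?_,
    fun x F hF => ⟨fun i => ?_, fun j => ?_⟩⟩
  · exact Prod.ext (funext fun i => hs₁ i k σ x) (funext fun j => hs₂ j k σ x)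
  · rw [ContinuousMultilinearMap.opNorm_prod]
    refine max_le ?_ ?_
    · rw [ContinuousMultilinearMap.opNorm_pi]
      exact (pi_norm_le_iff_of_nonneg (hν k)).2 fun i => hb₁ i k
    · rw [ContinuousMultilinearMap.opNorm_pi]
      exact (pi_norm_le_iff_of_nonneg (hν k)).2 fun j => hb₂ j k
  · exact hF.map ((LinearMap.proj i).comp (LinearMap.fst ℝ (Fin d₁ → Sobolev n m s)
      (Fin d₂ → Sobolev n m b))) ((continuous_apply i).comp continuous_fst)
  · exact hF.map ((LinearMap.proj j).comp (LinearMap.snd ℝ (Fin d₁ → Sobolev n m s)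
      (Fin d₂ → Sobolev n m b))) ((continuous_apply j).comp continuous_snd)

end Forcing

/-- `exists_isNormalFamily` for the evaluations `φ ↦ [φ]_t` of `𝓔₀^s(I)`. -/
theorem exists_isNormalFamily_E0 {n r d₁ d₂ : ℕ} {m s : ℝ} [Fact (0 < m)]
    {L : LinOp n r d₁ d₂} {I : Set ℝ} [I.OrdConnected] {Y : Type*}
    [NormedAddCommGroup Y] [NormedSpace ℝ Y] [CompleteSpace Y]
    {Φ : FormalMultilinearSeries ℝ (Cau n r d₁ d₂ m s) Y} (hΦ : IsSymmetricSeries Φ) {ν : ℕ → ℝ}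
    (hν : ∀ k, ‖Φ k‖ ≤ ν k) {A : I → Y →L[ℝ] Cau n r d₁ d₂ m s} {B : ℝ} (hB : 0 < B)
    (hA : ∀ t, ‖A t‖ ≤ B) (hAc : ∀ y, Continuous fun t => A t y)
    {S : Cau n r d₁ d₂ m s →ₗ[ℝ] E0 L m s I} {B' : ℝ} (hB' : 0 < B')
    (hS : ∀ c, ‖S c‖ ≤ B' * ‖c‖) :
    ∃ V : I → E0 L m s I → E0 L m s I,
      (∀ t, ∀ φ ∈ oball (E0 L m s I)
          (FormalMultilinearSeries.ofScalars ℝ fun k => B' * B * ν k).radius,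
        ∃ F, HasSum (fun k => Φ k fun _ => φ.1 t) F ∧ V t φ = S (A t F)) ∧
      ContinuousOn (fun x : I × E0 L m s I => V x.1 x.2) {x | x.2 ∈ oball (E0 L m s I)
        (FormalMultilinearSeries.ofScalars ℝ fun k => B' * B * ν k).radius} ∧
      IsNormalFamily V (FormalMultilinearSeries.ofScalars ℝ fun k => B' * B * ν k).radius := by
  have h := fun hev => exists_isNormalFamily (X := E0 L m s I) (A := A) (S := S) (B := B)
    (B' := B') hΦ hν (ev := cauchyData L m s I) hev continuous_cauchyData hB hA hAc hB' hS
  exact h norm_cauchyData_le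

end

end LagrangeDuhamel

end

/-! ### Assembly of the proposition. -/

theorem proposition2p1 (n r d₁ d₂ : ℕ) (hr : 1 ≤ r) (m s : ℝ) [Fact (0 < m)] :
    ∃ Q : ℝ≥0, 0 < Q ∧
      ∀ (L : LinOp n r d₁ d₂) (α μ₀ : ℝ), 0 < α → 0 ≤ μ₀ → L.LowerBound α μ₀ →
      ∀ (I : Set ℝ) [I.OrdConnected], I.Nontrivial → (0 < μ₀ ∨ Bornology.IsBounded I) →
      ∀ N : FormalMultilinearSeries ℝ (JetSpace n d₁ d₂) (Target d₁ d₂),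
        IsSymmetricSeries N → 0 < N.radius → N 0 = 0 → FirstPartIndep N →
        ((SecondPartIndep N ∧ (n : ℝ) / 2 < s) ∨
          (SecondPartAffine N ∧ (n : ℝ) / 2 < s ∧ s - r < (n : ℝ) / 2 ∧ 0 ≤ s - r) ∨
          ((n : ℝ) / 2 + 1 < s ∧
            ((n : ℝ) / 2 < s - r ∨ (0 ≤ s - r ∧ SecondPartAffineTime N) ∨
              SecondPartIndepTime N))) →
        ∃ ρ : ℝ≥0∞, N.radius ≤ Q * ρ ∧
          ∃ V : I → E0 L m s I → E0 L m s I,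
            (∀ (t : I), ∀ φ ∈ oball (E0 L m s I) ρ, IsDuhamelIntegral L N t φ.1 (V t φ).1) ∧
            ContinuousOn (fun x : I × E0 L m s I => V x.1 x.2) {x | x.2 ∈ oball (E0 L m s I) ρ} ∧
            IsNormalFamily V ρ := by
  obtain ⟨Q, hQ, hN⟩ := exists_nonlinearity n r d₁ d₂ hr m s
  lift Q to ℝ≥0 using hQ.le
  have hQ0 : 0 < Q := by exact_mod_cast hQ
  refine ⟨Q, hQ0, fun L α μ₀ hα hμ hL I _ _ hI N hsymm hrad hN0 hN1 hcase => ?_⟩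
  obtain ⟨b, hb0, hs, hb, h₁, h₂⟩ := hN N hsymm hrad hN0 hN1 hcase
  obtain ⟨C, D, hC, hD, hμD, H⟩ := exists_isMultiplier_propagator (m := m) s L hα hμ hL
  change IsPropagatorBound L m s C D at H
  obtain ⟨B, hB0, hB⟩ := exists_norm_evolution_le H hC hD (I := I) (hI.imp_left hμD)
  choose Φ₁ hs₁ hb₁ hΦ₁ using h₁
  choose Φ₂ hs₂ hb₂ hΦ₂ using h₂
  obtain ⟨Φ, hΦs, hΦb, hΦF⟩ := exists_forceSeries Φ₁ Φ₂ hs₁ hs₂ hb₁ hb₂ fun k => by positivity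
  let Λ : Force n d₁ d₂ m s b →L[ℝ] Cau n r d₁ d₂ m s := forceData L hb
  -- The data created at time t are transported back to time 0, the reference time of `solve`; 0
  -- need not belong to I because the evolution exists on all of ℝ.
  let A : I → Force n d₁ d₂ m s b →L[ℝ] Cau n r d₁ d₂ m s := fun t => (evolution H (-t)).comp Λ
  have hA : ∀ t, ‖A t‖ ≤ B * (‖Λ‖ + 1) := fun t =>
    (ContinuousLinearMap.opNorm_comp_le _ _).trans
      (mul_le_mul (hB t t.2).2 (by linarith) (norm_nonneg _) hB0.le)
  have hAc : ∀ F, Continuous fun t => A t F := fun F =>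
    (continuous_evolution H hD (Λ F)).comp (continuous_subtype_val.neg)
  have hBΛ : 0 < B * (‖Λ‖ + 1) := by positivity
  obtain ⟨V, hV, hVc, hVn⟩ := exists_isNormalFamily_E0 hΦs hΦb hBΛ hA hAc
    (S := solve I H hD fun t ht => (hB t ht).1) hB0
    (norm_solve_le H hD hB0.le fun t ht => (hB t ht).1)
  refine ⟨_, radius_le_mul_radius_ofScalars N hQ0 (B := B * (B * (‖Λ‖ + 1))) (by positivity), V,
    fun t φ hφ => ?_, hVc, hVn⟩
  obtain ⟨F, hF, hVF⟩ := hV t φ hφ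
  -- A radius τ strictly between ‖φ‖ and ρ is positive even for φ = 0, and the majorant converges
  -- there; this is the condition for pointwise convergence of N(φ,∂φ).
  obtain ⟨τ, hτ1, hτ2⟩ := ENNReal.lt_iff_exists_nnreal_btwn.1 hφ
  have hτ0 : 0 < τ := by
    have : ‖φ‖₊ < τ := by exact_mod_cast hτ1
    exact lt_of_le_of_lt zero_le this
  have hφτ : ‖φ.1 t‖ ≤ τ := by
    have h1 : ‖φ‖₊ < τ := by exact_mod_cast hτ1
    exact (norm_cauchyData_le t φ).trans (by exact_mod_cast h1.le)
  have hsummable : Summable fun k => ‖N k‖ * ((Q : ℝ) * τ) ^ k := by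
    have h1 := (summable_of_lt_radius_ofScalars hτ2).mul_left (B * (B * (‖Λ‖ + 1)))⁻¹
    refine h1.congr fun k => ?_
    rw [abs_of_nonneg (by positivity), ← mul_assoc, inv_mul_cancel_left₀ (by positivity), mul_pow]
    ring
  obtain ⟨hF₁, hF₂⟩ := hΦF _ _ hF
  have hτ0' : (0 : ℝ) < τ := by exact_mod_cast hτ0
  refine isDuhamelIntegral_of_evolution H hs hb0 hb (F := F)
    (fun i => hΦ₁ i (φ.1 t) τ hτ0' hφτ hsummable _ (hF₁ i))
    (fun j => hΦ₂ j (φ.1 t) τ hτ0' hφτ hsummable _ (hF₂ j)) fun τ => ?_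
  rw [hVF]
  change evolution H τ (evolution H (-t) (Λ F)) = _
  -- The group law turns U(τ)U(-t) into U(τ-t), which is the propagator in the Duhamel formula.
  rw [← evolution_add, sub_eq_add_neg (τ : ℝ) t]
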